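/- Let $\Sigma$ be the set of real antisymmetric tensors $Q^{\mu\nu}$, $\mu,\nu=0,\dots,3$, whose electric and magnetic parts $e_i=Q^{0i}$, $m_i=\tfrac12\epsilon_{ijk}Q^{jk}$ satisfy $\vec e^{\,2}=\vec m^{\,2}$ and $\vec e\cdot\vec m=\pm1$ (Planck units). Consider any regular representation, on a Hilbert space $H$, of the coordinates of four independent events of Quantum Spacetime: a nondegenerate representation $f\mapsto f(Q)$ of $C_b(\Sigma)$ (nondegenerate on compactly supported functions), and for each event $j=1,\dots,4$ a strongly continuous family of unitaries $e^{i\alpha_\mu q_j^\mu}$, $\alpha\in\mathbb R^4$, commuting with all $f(Q)$ and with the unitaries of the other events, such that $$e^{i\alpha_\mu q_j^\mu}e^{i\beta_\nu q_j^\nu}=e^{-\frac i2\alpha_\mu Q^{\mu\nu}\beta_\nu}e^{i(\alpha+\beta)_\mu q_j^\mu}.$$ The coordinate $q_j^\mu$ is the selfadjoint generator of $t\mapsto e^{itq_j^\mu}$, and $D$ is the largest subspace of $H$ contained in the domains of all $q_j^\mu$ and invariant under them. On $D$ one has $[q_j^\mu,q_k^\nu]=i\delta_{jk}Q^{\mu\nu}$.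 With $\epsilon_{0123}=1$, define on $D$ $$V_\sigma=\epsilon_{\mu\nu\rho\sigma}\,dq^\mu dq^\nu dq^\rho=\epsilon_{\mu\nu\rho\sigma}(q_2^\mu-q_1^\mu)(q_3^\nu-q_2^\nu)(q_4^\rho-q_3^\rho),$$ $$A_\sigma=\tfrac16\,\epsilon_{\mu\nu\rho\sigma}\det\bigl(1,\,q_j^\mu,\,q_j^\nu,\,q_j^\rho\bigr)_{j=1,\dots,4},\qquad B_\sigma=\tfrac12\,\epsilon_{\mu\nu\rho\sigma}Q^{\mu\nu}(q_1^\rho-q_2^\rho+q_3^\rho-q_4^\rho),$$ and write $\overline T$ for the closure of an operator $T$ on $D$. Then, for $\sigma,\rho=0,\dots,3$: 1. $V_\sigma=A_\sigma+iB_\sigma$ on $D$, where $A_\sigma$ and $B_\sigma$ are essentially selfadjoint on $D$ and $A_\sigma B_\sigma=B_\sigma A_\sigma$ on $D$; the operator $\overline{V_\sigma}$ is normal. 2. $[B_\sigma,B_\rho]=4i\,Q^{-1}_{\sigma\rho}$ on $D$, where $Q^{-1}$ is the inverse tensor normalized by $Q^{-1}_{\sigma\rho}Q^{\mu\rho}=\delta^\mu_\sigma$.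 3. $V_\sigma^*V_\sigma=A_\sigma^2+B_\sigma^2$ on $D$, and $$\sum_\sigma V_\sigma^*V_\sigma\;\ge\;\sum_\sigma B_\sigma^2\;\ge\;8$$ in the sense of quadratic forms: every $\psi\in\bigcap_\sigma\mathrm{dom}\,\overline{V_\sigma}$ lies in $\bigcap_\sigma\mathrm{dom}\,\overline{B_\sigma}$ and satisfies $\sum_\sigma\|\overline{V_\sigma}\psi\|^2\ge\sum_\sigma\|\overline{B_\sigma}\psi\|^2$, and every $\psi\in\bigcap_\sigma\mathrm{dom}\,\overline{B_\sigma}$ satisfies $\sum_\sigma\|\overline{B_\sigma}\psi\|^2\ge8\|\psi\|^2$. -/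

import Mathlib

open scoped Matrix BoundedContinuousFunction LinearPMap

namespace QST

noncomputable section

/-! ### The joint spectrum of the commutators -/

/-- The electric components `e_i = Q^{0i}` of a two-tensor. -/
def elec (s : Matrix (Fin 4) (Fin 4) ℝ) : Fin 3 → ℝ := ![s 0 1, s 0 2, s 0 3]

/-- The magnetic components `m_i = Q^{jk}`, `(i, j, k)` cyclic, of a two-tensor. -/
def magn (s : Matrix (Fin 4) (Fin 4) ℝ) : Fin 3 → ℝ := ![s 2 3, s 3 1, s 1 2]

/-- The manifold `Σ` of the real antisymmetric two-tensors `Q^{μν}` that fulfil the quantum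
conditions `e² = m²` and `e · m = ±1`. -/
def jointSpectrum : Set (Matrix (Fin 4) (Fin 4) ℝ) :=
  {s | sᵀ = -s ∧ elec s ⬝ᵥ elec s = magn s ⬝ᵥ magn s ∧
    (elec s ⬝ᵥ magn s = 1 ∨ elec s ⬝ᵥ magn s = -1)}

/-- The bounded continuous function `Q ↦ exp (-(i/2) α_μ Q^{μν} β_ν)` on `Σ`. -/
def weylPhase (α β : Fin 4 → ℝ) : jointSpectrum →ᵇ ℂ :=
  BoundedContinuousFunction.ofNormedAddCommGroup
    (fun s => Complex.exp (((-(1 / 2) * (α ⬝ᵥ (s : Matrix (Fin 4) (Fin 4) ℝ) *ᵥ β) : ℝ) : ℂ) *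
      Complex.I))
    (by fun_prop) 1 (fun s => (Complex.norm_exp_ofReal_mul_I _).le)

/-! ### Regular representations of the algebra of four independent events -/

/-- A regular representation, on the Hilbert space `H`, of the algebra of four independent events:
the fourth tensor power of the algebra of Quantum Spacetime over the algebra `C_b(Σ)`, the centre
of its multiplier algebra.

It is given by a nondegenerate representation `central` of `C_b(Σ)`, and, for each event `j`, by
the strongly continuous Weyl operators `weyl j α = exp (i α_μ q_j^μ)`. All events share the same
`central`, which is what the tensor product over the centre means, and the Weyl operators of
different events commute. -/
structure RegularRep (H : Type*) [NormedAddCommGroup H] [InnerProductSpace ℂ H]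
    [CompleteSpace H] where
  central : (jointSpectrum →ᵇ ℂ) →⋆ₐ[ℂ] (H →L[ℂ] H)
  weyl : Fin 4 → (Fin 4 → ℝ) → unitary (H →L[ℂ] H)
  central_nondegenerate :
    Dense (Submodule.span ℂ {φ : H | ∃ (f : jointSpectrum →ᵇ ℂ) (ψ : H),
      HasCompactSupport f ∧ φ = central f ψ} : Set H)
  central_comm : ∀ (f : jointSpectrum →ᵇ ℂ) (j : Fin 4) (α : Fin 4 → ℝ),
    Commute (central f) (weyl j α : H →L[ℂ] H)
  weyl_continuous : ∀ (j : Fin 4) (ψ : H),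
    Continuous fun α : Fin 4 → ℝ => (weyl j α : H →L[ℂ] H) ψ
  weyl_mul : ∀ (j : Fin 4) (α β : Fin 4 → ℝ),
    (weyl j α : H →L[ℂ] H) * (weyl j β : H →L[ℂ] H) =
      central (weylPhase α β) * (weyl j (α + β) : H →L[ℂ] H)
  weyl_comm : ∀ (j k : Fin 4) (α β : Fin 4 → ℝ), j ≠ k →
    Commute (weyl j α : H →L[ℂ] H) (weyl k β : H →L[ℂ] H)

variable {H : Type*} [NormedAddCommGroup H] [InnerProductSpace ℂ H] [CompleteSpace H]

/-- The orbit `t ↦ exp (i t q_j^μ) ψ`. -/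
def RegularRep.orbit (π : RegularRep H) (j μ : Fin 4) (ψ : H) (t : ℝ) : H :=
  (π.weyl j (t • Pi.single μ 1) : H →L[ℂ] H) ψ

/-- The coordinate operator `q_j^μ` of the event `j`: the infinitesimal generator of the
one-parameter unitary group `t ↦ exp (i t q_j^μ)`, with its full domain. -/
def RegularRep.coord (π : RegularRep H) (j μ : Fin 4) : H →ₗ.[ℂ] H where
  domain :=
    { carrier := {ψ | DifferentiableAt ℝ (π.orbit j μ ψ) 0}
      zero_mem' := by
        have : π.orbit j μ 0 = fun _ => 0 := by funext t; simp [RegularRep.orbit]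
        simp [this]
      add_mem' := by
        intro a b ha hb
        have : π.orbit j μ (a + b) = π.orbit j μ a + π.orbit j μ b := by
          funext t; simp [RegularRep.orbit]
        simp only [Set.mem_ofPred_eq] at ha hb ⊢
        rw [this]
        exact ha.add hb
      smul_mem' := by
        intro c a ha
        have : π.orbit j μ (c • a) = c • π.orbit j μ a := by
          funext t; simp [RegularRep.orbit]
        simp only [Set.mem_ofPred_eq] at ha ⊢
        rw [this]
        exact ha.const_smul c }
  toFun :=
    { toFun := fun ψ => (-Complex.I) • deriv (π.orbit j μ ψ) 0
      map_add' := by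
        rintro ⟨a, ha⟩ ⟨b, hb⟩
        have : π.orbit j μ (a + b) = π.orbit j μ a + π.orbit j μ b := by
          funext t; simp [RegularRep.orbit]
        simp only [Submodule.coe_add]
        rw [this, deriv_add ha hb, smul_add]
      map_smul' := by
        rintro c ⟨a, ha⟩
        have : π.orbit j μ (c • a) = c • π.orbit j μ a := by
          funext t; simp [RegularRep.orbit]
        simp only [Submodule.coe_smul, RingHom.id_apply]
        rw [this, deriv_const_smul c ha, smul_comm] }

/-- A subspace on which all coordinate operators are defined and which they map into itself. -/
def RegularRep.IsInvariant (π : RegularRep H) (D : Submodule ℂ H) : Prop :=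
  ∀ j μ : Fin 4, ∃ h : D ≤ (π.coord j μ).domain, ∀ ψ : D, π.coord j μ ⟨ψ, h ψ.2⟩ ∈ D

/-- The smooth vectors: the largest common invariant domain of the coordinate operators. All
polynomials in the coordinates are defined there. -/
def RegularRep.smooth (π : RegularRep H) : Submodule ℂ H :=
  sSup {D | π.IsInvariant D}

theorem RegularRep.smooth_isInvariant (π : RegularRep H) : π.IsInvariant π.smooth := by
  intro j μ
  have hle : π.smooth ≤ (π.coord j μ).domain := sSup_le fun D hD => (hD j μ).1
  refine ⟨hle, ?_⟩
  rintro ⟨ψ, hψ⟩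
  have key : π.smooth ≤ (π.smooth.comap (π.coord j μ).toFun).map (π.coord j μ).domain.subtype := by
    refine sSup_le fun D hD x hx => ?_
    obtain ⟨h, h'⟩ := hD j μ
    exact ⟨⟨x, h hx⟩, (le_sSup hD : D ≤ π.smooth) (h' ⟨x, hx⟩), rfl⟩
  obtain ⟨y, hy, hyψ⟩ := key hψ
  have : y = ⟨ψ, hle hψ⟩ := Subtype.ext hyψ
  rw [← this]
  exact hy

/-- The coordinate `q_j^μ` as an operator on the smooth vectors. -/
def RegularRep.q (π : RegularRep H) (j μ : Fin 4) : Module.End ℂ π.smooth where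
  toFun ψ := ⟨π.coord j μ ⟨ψ, (π.smooth_isInvariant j μ).1 ψ.2⟩, (π.smooth_isInvariant j μ).2 ψ⟩
  map_add' a b := Subtype.ext ((π.coord j μ).map_add
    ⟨a, (π.smooth_isInvariant j μ).1 a.2⟩ ⟨b, (π.smooth_isInvariant j μ).1 b.2⟩)
  map_smul' c a := Subtype.ext ((π.coord j μ).map_smul c
    ⟨a, (π.smooth_isInvariant j μ).1 a.2⟩)

/-- The commutator tensor `Q^{μν} = -i [q^μ, q^ν]` on the smooth vectors, read off at the first
event. -/
def RegularRep.Q (π : RegularRep H) (μ ν : Fin 4) : Module.End ℂ π.smooth :=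
  (-Complex.I) • (π.q 0 μ * π.q 0 ν - π.q 0 ν * π.q 0 μ)

/-- `π.IsCentralApply f ψ φ` says that `φ = f(Q) ψ`, where `f` is a function on `Σ` (continuous,
possibly unbounded) and `f(Q)` is the corresponding operator with its maximal domain:
`(f g)(Q) ψ = g(Q) φ` for every compactly supported continuous `g`. The vector `φ` is determined
by `f` and `ψ` because `central` is nondegenerate. -/
def RegularRep.IsCentralApply (π : RegularRep H) (f : jointSpectrum → ℂ) (ψ φ : H) : Prop :=
  ∀ g h : jointSpectrum →ᵇ ℂ, HasCompactSupport g → (∀ s, h s = f s * g s) →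
    π.central h ψ = π.central g φ

/-! ### The three-volume operators -/

/-- The Levi-Civita symbol, with `ε_{0123} = 1`. -/
def eps (μ ν ρ σ : Fin 4) : ℤ :=
  Matrix.det (Matrix.of fun i j : Fin 4 => if ![μ, ν, ρ, σ] i = j then (1 : ℤ) else 0)

/-- The determinant of a matrix in which entries of different rows commute. -/
def rowDet {R : Type*} [Ring R] (M : Matrix (Fin 4) (Fin 4) R) : R :=
  ∑ p : Equiv.Perm (Fin 4),
    (Equiv.Perm.sign p : ℤ) • (M (p 0) 0 * M (p 1) 1 * M (p 2) 2 * M (p 3) 3)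

/-- The component `V_σ = ε_{μνρσ} dq^μ dq^ν dq^ρ` of the three-volume operator of four independent
events. In the universal differential calculus `dq = 1 ⊗ q - q ⊗ 1` and
`(a ⊗ b)(c ⊗ d) = a ⊗ bc ⊗ d`, so that `dq^μ dq^ν dq^ρ`, as an element of the fourth tensor power,
is `(q_2^μ - q_1^μ)(q_3^ν - q_2^ν)(q_4^ρ - q_3^ρ)`. The events are numbered from `0` here. -/
def RegularRep.V (π : RegularRep H) (σ : Fin 4) : Module.End ℂ π.smooth :=
  ∑ μ, ∑ ν, ∑ ρ, eps μ ν ρ σ •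
    ((π.q 1 μ - π.q 0 μ) * (π.q 2 ν - π.q 1 ν) * (π.q 3 ρ - π.q 2 ρ))

/-- `A_σ = (1/6) det (1, q_j^μ, q_j^ν, q_j^ρ) ε_{μνρσ}`, the row index of the matrix being the
event `j`. -/
def RegularRep.A (π : RegularRep H) (σ : Fin 4) : Module.End ℂ π.smooth :=
  (1 / 6 : ℂ) • ∑ μ, ∑ ν, ∑ ρ, eps μ ν ρ σ •
    rowDet (Matrix.of fun j => ![1, π.q j μ, π.q j ν, π.q j ρ])

/-- `B_σ = (1/2) Q^{μν} (q_1^ρ - q_2^ρ + q_3^ρ - q_4^ρ) ε_{μνρσ}`. -/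
def RegularRep.B (π : RegularRep H) (σ : Fin 4) : Module.End ℂ π.smooth :=
  (1 / 2 : ℂ) • ∑ μ, ∑ ν, ∑ ρ, eps μ ν ρ σ •
    (π.Q μ ν * (π.q 0 ρ - π.q 1 ρ + π.q 2 ρ - π.q 3 ρ))

/-! ### Unbounded operators -/

/-- The closed operator in `H` that a polynomial `T` in the coordinates determines: the closure of
its restriction to the smooth vectors. -/
def RegularRep.cl (π : RegularRep H) (T : Module.End ℂ π.smooth) : H →ₗ.[ℂ] H :=
  (LinearPMap.mk π.smooth (π.smooth.subtype ∘ₗ T)).closure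

/-- An unbounded operator `T` is normal if it is closed and densely defined, `T` and `T*` have the
same domain, and `‖T ψ‖ = ‖T* ψ‖` there. -/
def IsNormalOp (T : H →ₗ.[ℂ] H) : Prop :=
  Dense (T.domain : Set H) ∧ T.IsClosed ∧ T.domain = T†.domain ∧
    ∀ (x : T.domain) (y : T†.domain), (x : H) = y → ‖T x‖ = ‖T† y‖

end

end QST

namespace QST

open Filter Topology

noncomputable section

/-! ### Compactly supported functions on the joint spectrum -/

/-! Algebra. Contraction with ε over three indices is the alternating sum over the directions `a, b,
c` other than σ. Expand the product in `V_σ`: the terms with three distinct events form the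
determinant `A_σ` (`alt_rowDet`), and in a term with a repeated event the alternation produces the
commutator `iQ` of that event, so these terms form `iB_σ` (`alt_differences`). With `y = q_1 - q_2 +
q_3 - q_4` one has `B_σ = Σ (*Q)_{ρσ} y^ρ` and `[y^κ, y^ρ] = 4i Q^{κρ}`, so `[B_σ, B_ρ]` is `4i`
times the entry of `(*Q)ᵀ Q (*Q)`. This matrix is the stated inverse, because `Q (*Q) = -(e·m) 1`
and `(e·m)² = 1`. Every `q_j^κ` with κ ≠ σ commutes with `B_σ` (`comm_cyclic`), hence so does `A_σ`.

Selfadjointness. Products of Gaussian averages of the Weyl operators of the four events, cut off in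
the centre, map `H` into the smooth vectors (`smearAll_mem_smooth`) and tend to the identity. If
their commutators with `T` tend to zero in norm, then applying them to a vector in the domain of the
adjoint of `T` shows that the vector lies in the domain of the closure of the formal adjoint
(`FormalAdj.adjoint_cl`). For the average `K` of one event at scale ε, `qK = s + d` and `Kq = s -
d`, where `s` is of order `1/ε` and `d` of order `ε`. This suffices for `B_σ`, which is linear in
the `q_j`. For the cubic `A_σ` it only gives the order `1/ε`. The cure is that `d = wQs` up to the
contribution of the direction σ. A trilinear alternating form in three dimensions takes the same
value at `(1 + wQ)s` and `(1 - wQ)s`: the difference is a combination of the trace and the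
determinant of the antisymmetric 3×3 block of `Q`, and both vanish (`altMul_add_eq_altMul_sub`). The
direction σ is averaged at the finer scale `ε³`, which leaves an error of order `ε⁻² ε³ = ε`
(`SmearBound.A_term_commutator_moll`). Normality follows, since `V_σ` and its formal adjoint `A_σ -
iB_σ` have equal norms on smooth vectors and their closures are adjoint to each other.

Lower bound. Let `S(Q)` be the antisymmetric orthogonal matrix `frame`. Expanding `0 ≤ Σ_σ ‖B_σψ + i
Σ_ρ S_{σρ} B_ρψ‖²` gives `2 Σ ‖B_σψ‖²` minus four times the expectation of `Σ S_{σρ} Q⁻¹_{σρ} = 2|e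
+ (e·m)m|`. This function is at least 4, because `|e + (e·m)m|² = e² + m² + 2 ≥ 4`; hence the
constant 8. -/

theorem isClosed_jointSpectrum : IsClosed jointSpectrum := by
  have he : Continuous fun s : Matrix (Fin 4) (Fin 4) ℝ => elec s := by
    unfold elec; fun_prop
  have hm : Continuous fun s : Matrix (Fin 4) (Fin 4) ℝ => magn s := by
    unfold magn; fun_prop
  refine (isClosed_eq (by fun_prop) (by fun_prop)).inter
    ((isClosed_eq (by fun_prop) (by fun_prop)).inter
      ((isClosed_eq (by fun_prop) (by fun_prop)).union (isClosed_eq (by fun_prop) (by fun_prop))))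

/-- The sum of the squares of the entries of a point of the joint spectrum. -/
def sqSize (s : jointSpectrum) : ℝ := ∑ i, ∑ j, s.1 i j ^ 2

theorem continuous_sqSize : Continuous sqSize := by
  unfold sqSize
  exact continuous_finsetSum _ fun i _ => continuous_finsetSum _ fun j _ =>
    (continuous_subtype_val.matrix_elem i j).pow 2

theorem isCompact_sqSize_le (c : ℝ) : IsCompact {s : jointSpectrum | sqSize s ≤ c} := by
  rw [Subtype.isCompact_iff]
  have hK : IsCompact (Set.univ.pi fun _ : Fin 4 => Set.univ.pi fun _ : Fin 4 =>
      Set.Icc (-(c + 1)) (c + 1) : Set (Fin 4 → Fin 4 → ℝ)) :=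
    isCompact_univ_pi fun _ => isCompact_univ_pi fun _ => isCompact_Icc
  have hcl : IsClosed (Subtype.val '' {s : jointSpectrum | sqSize s ≤ c}) :=
    isClosed_jointSpectrum.isClosedEmbedding_subtypeVal.isClosedMap _
      (isClosed_le continuous_sqSize continuous_const)
  refine hK.of_isClosed_subset hcl ?_
  rintro _ ⟨s, hs, rfl⟩
  have hs' : sqSize s ≤ c := hs
  intro i _ j _
  have h1 : s.1 i j ^ 2 ≤ sqSize s :=
    (Finset.single_le_sum (f := fun j => s.1 i j ^ 2) (fun _ _ => sq_nonneg _)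
      (Finset.mem_univ j)).trans
      (Finset.single_le_sum (f := fun i => ∑ j, s.1 i j ^ 2)
        (fun _ _ => Finset.sum_nonneg fun _ _ => sq_nonneg _) (Finset.mem_univ i))
  constructor <;> nlinarith [sq_nonneg (s.1 i j - 1), sq_nonneg (s.1 i j + 1)]

/-- A continuous cutoff on the joint spectrum, equal to one where `sqSize s ≤ n`. -/
def cutoff (n : ℕ) : jointSpectrum →ᵇ ℂ :=
  BoundedContinuousFunction.ofNormedAddCommGroup
    (fun s => ((max 0 (min 1 (n + 1 - sqSize s)) : ℝ) : ℂ))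
    (by have := continuous_sqSize; fun_prop) 1 (fun s => by
      rw [Complex.norm_real, Real.norm_of_nonneg (le_max_left _ _)]
      exact max_le zero_le_one (min_le_left _ _))

theorem cutoff_apply (n : ℕ) (s : jointSpectrum) :
    cutoff n s = ((max 0 (min 1 (n + 1 - sqSize s)) : ℝ) : ℂ) := rfl

theorem cutoff_eq_one {n : ℕ} {s : jointSpectrum} (h : sqSize s ≤ n) : cutoff n s = 1 := by
  rw [cutoff_apply, min_eq_left (by linarith), max_eq_right zero_le_one, Complex.ofReal_one]

theorem hasCompactSupport_cutoff (n : ℕ) : HasCompactSupport (cutoff n) := by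
  refine HasCompactSupport.intro (isCompact_sqSize_le (n + 1)) fun s hs => ?_
  have hs' : (n : ℝ) + 1 < sqSize s := not_le.1 hs
  rw [cutoff_apply, max_eq_left ((min_le_right _ _).trans (by linarith)), Complex.ofReal_zero]

theorem norm_cutoff_le (n : ℕ) : ‖cutoff n‖ ≤ 1 :=
  BoundedContinuousFunction.norm_ofNormedAddCommGroup_le _ zero_le_one _

theorem star_cutoff (n : ℕ) : star (cutoff n) = cutoff n := by
  ext s
  rw [BoundedContinuousFunction.star_apply, cutoff_apply]
  exact Complex.conj_ofReal _

theorem exists_cutoff_mul_eq {h : jointSpectrum →ᵇ ℂ} (hh : HasCompactSupport h) :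
    ∃ N : ℕ, ∀ n ≥ N, cutoff n * h = h := by
  obtain ⟨C, hC⟩ := (hh.image continuous_sqSize).bddAbove
  obtain ⟨N, hN⟩ := exists_nat_ge C
  refine ⟨N, fun n hn => ?_⟩
  ext s
  by_cases hs : h s = 0
  · simp [hs]
  · have h1 : sqSize s ≤ C := hC ⟨s, subset_tsupport _ hs, rfl⟩
    have h2 : (N : ℝ) ≤ n := by exact_mod_cast hn
    simp [cutoff_eq_one (h1.trans (hN.trans h2))]

/-- The product of a continuous function and a compactly supported one, as a bounded function. -/
def cutMul (f : C(jointSpectrum, ℂ)) (g : jointSpectrum →ᵇ ℂ) (hg : HasCompactSupport g) :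
    jointSpectrum →ᵇ ℂ :=
  BoundedContinuousFunction.ofNormedAddCommGroup (fun s => f s * g s) (by fun_prop)
    (Classical.choose ((hg.mul_left (f := f)).exists_bound_of_continuous (by fun_prop)))
    (Classical.choose_spec ((hg.mul_left (f := f)).exists_bound_of_continuous (by fun_prop)))

@[simp] theorem cutMul_apply (f : C(jointSpectrum, ℂ)) (g : jointSpectrum →ᵇ ℂ)
    (hg : HasCompactSupport g) (s : jointSpectrum) : cutMul f g hg s = f s * g s := rfl

theorem hasCompactSupport_cutMul (f : C(jointSpectrum, ℂ)) {g : jointSpectrum →ᵇ ℂ}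
    (hg : HasCompactSupport g) : HasCompactSupport (cutMul f g hg) :=
  hg.mul_left (f := f)

theorem hasCompactSupport_mul_left {g : jointSpectrum →ᵇ ℂ} (f : jointSpectrum →ᵇ ℂ)
    (hg : HasCompactSupport g) : HasCompactSupport (f * g : jointSpectrum →ᵇ ℂ) :=
  hg.mul_left (f := f)

theorem hasCompactSupport_star {g : jointSpectrum →ᵇ ℂ}
    (hg : HasCompactSupport g) : HasCompactSupport (star g : jointSpectrum →ᵇ ℂ) :=
  hg.comp_left (g := star) (star_zero ℂ)

/-- The matrix entry `s ↦ s^{μν}` on the joint spectrum. -/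
def entry (μ ν : Fin 4) : C(jointSpectrum, ℂ) :=
  ⟨fun s => (s.1 μ ν : ℂ),
    Complex.continuous_ofReal.comp (continuous_subtype_val.matrix_elem μ ν)⟩

@[simp] theorem entry_apply (μ ν : Fin 4) (s : jointSpectrum) : entry μ ν s = (s.1 μ ν : ℂ) := rfl

theorem entry_antisymm (s : jointSpectrum) (μ ν : Fin 4) : s.1 μ ν = -s.1 ν μ := by
  have := congrFun (congrFun s.2.1 ν) μ
  simpa [Matrix.transpose_apply] using this

theorem entry_self (s : jointSpectrum) (μ : Fin 4) : s.1 μ μ = 0 := by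
  have := entry_antisymm s μ μ; linarith

variable {H : Type*} [NormedAddCommGroup H] [InnerProductSpace ℂ H] [CompleteSpace H]

namespace RegularRep

variable (π : RegularRep H)

/-! ### The central representation -/

theorem norm_central_le (f : jointSpectrum →ᵇ ℂ) : ‖π.central f‖ ≤ ‖f‖ :=
  NonUnitalStarAlgHom.norm_apply_le π.central f

theorem norm_central_apply_le (f : jointSpectrum →ᵇ ℂ) (x : H) :
    ‖π.central f x‖ ≤ ‖f‖ * ‖x‖ :=
  (π.central f).le_of_opNorm_le (π.norm_central_le f) x

theorem central_mul_apply (f g : jointSpectrum →ᵇ ℂ) (x : H) :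
    π.central (f * g) x = π.central f (π.central g x) := by
  rw [map_mul]; rfl

theorem central_inner_left (f : jointSpectrum →ᵇ ℂ) (x y : H) :
    inner ℂ (π.central f x) y = inner ℂ x (π.central (star f) y) := by
  rw [map_star, ContinuousLinearMap.star_eq_adjoint, ContinuousLinearMap.adjoint_inner_right]

/-- Nondegeneracy on compactly supported functions: on the span of the vectors `central f ψ` the
sequence is eventually constant, and the cutoffs have norm at most one, so the convergence extends
to the closure. -/
theorem tendsto_central_cutoff (x : H) :
    Tendsto (fun n => π.central (cutoff n) x) atTop (𝓝 x) := by
  set S : Set H := {φ : H | ∃ (f : jointSpectrum →ᵇ ℂ) (ψ : H),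
      HasCompactSupport f ∧ φ = π.central f ψ}
  have hspan : ∀ y ∈ Submodule.span ℂ S,
      Tendsto (fun n => π.central (cutoff n) y) atTop (𝓝 y) := by
    intro y hy
    induction hy using Submodule.span_induction with
    | mem y hy =>
      obtain ⟨f, ψ, hf, rfl⟩ := hy
      obtain ⟨N, hN⟩ := exists_cutoff_mul_eq hf
      refine tendsto_const_nhds.congr' ?_
      filter_upwards [eventually_ge_atTop N] with n hn
      rw [← central_mul_apply, hN n hn]
    | zero => simp
    | add y z _ _ hy hz => simpa using hy.add hz
    | smul c y _ hy => simpa using hy.const_smul c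
  rw [Metric.tendsto_atTop]
  intro ε hε
  obtain ⟨y, hy, hxy⟩ := Metric.dense_iff.1 π.central_nondegenerate x (ε / 3) (by positivity)
  obtain ⟨N, hN⟩ := Metric.tendsto_atTop.1 (hspan y hxy) (ε / 3) (by positivity)
  refine ⟨N, fun n hn => ?_⟩
  have h1 := hN n hn
  have h2 : ‖π.central (cutoff n) (x - y)‖ ≤ ‖x - y‖ :=
    (π.norm_central_apply_le _ _).trans
      (mul_le_of_le_one_left (norm_nonneg _) (norm_cutoff_le n))
  have hy' : ‖x - y‖ < ε / 3 := by
    rw [← dist_eq_norm, dist_comm]; exact hy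
  rw [dist_eq_norm] at h1 ⊢
  have : π.central (cutoff n) x - x =
      π.central (cutoff n) (x - y) + (π.central (cutoff n) y - y) - (x - y) := by
    rw [map_sub]; abel
  rw [this]
  calc _ ≤ ‖π.central (cutoff n) (x - y)‖ + ‖π.central (cutoff n) y - y‖ + ‖x - y‖ :=
        (norm_sub_le _ _).trans (by gcongr; exact norm_add_le _ _)
    _ < ε := by linarith

theorem eq_of_central_eq {x y : H}
    (h : ∀ g : jointSpectrum →ᵇ ℂ, HasCompactSupport g → π.central g x = π.central g y) :
    x = y :=
  tendsto_nhds_unique (π.tendsto_central_cutoff x)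
    ((π.tendsto_central_cutoff y).congr fun n => (h _ (hasCompactSupport_cutoff n)).symm)

theorem isCentralApply_iff (f : C(jointSpectrum, ℂ)) (ψ φ : H) :
    π.IsCentralApply f ψ φ ↔ ∀ (g : jointSpectrum →ᵇ ℂ) (hg : HasCompactSupport g),
      π.central (cutMul f g hg) ψ = π.central g φ := by
  constructor
  · intro h g hg
    exact h g _ hg fun s => rfl
  · intro h g k hg hk
    rw [← h g hg]
    congr 2
    ext s
    exact hk s

variable {π}

theorem IsCentralApply.unique {f : C(jointSpectrum, ℂ)} {ψ φ φ' : H}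
    (h : π.IsCentralApply f ψ φ) (h' : π.IsCentralApply f ψ φ') : φ = φ' := by
  rw [isCentralApply_iff] at h h'
  exact π.eq_of_central_eq fun g hg => (h g hg).symm.trans (h' g hg)

theorem IsCentralApply.comp {f f' : C(jointSpectrum, ℂ)} {ψ φ χ : H}
    (h : π.IsCentralApply f ψ φ) (h' : π.IsCentralApply f' φ χ) :
    π.IsCentralApply (f * f' : C(jointSpectrum, ℂ)) ψ χ := by
  rw [isCentralApply_iff] at h h' ⊢
  intro g hg
  rw [← h' g hg, ← h _ (hasCompactSupport_cutMul f' hg)]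
  congr 2
  ext s
  simp [mul_assoc]

theorem IsCentralApply.add {f f' : C(jointSpectrum, ℂ)} {ψ φ φ' : H}
    (h : π.IsCentralApply f ψ φ) (h' : π.IsCentralApply f' ψ φ') :
    π.IsCentralApply (f + f' : C(jointSpectrum, ℂ)) ψ (φ + φ') := by
  rw [isCentralApply_iff] at h h' ⊢
  intro g hg
  rw [map_add, ← h g hg, ← h' g hg, ← _root_.add_apply, ← map_add]
  congr 2
  ext s
  simp [add_mul]

theorem IsCentralApply.smul {f : C(jointSpectrum, ℂ)} {ψ φ : H} (c : ℂ)
    (h : π.IsCentralApply f ψ φ) :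
    π.IsCentralApply (c • f : C(jointSpectrum, ℂ)) ψ (c • φ) := by
  rw [isCentralApply_iff] at h ⊢
  intro g hg
  rw [map_smul, ← h g hg, ← _root_.smul_apply, ← map_smul]
  congr 2
  ext s
  simp [mul_assoc]

theorem isCentralApply_sum {ι : Type*} (t : Finset ι) {f : ι → C(jointSpectrum, ℂ)} {ψ : H}
    {φ : ι → H} (h : ∀ i ∈ t, π.IsCentralApply (f i) ψ (φ i)) :
    π.IsCentralApply (∑ i ∈ t, f i : C(jointSpectrum, ℂ)) ψ (∑ i ∈ t, φ i) := by
  classical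
  induction t using Finset.induction_on with
  | empty =>
    rw [isCentralApply_iff]
    intro g hg
    have : cutMul (∑ i ∈ (∅ : Finset ι), f i) g hg = 0 := by ext s; simp
    rw [this]; simp
  | insert a t ha ih =>
    rw [Finset.sum_insert ha, Finset.sum_insert ha]
    exact (h a (Finset.mem_insert_self a t)).add
      (ih fun i hi => h i (Finset.mem_insert_of_mem hi))

variable (π)

/-! ### The Weyl operators -/

theorem weylPhase_apply (α β : Fin 4 → ℝ) (s : jointSpectrum) : weylPhase α β s =
    Complex.exp (((-(1 / 2) * (α ⬝ᵥ s.1 *ᵥ β) : ℝ) : ℂ) * Complex.I) := rfl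

theorem dotProduct_self (s : jointSpectrum) (α : Fin 4 → ℝ) : α ⬝ᵥ s.1 *ᵥ α = 0 := by
  have h : α ⬝ᵥ s.1 *ᵥ α = -(α ⬝ᵥ s.1 *ᵥ α) := by
    conv_lhs => rw [Matrix.dotProduct_mulVec, ← Matrix.mulVec_transpose, s.2.1, dotProduct_comm,
      Matrix.neg_mulVec, dotProduct_neg]
  linarith

theorem weylPhase_self (α : Fin 4 → ℝ) (c d : ℝ) : weylPhase (c • α) (d • α) = 1 := by
  ext s
  rw [weylPhase_apply, smul_dotProduct, Matrix.mulVec_smul, dotProduct_smul, dotProduct_self]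
  simp

theorem norm_weyl_apply (j : Fin 4) (α : Fin 4 → ℝ) (x : H) :
    ‖(π.weyl j α : H →L[ℂ] H) x‖ = ‖x‖ :=
  Unitary.norm_map (π.weyl j α) x

theorem weyl_zero (j : Fin 4) : (π.weyl j 0 : H →L[ℂ] H) = 1 := by
  have h := π.weyl_mul j 0 0
  have h0 : weylPhase (0 : Fin 4 → ℝ) 0 = 1 := by
    have := weylPhase_self (0 : Fin 4 → ℝ) 0 0
    simpa using this
  rw [h0, map_one, one_mul, add_zero] at h
  have : π.weyl j 0 * π.weyl j 0 = π.weyl j 0 := Subtype.ext h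
  rw [mul_eq_left.1 this]
  rfl

theorem weyl_neg (j : Fin 4) (α : Fin 4 → ℝ) :
    (π.weyl j (-α) : H →L[ℂ] H) = ContinuousLinearMap.adjoint (π.weyl j α : H →L[ℂ] H) := by
  have h := π.weyl_mul j (-α) α
  have h0 : weylPhase (-α) α = 1 := by
    have := weylPhase_self α (-1) 1
    simpa using this
  rw [h0, map_one, one_mul, neg_add_cancel, weyl_zero] at h
  have h1 : π.weyl j (-α) * π.weyl j α = 1 := Subtype.ext h
  rw [eq_inv_of_mul_eq_one_left h1]
  rfl

theorem weyl_inner_left (j : Fin 4) (α : Fin 4 → ℝ) (x y : H) :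
    inner ℂ ((π.weyl j α : H →L[ℂ] H) x) y = inner ℂ x ((π.weyl j (-α) : H →L[ℂ] H) y) := by
  rw [weyl_neg, ContinuousLinearMap.adjoint_inner_right]

theorem central_weyl_apply (f : jointSpectrum →ᵇ ℂ) (j : Fin 4) (α : Fin 4 → ℝ) (x : H) :
    π.central f ((π.weyl j α : H →L[ℂ] H) x) = (π.weyl j α : H →L[ℂ] H) (π.central f x) :=
  DFunLike.congr_fun (π.central_comm f j α).eq x

theorem weyl_mul_apply (j : Fin 4) (α β : Fin 4 → ℝ) (x : H) :
    (π.weyl j α : H →L[ℂ] H) ((π.weyl j β : H →L[ℂ] H) x) =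
      (π.weyl j (α + β) : H →L[ℂ] H) (π.central (weylPhase α β) x) := by
  rw [← central_weyl_apply]
  exact DFunLike.congr_fun (π.weyl_mul j α β) x

end RegularRep

end

end QST

namespace QST

open Filter Topology MeasureTheory

noncomputable section

/-! ### Polynomials times a Gaussian on `ℝ⁴` -/

/-- The Gaussian `exp (-|β|²)` on `ℝ⁴`, normalized to have integral one. -/
def gauss (β : Fin 4 → ℝ) : ℝ :=
  (∫ γ : Fin 4 → ℝ, Real.exp (-∑ i, γ i ^ 2))⁻¹ * Real.exp (-∑ i, β i ^ 2)

/-- A polynomial times the Gaussian. -/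
def polyGauss (p : MvPolynomial (Fin 4) ℂ) (β : Fin 4 → ℝ) : ℂ :=
  MvPolynomial.eval (fun i => (β i : ℂ)) p * gauss β

theorem polyGauss_add (p q : MvPolynomial (Fin 4) ℂ) (β : Fin 4 → ℝ) :
    polyGauss (p + q) β = polyGauss p β + polyGauss q β := by
  simp [polyGauss, add_mul]

theorem polyGauss_smul (c : ℂ) (p : MvPolynomial (Fin 4) ℂ) (β : Fin 4 → ℝ) :
    polyGauss (c • p) β = c * polyGauss p β := by
  simp [polyGauss, mul_assoc]

theorem polyGauss_X_mul (i : Fin 4) (p : MvPolynomial (Fin 4) ℂ) (β : Fin 4 → ℝ) :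
    polyGauss (MvPolynomial.X i * p) β = β i * polyGauss p β := by
  simp [polyGauss, mul_assoc]

theorem polyGauss_one (β : Fin 4 → ℝ) : polyGauss 1 β = gauss β := by
  simp [polyGauss]

theorem continuous_gauss : Continuous gauss := by
  unfold gauss; fun_prop

theorem continuous_polyGauss (p : MvPolynomial (Fin 4) ℂ) : Continuous (polyGauss p) := by
  have := continuous_gauss
  have h : Continuous fun β : Fin 4 → ℝ => MvPolynomial.eval (fun i => (β i : ℂ)) p :=
    (MvPolynomial.continuous_eval p).comp (by fun_prop)
  unfold polyGauss
  fun_prop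

theorem sq_norm_le_sum (β : Fin 4 → ℝ) : ‖β‖ ^ 2 ≤ ∑ i, β i ^ 2 := by
  have h : ‖β‖ ≤ Real.sqrt (∑ i, β i ^ 2) := by
    refine (pi_norm_le_iff_of_nonneg (Real.sqrt_nonneg _)).2 fun i => ?_
    rw [Real.norm_eq_abs]
    exact Real.abs_le_sqrt (Finset.single_le_sum (f := fun i => β i ^ 2)
      (fun _ _ => sq_nonneg _) (Finset.mem_univ i))
  calc ‖β‖ ^ 2 ≤ Real.sqrt (∑ i, β i ^ 2) ^ 2 := by gcongr
    _ = _ := Real.sq_sqrt (Finset.sum_nonneg fun _ _ => sq_nonneg _)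

theorem exp_neg_sum_sq_decay (k : ℕ) :
    ∃ C, ∀ β : Fin 4 → ℝ, (1 + ‖β‖) ^ k * Real.exp (-∑ i, β i ^ 2) ≤ C := by
  refine ⟨k.factorial * Real.exp 2, fun β => ?_⟩
  have h0 : 0 ≤ 1 + ‖β‖ := by positivity
  have h1 : (1 + ‖β‖) ^ k ≤ k.factorial * Real.exp (1 + ‖β‖) := by
    have := Real.pow_div_factorial_le_exp (1 + ‖β‖) h0 k
    rwa [div_le_iff₀ (by positivity), mul_comm] at this
  have h2 : 1 + ‖β‖ ≤ 2 + ∑ i, β i ^ 2 := by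
    nlinarith [sq_norm_le_sum β, sq_nonneg (‖β‖ - 1), norm_nonneg β]
  calc (1 + ‖β‖) ^ k * Real.exp (-∑ i, β i ^ 2)
      ≤ k.factorial * Real.exp (2 + ∑ i, β i ^ 2) * Real.exp (-∑ i, β i ^ 2) := by
        gcongr
        exact h1.trans (by gcongr)
    _ = k.factorial * Real.exp 2 := by
        rw [mul_assoc, ← Real.exp_add]; congr 2; ring

theorem polyGauss_decay (p : MvPolynomial (Fin 4) ℂ) (k : ℕ) :
    ∃ C, ∀ β, (1 + ‖β‖) ^ k * ‖polyGauss p β‖ ≤ C := by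
  induction p using MvPolynomial.induction_on generalizing k with
  | C a =>
    obtain ⟨C, hC⟩ := exp_neg_sum_sq_decay k
    refine ⟨‖a‖ * (|(∫ γ : Fin 4 → ℝ, Real.exp (-∑ i, γ i ^ 2))⁻¹| * C), fun β => ?_⟩
    have : ‖polyGauss (MvPolynomial.C a) β‖ = ‖a‖ *
        (|(∫ γ : Fin 4 → ℝ, Real.exp (-∑ i, γ i ^ 2))⁻¹| * Real.exp (-∑ i, β i ^ 2)) := by
      rw [polyGauss, gauss, MvPolynomial.eval_C, norm_mul, Complex.norm_real, norm_mul,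
        Real.norm_eq_abs, Real.norm_eq_abs, Real.abs_exp]
    rw [this]
    calc _ = ‖a‖ * (|(∫ γ : Fin 4 → ℝ, Real.exp (-∑ i, γ i ^ 2))⁻¹| *
          ((1 + ‖β‖) ^ k * Real.exp (-∑ i, β i ^ 2))) := by ring
      _ ≤ _ := by gcongr; exact hC β
  | add p q hp hq =>
    obtain ⟨C, hC⟩ := hp k
    obtain ⟨C', hC'⟩ := hq k
    refine ⟨C + C', fun β => ?_⟩
    rw [polyGauss_add]
    calc _ ≤ (1 + ‖β‖) ^ k * (‖polyGauss p β‖ + ‖polyGauss q β‖) := by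
          gcongr; exact norm_add_le _ _
      _ ≤ _ := by rw [mul_add]; exact add_le_add (hC β) (hC' β)
  | mul_X p i hp =>
    obtain ⟨C, hC⟩ := hp (k + 1)
    refine ⟨C, fun β => ?_⟩
    rw [mul_comm p, polyGauss_X_mul, norm_mul, Complex.norm_real]
    have : ‖β i‖ ≤ 1 + ‖β‖ := (norm_le_pi_norm β i).trans (by linarith)
    calc _ ≤ (1 + ‖β‖) ^ k * ((1 + ‖β‖) * ‖polyGauss p β‖) := by gcongr
      _ = (1 + ‖β‖) ^ (k + 1) * ‖polyGauss p β‖ := by ring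
      _ ≤ C := hC β

/-- The exponent 5 is the first integer above the dimension 4. -/
theorem integrable_decay (C : ℝ) :
    Integrable fun β : Fin 4 → ℝ => C * ((1 + ‖β‖) ^ 5)⁻¹ := by
  have h := (integrable_one_add_norm (E := Fin 4 → ℝ) (μ := volume) (r := 5)
    (by simp; norm_num)).const_mul C
  refine h.congr (Eventually.of_forall fun β => ?_)
  have : (1 + ‖β‖) ^ (-5 : ℝ) = ((1 + ‖β‖) ^ 5)⁻¹ := by
    rw [Real.rpow_neg (by positivity)]; norm_cast
  simp only [this]

theorem integrable_polyGauss (p : MvPolynomial (Fin 4) ℂ) : Integrable (polyGauss p) := by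
  obtain ⟨C, hC⟩ := polyGauss_decay p 5
  refine (integrable_decay C).mono' (continuous_polyGauss p).aestronglyMeasurable
    (Eventually.of_forall fun β => ?_)
  rw [← div_eq_mul_inv, le_div_iff₀ (by positivity), mul_comm]
  exact hC β

theorem integral_gauss : ∫ β, gauss β = 1 := by
  obtain ⟨C, hC⟩ := exp_neg_sum_sq_decay 5
  have hi : Integrable fun γ : Fin 4 → ℝ => Real.exp (-∑ i, γ i ^ 2) := by
    refine (integrable_decay C).mono' (by fun_prop : Continuous _).aestronglyMeasurable
      (Eventually.of_forall fun β => ?_)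
    rw [← div_eq_mul_inv, le_div_iff₀ (by positivity), mul_comm, Real.norm_eq_abs, Real.abs_exp]
    exact hC β
  have hpos : 0 < ∫ γ : Fin 4 → ℝ, Real.exp (-∑ i, γ i ^ 2) := integral_exp_pos hi
  unfold gauss
  rw [integral_const_mul, inv_mul_cancel₀ hpos.ne']

/-- The polynomial factor of the partial derivative of `p * gauss`. -/
def gaussDeriv (μ : Fin 4) (p : MvPolynomial (Fin 4) ℂ) : MvPolynomial (Fin 4) ℂ :=
  MvPolynomial.pderiv μ p + (-2 : ℂ) • (MvPolynomial.X μ * p)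

theorem gaussDeriv_one (μ : Fin 4) : gaussDeriv μ 1 = (-2 : ℂ) • MvPolynomial.X μ := by
  simp [gaussDeriv]

theorem hasDerivAt_eval_line (p : MvPolynomial (Fin 4) ℂ) (β : Fin 4 → ℝ) (μ : Fin 4) (t : ℝ) :
    HasDerivAt (fun t : ℝ => MvPolynomial.eval
        (fun i => (((β + t • Pi.single μ 1 : Fin 4 → ℝ) i : ℝ) : ℂ)) p)
      (MvPolynomial.eval (fun i => (((β + t • Pi.single μ 1 : Fin 4 → ℝ) i : ℝ) : ℂ))
        (MvPolynomial.pderiv μ p)) t := by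
  induction p using MvPolynomial.induction_on with
  | C a => simpa using hasDerivAt_const t a
  | add p q hp hq => simpa using hp.fun_add hq
  | mul_X p i hp =>
    have hX : HasDerivAt (fun t : ℝ => (((β + t • Pi.single μ 1 : Fin 4 → ℝ) i : ℝ) : ℂ))
        ((Pi.single μ 1 : Fin 4 → ℝ) i : ℂ) t := by
      refine HasDerivAt.ofReal_comp (f := fun t : ℝ => (β + t • Pi.single μ 1 : Fin 4 → ℝ) i) ?_
      simpa using ((hasDerivAt_id t).mul_const ((Pi.single μ 1 : Fin 4 → ℝ) i)).const_add (β i)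
    have h := hp.fun_mul hX
    simp only [map_mul, MvPolynomial.eval_X, Derivation.leibniz, MvPolynomial.pderiv_X,
      smul_eq_mul, map_add] at h ⊢
    refine h.congr_deriv ?_
    rw [add_comm, mul_comm (MvPolynomial.eval _ (MvPolynomial.pderiv μ p))]
    congr 2
    by_cases hi : i = μ
    · subst hi; simp
    · simp [hi]

theorem hasDerivAt_gauss_line (β : Fin 4 → ℝ) (μ : Fin 4) (t : ℝ) :
    HasDerivAt (fun t : ℝ => gauss (β + t • Pi.single μ 1))
      (-2 * (β + t • Pi.single μ 1 : Fin 4 → ℝ) μ * gauss (β + t • Pi.single μ 1)) t := by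
  have hc : ∀ i, HasDerivAt (fun t : ℝ => (β + t • Pi.single μ 1 : Fin 4 → ℝ) i ^ 2)
      (2 * (β + t • Pi.single μ 1 : Fin 4 → ℝ) i * (Pi.single μ 1 : Fin 4 → ℝ) i) t := by
    intro i
    have : HasDerivAt (fun t : ℝ => (β + t • Pi.single μ 1 : Fin 4 → ℝ) i)
        ((Pi.single μ 1 : Fin 4 → ℝ) i) t := by
      simpa using ((hasDerivAt_id t).mul_const ((Pi.single μ 1 : Fin 4 → ℝ) i)).const_add (β i)
    simpa using this.fun_pow 2
  have hs := (HasDerivAt.fun_sum (u := Finset.univ) fun i _ => hc i).fun_neg.exp.const_mul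
    (∫ γ : Fin 4 → ℝ, Real.exp (-∑ i, γ i ^ 2))⁻¹
  unfold gauss
  refine hs.congr_deriv ?_
  have : ∑ i, 2 * (β + t • Pi.single μ 1 : Fin 4 → ℝ) i * (Pi.single μ 1 : Fin 4 → ℝ) i =
      2 * (β + t • Pi.single μ 1 : Fin 4 → ℝ) μ := by
    rw [Finset.sum_eq_single μ]
    · simp
    · intro i _ hi; simp [hi]
    · simp
  rw [this]
  ring

theorem hasDerivAt_polyGauss_line (p : MvPolynomial (Fin 4) ℂ) (β : Fin 4 → ℝ) (μ : Fin 4)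
    (t : ℝ) :
    HasDerivAt (fun t : ℝ => polyGauss p (β + t • Pi.single μ 1))
      (polyGauss (gaussDeriv μ p) (β + t • Pi.single μ 1)) t := by
  have h := (hasDerivAt_eval_line p β μ t).fun_mul (hasDerivAt_gauss_line β μ t).ofReal_comp
  unfold polyGauss
  refine h.congr_deriv ?_
  simp only [gaussDeriv, map_add, MvPolynomial.smul_eval, map_mul, MvPolynomial.eval_X]
  push_cast
  ring

/-- The bound is uniform over bounded translations, as needed to dominate the difference quotients
when an average is differentiated along an orbit. -/
theorem polyGauss_translate_decay (p : MvPolynomial (Fin 4) ℂ) (k : ℕ) (r : ℝ) :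
    ∃ C, ∀ β γ : Fin 4 → ℝ, ‖γ‖ ≤ r → (1 + ‖β‖) ^ k * ‖polyGauss p (β + γ)‖ ≤ C := by
  obtain ⟨C, hC⟩ := polyGauss_decay p k
  refine ⟨(1 + r) ^ k * C, fun β γ hγ => ?_⟩
  have hr : 0 ≤ r := (norm_nonneg _).trans hγ
  have h1 : 1 + ‖β‖ ≤ (1 + r) * (1 + ‖β + γ‖) := by
    have : ‖β‖ ≤ ‖β + γ‖ + ‖γ‖ := by
      have := norm_sub_le (β + γ) γ
      simpa using this
    nlinarith [norm_nonneg (β + γ)]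
  calc _ ≤ ((1 + r) * (1 + ‖β + γ‖)) ^ k * ‖polyGauss p (β + γ)‖ := by gcongr
    _ = (1 + r) ^ k * ((1 + ‖β + γ‖) ^ k * ‖polyGauss p (β + γ)‖) := by rw [mul_pow]; ring
    _ ≤ _ := by gcongr; exact hC _

end

end QST

namespace QST

open Filter Topology MeasureTheory

noncomputable section

variable {H : Type*} [NormedAddCommGroup H] [InnerProductSpace ℂ H] [CompleteSpace H]

namespace RegularRep

variable (π : RegularRep H)

/-! ### Gaussian averages of the Weyl operators -/

theorem continuous_weyl_scaled (Λ : Fin 4 → ℝ) (j : Fin 4) (x : H) :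
    Continuous fun β : Fin 4 → ℝ => (π.weyl j (Λ * β) : H →L[ℂ] H) x :=
  (π.weyl_continuous j x).comp (by fun_prop)

theorem integrable_smear (Λ : Fin 4 → ℝ) (j : Fin 4) (p : MvPolynomial (Fin 4) ℂ) (x : H) :
    Integrable fun β => polyGauss p β • (π.weyl j (Λ * β) : H →L[ℂ] H) x := by
  refine ((integrable_polyGauss p).norm.mul_const ‖x‖).mono'
    ((continuous_polyGauss p).smul (π.continuous_weyl_scaled Λ j x)).aestronglyMeasurable
    (Eventually.of_forall fun β => ?_)
  rw [norm_smul, norm_weyl_apply]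

/-- The average `∫ p(β) γ(β) exp (i Λβ · q_j) dβ` of the Weyl operators of the event `j`, where `γ`
is the normalized Gaussian, `p` a polynomial and `Λ` a diagonal scaling. -/
def smear (Λ : Fin 4 → ℝ) (j : Fin 4) (p : MvPolynomial (Fin 4) ℂ) : H →L[ℂ] H :=
  LinearMap.mkContinuous
    { toFun := fun x => ∫ β, polyGauss p β • (π.weyl j (Λ * β) : H →L[ℂ] H) x
      map_add' := fun x y => by
        simp only [map_add, smul_add]
        exact integral_add (π.integrable_smear Λ j p x) (π.integrable_smear Λ j p y)
      map_smul' := fun c x => by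
        simp only [map_smul, RingHom.id_apply, smul_comm _ c]
        exact integral_smul c _ }
    (∫ β, ‖polyGauss p β‖)
    (fun x => by
      refine (norm_integral_le_integral_norm _).trans (le_of_eq ?_)
      simp only [norm_smul, norm_weyl_apply]
      exact integral_mul_const _ _)

theorem smear_apply (Λ : Fin 4 → ℝ) (j : Fin 4) (p : MvPolynomial (Fin 4) ℂ) (x : H) :
    π.smear Λ j p x = ∫ β, polyGauss p β • (π.weyl j (Λ * β) : H →L[ℂ] H) x := rfl

theorem norm_smear_apply_le (Λ : Fin 4 → ℝ) (j : Fin 4) (p : MvPolynomial (Fin 4) ℂ) (x : H) :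
    ‖π.smear Λ j p x‖ ≤ (∫ β, ‖polyGauss p β‖) * ‖x‖ :=
  (π.smear Λ j p).le_of_opNorm_le
    (LinearMap.mkContinuous_norm_le _ (integral_nonneg fun _ => norm_nonneg _) _) x

theorem smear_smul (Λ : Fin 4 → ℝ) (j : Fin 4) (c : ℂ) (p : MvPolynomial (Fin 4) ℂ) (x : H) :
    π.smear Λ j (c • p) x = c • π.smear Λ j p x := by
  simp only [smear_apply, polyGauss_smul, mul_smul]
  exact integral_smul c _

theorem map_smear_of_comm {C : H →L[ℂ] H} {j : Fin 4}
    (hC : ∀ α x, C ((π.weyl j α : H →L[ℂ] H) x) = (π.weyl j α : H →L[ℂ] H) (C x))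
    (Λ : Fin 4 → ℝ) (p : MvPolynomial (Fin 4) ℂ) (x : H) :
    C (π.smear Λ j p x) = π.smear Λ j p (C x) := by
  rw [smear_apply, ← C.integral_comp_comm (π.integrable_smear Λ j p x), smear_apply]
  simp only [map_smul, hC]

theorem central_smear (f : jointSpectrum →ᵇ ℂ) (Λ : Fin 4 → ℝ) (j : Fin 4)
    (p : MvPolynomial (Fin 4) ℂ) (x : H) :
    π.central f (π.smear Λ j p x) = π.smear Λ j p (π.central f x) :=
  π.map_smear_of_comm (fun α x => π.central_weyl_apply f j α x) Λ p x

theorem weyl_smear {j k : Fin 4} (hjk : j ≠ k) (α : Fin 4 → ℝ) (Λ : Fin 4 → ℝ)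
    (p : MvPolynomial (Fin 4) ℂ) (x : H) :
    (π.weyl j α : H →L[ℂ] H) (π.smear Λ k p x) =
      π.smear Λ k p ((π.weyl j α : H →L[ℂ] H) x) :=
  π.map_smear_of_comm (fun β x => DFunLike.congr_fun (π.weyl_comm j k α β hjk).eq x) Λ p x

theorem smear_smear {j k : Fin 4} (hjk : j ≠ k) (Λ Λ' : Fin 4 → ℝ)
    (p q : MvPolynomial (Fin 4) ℂ) (x : H) :
    π.smear Λ j p (π.smear Λ' k q x) = π.smear Λ' k q (π.smear Λ j p x) :=
  π.map_smear_of_comm (fun α x => (π.weyl_smear hjk.symm α Λ p x).symm) Λ' q x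

/-- The adjoint of the Weyl operator at `Λβ` is the one at `-Λβ`; the reflection `β ↦ -β` of the
integral turns the conjugate of `p` into `q`. -/
theorem smear_inner_left (Λ : Fin 4 → ℝ) (j : Fin 4) {p q : MvPolynomial (Fin 4) ℂ}
    (hpq : ∀ β, polyGauss q (-β) = star (polyGauss p β)) (x y : H) :
    inner ℂ (π.smear Λ j p x) y = inner ℂ x (π.smear Λ j q y) := by
  have h1 : inner ℂ x (π.smear Λ j q y) =
      ∫ β, polyGauss q β * inner ℂ ((π.weyl j (-(Λ * β)) : H →L[ℂ] H) x) y := by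
    rw [smear_apply, ← integral_inner (π.integrable_smear Λ j q y)]
    refine integral_congr_ae (Eventually.of_forall fun β => ?_)
    simp only [inner_smul_right]
    rw [weyl_inner_left, neg_neg]
  have h2 : inner ℂ y (π.smear Λ j p x) =
      ∫ β, polyGauss p β * inner ℂ y ((π.weyl j (Λ * β) : H →L[ℂ] H) x) := by
    rw [smear_apply, ← integral_inner (π.integrable_smear Λ j p x)]
    simp only [inner_smul_right]
  rw [h1, ← integral_neg_eq_self, ← inner_conj_symm, h2, ← integral_conj]
  refine integral_congr_ae (Eventually.of_forall fun β => ?_)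
  simp only [map_mul, inner_conj_symm, hpq, mul_neg, neg_neg]
  rfl

theorem tendsto_smear_one {ι : Type*} {l : Filter ι} [l.IsCountablyGenerated]
    {Λ : ι → Fin 4 → ℝ} (hΛ : Tendsto Λ l (𝓝 0)) (j : Fin 4) (x : H) :
    Tendsto (fun i => π.smear (Λ i) j 1 x) l (𝓝 x) := by
  have h : Tendsto (fun i => ∫ β, polyGauss 1 β • (π.weyl j (Λ i * β) : H →L[ℂ] H) x) l
      (𝓝 (∫ β, polyGauss 1 β • x)) := by
    refine tendsto_integral_filter_of_dominated_convergence (fun β => ‖polyGauss 1 β‖ * ‖x‖)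
      (Eventually.of_forall fun i => (π.integrable_smear (Λ i) j 1 x).aestronglyMeasurable)
      (Eventually.of_forall fun i => Eventually.of_forall fun β => ?_)
      ((integrable_polyGauss 1).norm.mul_const _)
      (Eventually.of_forall fun β => ?_)
    · rw [norm_smul, norm_weyl_apply]
    · have h1 : Tendsto (fun i => Λ i * β) l (𝓝 0) := by
        have := hΛ.mul_const β
        rwa [zero_mul] at this
      have h2 := ((π.weyl_continuous j x).tendsto 0).comp h1
      rw [weyl_zero] at h2
      exact h2.const_smul _
  have h3 : ∫ β, polyGauss 1 β • x = x := by
    rw [integral_smul_const]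
    simp only [polyGauss_one]
    rw [integral_complex_ofReal, integral_gauss]
    simp
  rw [h3] at h
  exact h

/-! ### The coordinates -/

/-- `x` is in the domain of `q_j^μ`, with `q_j^μ x = y`. -/
def HasCoord (j μ : Fin 4) (x y : H) : Prop :=
  HasDerivAt (π.orbit j μ x) (Complex.I • y) 0

variable {π}

theorem HasCoord.mem {j μ : Fin 4} {x y : H} (h : π.HasCoord j μ x y) :
    x ∈ (π.coord j μ).domain :=
  HasDerivAt.differentiableAt h

theorem HasCoord.coord_eq {j μ : Fin 4} {x y : H} (h : π.HasCoord j μ x y) :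
    π.coord j μ ⟨x, h.mem⟩ = y := by
  change (-Complex.I) • deriv (π.orbit j μ x) 0 = y
  rw [HasDerivAt.deriv h, smul_smul]
  simp

theorem hasCoord_coord {j μ : Fin 4} (x : (π.coord j μ).domain) :
    π.HasCoord j μ x (π.coord j μ x) := by
  have h : HasDerivAt (π.orbit j μ x) (deriv (π.orbit j μ x) 0) 0 :=
    DifferentiableAt.hasDerivAt x.2
  unfold HasCoord
  convert h using 1
  change Complex.I • (-Complex.I) • deriv (π.orbit j μ x) 0 = _
  rw [smul_smul]
  simp

theorem HasCoord.unique {j μ : Fin 4} {x y z : H} (h : π.HasCoord j μ x y)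
    (h' : π.HasCoord j μ x z) : y = z := by
  rw [← h.coord_eq, ← h'.coord_eq]

theorem HasCoord.add {j μ : Fin 4} {x y x' y' : H} (h : π.HasCoord j μ x y)
    (h' : π.HasCoord j μ x' y') : π.HasCoord j μ (x + x') (y + y') := by
  have := HasDerivAt.fun_add h h'
  unfold HasCoord
  rw [smul_add]
  convert this using 1
  funext t
  simp [orbit]

theorem HasCoord.map {j μ : Fin 4} {x y : H} (h : π.HasCoord j μ x y) {C : H →L[ℂ] H}
    (hC : ∀ α x, C ((π.weyl j α : H →L[ℂ] H) x) = (π.weyl j α : H →L[ℂ] H) (C x)) :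
    π.HasCoord j μ (C x) (C y) := by
  have := (C.restrictScalars ℝ).hasFDerivAt.comp_hasDerivAt (0 : ℝ) h
  unfold HasCoord
  convert this using 1
  · funext t
    simp [orbit, hC]
  · simp

theorem HasCoord.smul {j μ : Fin 4} {x y : H} (c : ℂ) (h : π.HasCoord j μ x y) :
    π.HasCoord j μ (c • x) (c • y) :=
  h.map (C := c • ContinuousLinearMap.id ℂ H) (fun α x => by simp)

theorem hasCoord_zero (j μ : Fin 4) : π.HasCoord j μ 0 0 := by
  simpa using (hasCoord_coord (π := π) (j := j) (μ := μ) 0)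

theorem HasCoord.central {j μ : Fin 4} {x y : H} (h : π.HasCoord j μ x y)
    (f : jointSpectrum →ᵇ ℂ) : π.HasCoord j μ (π.central f x) (π.central f y) :=
  h.map fun α x => π.central_weyl_apply f j α x

theorem HasCoord.smear {j k μ : Fin 4} (hjk : j ≠ k) {x y : H} (h : π.HasCoord j μ x y)
    (Λ : Fin 4 → ℝ) (p : MvPolynomial (Fin 4) ℂ) :
    π.HasCoord j μ (π.smear Λ k p x) (π.smear Λ k p y) :=
  h.map fun α x => (π.weyl_smear hjk α Λ p x).symm

theorem HasCoord.inner_eq {j μ : Fin 4} {x y x' y' : H} (h : π.HasCoord j μ x y)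
    (h' : π.HasCoord j μ x' y') : inner ℂ y x' = inner ℂ x y' := by
  have e : ∀ t : ℝ, inner ℂ (π.orbit j μ x t) x' = inner ℂ x (π.orbit j μ x' (-t)) := by
    intro t
    rw [orbit, weyl_inner_left, orbit, neg_smul]
  have h1 : HasDerivAt (fun t : ℝ => inner ℂ (π.orbit j μ x t) x')
      (inner ℂ (Complex.I • y) x') 0 := by
    exact (HasDerivAt.inner ℂ h (hasDerivAt_const (0 : ℝ) x')).congr_deriv
      (by rw [inner_zero_right, zero_add])
  have h2 : HasDerivAt (fun t : ℝ => inner ℂ x (π.orbit j μ x' (-t)))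
      (inner ℂ x (-(Complex.I • y'))) 0 := by
    have h3 : HasDerivAt (fun t : ℝ => π.orbit j μ x' (-t)) (-(Complex.I • y')) 0 := by
      have h4 : HasDerivAt (π.orbit j μ x') (Complex.I • y') (-(0 : ℝ)) := by rw [neg_zero]; exact h'
      have := HasDerivAt.scomp (0 : ℝ) h4 (hasDerivAt_neg (0 : ℝ))
      simpa [Function.comp_def] using this
    exact (HasDerivAt.inner ℂ (hasDerivAt_const (0 : ℝ) x) h3).congr_deriv (by simp)
  have h5 := h1.unique ((funext e) ▸ h2)
  rw [inner_smul_left, inner_neg_right, inner_smul_right, Complex.conj_I] at h5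
  have h6 : -Complex.I ≠ 0 := by simp
  apply mul_left_cancel₀ h6
  rw [h5]; ring

variable (π)

/-! ### The action of the coordinates on Gaussian averages -/

theorem norm_exp_ofReal_mul_I_sub_one_sub_le (y : ℝ) :
    ‖Complex.exp (y * Complex.I) - 1 - y * Complex.I‖ ≤ 3 * y ^ 2 := by
  have hn : ‖(y : ℂ) * Complex.I‖ = |y| := by simp
  rcases le_total |y| 1 with h | h
  · have := Complex.norm_exp_sub_one_sub_id_le (x := y * Complex.I) (by rw [hn]; exact h)
    rw [hn, sq_abs] at this
    nlinarith [sq_nonneg y]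
  · have h1 : ‖Complex.exp (y * Complex.I) - 1 - y * Complex.I‖ ≤ 1 + 1 + |y| := by
      refine (norm_sub_le _ _).trans ?_
      rw [hn]
      gcongr
      refine (norm_sub_le _ _).trans ?_
      rw [Complex.norm_exp_ofReal_mul_I, norm_one]
    have : |y| ≤ |y| ^ 2 := by nlinarith
    rw [sq_abs] at this
    nlinarith

/-- `(i, s a)_μ g` up to the factor `-i/2`: the derivative of the Weyl phase. -/
def phaseDeriv (μ : Fin 4) (a : Fin 4 → ℝ) (g : jointSpectrum →ᵇ ℂ) (hg : HasCompactSupport g) :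
    jointSpectrum →ᵇ ℂ :=
  ∑ ν, (-(Complex.I / 2) * a ν) • cutMul (entry μ ν) g hg

theorem phaseDeriv_apply (μ : Fin 4) (a : Fin 4 → ℝ) (g : jointSpectrum →ᵇ ℂ)
    (hg : HasCompactSupport g) (s : jointSpectrum) :
    phaseDeriv μ a g hg s = ((-(1 / 2) * (s.1 *ᵥ a) μ : ℝ) : ℂ) * Complex.I * g s := by
  simp only [phaseDeriv, BoundedContinuousFunction.coe_sum, Finset.sum_apply,
    BoundedContinuousFunction.coe_smul, cutMul_apply, entry_apply, Matrix.mulVec, dotProduct,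
    smul_eq_mul]
  push_cast
  rw [Finset.mul_sum, Finset.sum_mul, Finset.sum_mul]
  refine Finset.sum_congr rfl fun ν _ => ?_
  ring

theorem weylPhase_single_apply (μ : Fin 4) (t : ℝ) (a : Fin 4 → ℝ) (s : jointSpectrum) :
    weylPhase (t • Pi.single μ 1) a s =
      Complex.exp (((t * (-(1 / 2) * (s.1 *ᵥ a) μ) : ℝ) : ℂ) * Complex.I) := by
  rw [weylPhase_apply, smul_dotProduct, single_one_dotProduct, smul_eq_mul]
  congr 3
  ring

/-- The derivative is taken in the supremum norm, so that the central representation can be applied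
to it. `Q` is unbounded on the joint spectrum; the factor `g` makes the second order remainder of
the exponential uniform. -/
theorem hasDerivAt_weylPhase_mul (μ : Fin 4) (a : Fin 4 → ℝ) (g : jointSpectrum →ᵇ ℂ)
    (hg : HasCompactSupport g) (t : ℝ) :
    HasDerivAt (fun t : ℝ => weylPhase (t • Pi.single μ 1) a * g)
      (weylPhase (t • Pi.single μ 1) a * phaseDeriv μ a g hg) t := by
  set D : C(jointSpectrum, ℂ) :=
    ⟨fun s => (((s.1 *ᵥ a) μ ^ 2 : ℝ) : ℂ), by
      have h : Continuous fun s : Matrix (Fin 4) (Fin 4) ℝ => (s *ᵥ a) μ := by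
        fun_prop
      exact Complex.continuous_ofReal.comp ((h.comp continuous_subtype_val).pow 2)⟩ with hD
  have bound : ∀ h : ℝ, ‖weylPhase ((t + h) • Pi.single μ 1) a * g
      - weylPhase (t • Pi.single μ 1) a * g
      - h • (weylPhase (t • Pi.single μ 1) a * phaseDeriv μ a g hg)‖
      ≤ ‖cutMul D g hg‖ * ‖h ^ 2‖ := by
    intro h
    refine (BoundedContinuousFunction.norm_le (by positivity)).2 fun s => ?_
    set x : ℝ := -(1 / 2) * (s.1 *ᵥ a) μ with hx
    have e1 : (weylPhase ((t + h) • Pi.single μ 1) a * g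
        - weylPhase (t • Pi.single μ 1) a * g
        - h • (weylPhase (t • Pi.single μ 1) a * phaseDeriv μ a g hg)) s =
        weylPhase (t • Pi.single μ 1) a s *
          (Complex.exp (((h * x : ℝ) : ℂ) * Complex.I) - 1 - ((h * x : ℝ) : ℂ) * Complex.I) *
            g s := by
      simp only [BoundedContinuousFunction.coe_sub, BoundedContinuousFunction.coe_mul,
        BoundedContinuousFunction.coe_smul, Pi.sub_apply, Pi.mul_apply, phaseDeriv_apply,
        weylPhase_single_apply, ← hx]
      rw [add_mul, Complex.ofReal_add, add_mul, Complex.exp_add, Complex.real_smul]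
      push_cast
      ring
    rw [e1, norm_mul, norm_mul, weylPhase_apply, Complex.norm_exp_ofReal_mul_I, one_mul]
    have e2 : ‖D s * g s‖ ≤ ‖cutMul D g hg‖ := (cutMul D g hg).norm_coe_le_norm s
    have e3 : ‖D s‖ = 4 * x ^ 2 := by
      rw [hD, hx]
      simp only [ContinuousMap.coe_mk]
      rw [Complex.norm_real, Real.norm_of_nonneg (sq_nonneg _)]
      ring
    rw [norm_mul, e3] at e2
    rw [Real.norm_of_nonneg (sq_nonneg h)]
    calc _ ≤ 3 * (h * x) ^ 2 * ‖g s‖ := by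
          gcongr; exact norm_exp_ofReal_mul_I_sub_one_sub_le _
      _ ≤ (4 * x ^ 2 * ‖g s‖) * h ^ 2 := by nlinarith [mul_nonneg (sq_nonneg (h * x)) (norm_nonneg (g s))]
      _ ≤ _ := by gcongr
  rw [hasDerivAt_iff_isLittleO_nhds_zero]
  exact (Asymptotics.IsBigO.of_bound _ (Eventually.of_forall bound)).trans_isLittleO
    (Asymptotics.isLittleO_pow_id one_lt_two)

/-- Evaluation of the central representation at a vector. -/
def centralAt (x : H) : (jointSpectrum →ᵇ ℂ) →L[ℂ] H :=
  LinearMap.mkContinuous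
    { toFun := fun f => π.central f x
      map_add' := fun f g => by simp
      map_smul' := fun c f => by simp } ‖x‖
    (fun f => by rw [mul_comm]; exact π.norm_central_apply_le f x)

theorem centralAt_apply (x : H) (f : jointSpectrum →ᵇ ℂ) : π.centralAt x f = π.central f x := rfl

theorem weylPhase_sub_self (μ : Fin 4) (t : ℝ) (a : Fin 4 → ℝ) :
    weylPhase (t • Pi.single μ 1) (a - t • Pi.single μ 1) = weylPhase (t • Pi.single μ 1) a := by
  ext s
  rw [weylPhase_apply, weylPhase_apply, Matrix.mulVec_sub, dotProduct_sub, dotProduct_self, sub_zero]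

theorem scaled_translate {Λ : Fin 4 → ℝ} {μ : Fin 4} (hΛ : Λ μ ≠ 0) (β : Fin 4 → ℝ) (t : ℝ) :
    Λ * (β + (-(Λ μ)⁻¹ * t) • Pi.single μ 1) = Λ * β - t • Pi.single μ 1 := by
  funext i
  by_cases hi : i = μ
  · subst hi
    simp only [Pi.mul_apply, Pi.add_apply, Pi.smul_apply, Pi.single_eq_same, smul_eq_mul, mul_one,
      Pi.sub_apply]
    field_simp
    ring
  · simp [hi]

set_option maxHeartbeats 400000 in
-- The vector `x` is arbitrary: the Weyl relation and a translation of the integration variable move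
-- the group parameter from the vector to the weight. Differentiating the weight gives `gaussDeriv`,
-- divided by the scale, and differentiating the central phase gives the terms `Q^{μν} Λ_ν β_ν`.
-- Both are again averages with a polynomial weight and a compactly supported central factor, so the
-- family of such averages is stable under the coordinates.
theorem hasCoord_smear {Λ : Fin 4 → ℝ} {μ : Fin 4} (hΛ : Λ μ ≠ 0) (j : Fin 4)
    (p : MvPolynomial (Fin 4) ℂ) (g : jointSpectrum →ᵇ ℂ) (hg : HasCompactSupport g) (x : H) :
    π.HasCoord j μ (π.smear Λ j p (π.central g x))
      ((Complex.I * (Λ μ : ℂ)⁻¹) • π.smear Λ j (gaussDeriv μ p) (π.central g x)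
        + ∑ ν, (-(1 / 2) * (Λ ν : ℂ)) •
          π.smear Λ j (MvPolynomial.X ν * p) (π.central (cutMul (entry μ ν) g hg) x)) := by
  set e : Fin 4 → ℝ := Pi.single μ 1 with he
  -- The integrand after `β` has been translated by `-t/Λ_μ` in the direction μ: now `t` enters only
  -- through the weight and the phase, and the Weyl operator no longer depends on it.
  set G : ℝ → (Fin 4 → ℝ) → H := fun t β =>
    polyGauss p (β + (-(Λ μ)⁻¹ * t) • e) • π.central (weylPhase (t • e) (Λ * β) * g)
      ((π.weyl j (Λ * β) : H →L[ℂ] H) x) with hG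
  set G' : ℝ → (Fin 4 → ℝ) → H := fun t β =>
    polyGauss p (β + (-(Λ μ)⁻¹ * t) • e) • π.central (weylPhase (t • e) (Λ * β) *
        phaseDeriv μ (Λ * β) g hg) ((π.weyl j (Λ * β) : H →L[ℂ] H) x)
    + ((-(Λ μ)⁻¹) • polyGauss (gaussDeriv μ p) (β + (-(Λ μ)⁻¹ * t) • e)) •
      π.central (weylPhase (t • e) (Λ * β) * g) ((π.weyl j (Λ * β) : H →L[ℂ] H) x) with hG'
  have hGweyl : ∀ t β, G t β = polyGauss p (β + (-(Λ μ)⁻¹ * t) • e) •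
      (π.weyl j (t • e) : H →L[ℂ] H) ((π.weyl j (Λ * (β + (-(Λ μ)⁻¹ * t) • e)) : H →L[ℂ] H)
        (π.central g x)) := by
    intro t β
    simp only [hG]
    rw [scaled_translate hΛ, weyl_mul_apply, weylPhase_sub_self, add_sub_cancel,
      ← central_mul_apply, central_weyl_apply]
  have horbit : π.orbit j μ (π.smear Λ j p (π.central g x)) = fun t => ∫ β, G t β := by
    funext t
    rw [orbit, smear_apply, ← ContinuousLinearMap.integral_comp_comm _ (π.integrable_smear _ _ _ _),
      ← integral_add_right_eq_self _ ((-(Λ μ)⁻¹ * t) • e)]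
    refine integral_congr_ae (Eventually.of_forall fun β => ?_)
    simp only [map_smul]
    rw [hGweyl]
  have hdiff : ∀ β t, HasDerivAt (fun t => G t β) (G' t β) t := by
    intro β t
    have h1 : HasDerivAt (fun t : ℝ => polyGauss p (β + (-(Λ μ)⁻¹ * t) • e))
        ((-(Λ μ)⁻¹) • polyGauss (gaussDeriv μ p) (β + (-(Λ μ)⁻¹ * t) • e)) t := by
      have h2 : HasDerivAt (fun t : ℝ => -(Λ μ)⁻¹ * t) (-(Λ μ)⁻¹) t := by
        simpa using (hasDerivAt_id t).const_mul (-(Λ μ)⁻¹)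
      exact HasDerivAt.scomp t (hasDerivAt_polyGauss_line p β μ (-(Λ μ)⁻¹ * t)) h2
    have h3 := ((π.centralAt ((π.weyl j (Λ * β) : H →L[ℂ] H) x)).restrictScalars
      ℝ).hasFDerivAt.comp_hasDerivAt t (hasDerivAt_weylPhase_mul μ (Λ * β) g hg t)
    exact h1.smul h3
  have hcont : ∀ t, Continuous (G t) := by
    intro t
    have : G t = fun β => polyGauss p (β + (-(Λ μ)⁻¹ * t) • e) •
      (π.weyl j (t • e) : H →L[ℂ] H) ((π.weyl j (Λ * (β + (-(Λ μ)⁻¹ * t) • e)) : H →L[ℂ] H)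
        (π.central g x)) := funext (hGweyl t)
    rw [this]
    exact ((continuous_polyGauss p).comp (by fun_prop)).smul
      ((π.weyl j (t • e) : H →L[ℂ] H).continuous.comp
        ((π.continuous_weyl_scaled Λ j _).comp (by fun_prop)))
  have hG'0 : G' 0 = fun β => (∑ ν, (-(Complex.I / 2) * (Λ ν : ℂ)) •
      polyGauss (MvPolynomial.X ν * p) β • (π.weyl j (Λ * β) : H →L[ℂ] H)
        (π.central (cutMul (entry μ ν) g hg) x)) +
      (-(Λ μ : ℂ)⁻¹) • polyGauss (gaussDeriv μ p) β • (π.weyl j (Λ * β) : H →L[ℂ] H)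
        (π.central g x) := by
    funext β
    have hph : weylPhase ((0 : ℝ) • e) (Λ * β) = 1 := by
      ext s
      simp [weylPhase_apply]
    simp only [hG', mul_zero, zero_smul, add_zero] at hph ⊢
    rw [hph, one_mul, one_mul]
    congr 1
    · rw [phaseDeriv, map_sum, _root_.sum_apply, Finset.smul_sum]
      refine Finset.sum_congr rfl fun ν _ => ?_
      rw [map_smul, _root_.smul_apply, central_weyl_apply, polyGauss_X_mul, smul_smul, smul_smul]
      congr 1
      simp only [Pi.mul_apply]
      push_cast
      ring
    · rw [central_weyl_apply, Complex.real_smul, smul_smul]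
      push_cast
      rfl
  have hintL : ∀ ν ∈ Finset.univ, Integrable fun β => (-(Complex.I / 2) * (Λ ν : ℂ)) •
      polyGauss (MvPolynomial.X ν * p) β • (π.weyl j (Λ * β) : H →L[ℂ] H)
        (π.central (cutMul (entry μ ν) g hg) x) :=
    fun ν _ => (π.integrable_smear Λ j _ _).smul _
  have hintR : Integrable fun β => (-(Λ μ : ℂ)⁻¹) • polyGauss (gaussDeriv μ p) β •
      (π.weyl j (Λ * β) : H →L[ℂ] H) (π.central g x) :=
    (π.integrable_smear Λ j _ _).smul _
  -- For `|t| ≤ 1` the translation has norm at most `|Λ μ|⁻¹`. `phaseDeriv` grows linearly in `β`,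
  -- so its coefficient needs one power of decay beyond the integrable order 5.
  obtain ⟨C₁, hC₁⟩ := polyGauss_translate_decay p 6 |Λ μ|⁻¹
  obtain ⟨C₂, hC₂⟩ := polyGauss_translate_decay (gaussDeriv μ p) 5 |Λ μ|⁻¹
  set M : ℝ := ∑ ν, ‖cutMul (entry μ ν) g hg‖ * |Λ ν| with hM
  have hM0 : 0 ≤ M := Finset.sum_nonneg fun _ _ => by positivity
  have hphase : ∀ (t : ℝ) β, ‖weylPhase (t • e) (Λ * β)‖ ≤ 1 := fun t β =>
    BoundedContinuousFunction.norm_ofNormedAddCommGroup_le _ zero_le_one _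
  have hpd : ∀ β : Fin 4 → ℝ, ‖phaseDeriv μ (Λ * β) g hg‖ ≤ M * (1 + ‖β‖) := by
    intro β
    rw [phaseDeriv, hM, Finset.sum_mul]
    refine (norm_sum_le _ _).trans (Finset.sum_le_sum fun ν _ => ?_)
    rw [norm_smul]
    have h1 : ‖-(Complex.I / 2) * ((Λ * β) ν : ℂ)‖ ≤ |Λ ν| * (1 + ‖β‖) := by
      rw [norm_mul, norm_neg, norm_div, Complex.norm_I, Complex.norm_real, Pi.mul_apply, norm_mul,
        Complex.norm_ofNat, Real.norm_eq_abs (Λ ν)]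
      have h2 := norm_le_pi_norm β ν
      have h3 : |Λ ν| * ‖β ν‖ ≤ |Λ ν| * (1 + ‖β‖) := by gcongr; linarith
      have h4 : 0 ≤ |Λ ν| * ‖β ν‖ := by positivity
      linarith
    calc _ ≤ |Λ ν| * (1 + ‖β‖) * ‖cutMul (entry μ ν) g hg‖ := by gcongr
      _ = _ := by ring
  have hbound : ∀ β, ∀ t ∈ Metric.ball (0 : ℝ) 1, ‖G' t β‖ ≤
      ((C₁ * M + |Λ μ|⁻¹ * C₂ * ‖g‖) * ‖x‖) * ((1 + ‖β‖) ^ 5)⁻¹ := by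
    intro β t ht
    have ht' : |t| ≤ 1 := by
      rw [Metric.mem_ball, dist_zero_right, Real.norm_eq_abs] at ht
      exact ht.le
    have hγ : ‖(-(Λ μ)⁻¹ * t) • e‖ ≤ |Λ μ|⁻¹ := by
      have h1 : ‖e‖ ≤ 1 := by
        refine (pi_norm_le_iff_of_nonneg zero_le_one).2 fun i => ?_
        by_cases hi : i = μ
        · subst hi; simp [he]
        · simp [he, hi]
      rw [norm_smul, norm_mul, norm_neg, norm_inv, Real.norm_eq_abs, Real.norm_eq_abs]
      calc |Λ μ|⁻¹ * |t| * ‖e‖ ≤ |Λ μ|⁻¹ * 1 * 1 := by gcongr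
        _ = _ := by ring
    have hpos : 0 < 1 + ‖β‖ := by positivity
    have b1 := hC₁ β _ hγ
    have b2 := hC₂ β _ hγ
    have n1 : ‖π.central (weylPhase (t • e) (Λ * β) * phaseDeriv μ (Λ * β) g hg)
        ((π.weyl j (Λ * β) : H →L[ℂ] H) x)‖ ≤ M * (1 + ‖β‖) * ‖x‖ := by
      refine (π.norm_central_apply_le _ _).trans ?_
      rw [norm_weyl_apply]
      gcongr
      refine (norm_mul_le _ _).trans ?_
      exact (mul_le_of_le_one_left (norm_nonneg _) (hphase t β)).trans (hpd β)
    have n2 : ‖π.central (weylPhase (t • e) (Λ * β) * g)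
        ((π.weyl j (Λ * β) : H →L[ℂ] H) x)‖ ≤ ‖g‖ * ‖x‖ := by
      refine (π.norm_central_apply_le _ _).trans ?_
      rw [norm_weyl_apply]
      gcongr
      refine (norm_mul_le _ _).trans ?_
      exact mul_le_of_le_one_left (norm_nonneg _) (hphase t β)
    rw [← div_eq_mul_inv, le_div_iff₀ (by positivity)]
    simp only [hG']
    calc _ ≤ (‖polyGauss p (β + (-(Λ μ)⁻¹ * t) • e)‖ * (M * (1 + ‖β‖) * ‖x‖) +
          |Λ μ|⁻¹ * ‖polyGauss (gaussDeriv μ p) (β + (-(Λ μ)⁻¹ * t) • e)‖ * (‖g‖ * ‖x‖)) *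
            (1 + ‖β‖) ^ 5 := by
          gcongr
          refine (norm_add_le _ _).trans ?_
          rw [norm_smul, norm_smul, norm_smul, norm_neg, norm_inv, Real.norm_eq_abs]
          gcongr
      _ = (((1 + ‖β‖) ^ 6 * ‖polyGauss p (β + (-(Λ μ)⁻¹ * t) • e)‖) * M +
          |Λ μ|⁻¹ * ((1 + ‖β‖) ^ 5 * ‖polyGauss (gaussDeriv μ p) (β + (-(Λ μ)⁻¹ * t) • e)‖) *
            ‖g‖) * ‖x‖ := by ring
      _ ≤ _ := mul_le_mul_of_nonneg_right (add_le_add (mul_le_mul_of_nonneg_right b1 hM0)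
          (mul_le_mul_of_nonneg_right (mul_le_mul_of_nonneg_left b2 (by positivity))
            (norm_nonneg _))) (norm_nonneg _)
  have key := (hasDerivAt_integral_of_dominated_loc_of_deriv_le (μ := volume)
    (Metric.ball_mem_nhds (0 : ℝ) one_pos)
    (Eventually.of_forall fun t => (hcont t).aestronglyMeasurable)
    (F := G) (F' := G')
    (by
      have : G 0 = fun β => polyGauss p β • (π.weyl j (Λ * β) : H →L[ℂ] H) (π.central g x) := by
        funext β
        rw [hGweyl]
        simp [weyl_zero]
      rw [this]
      exact π.integrable_smear Λ j p _)
    (by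
      rw [hG'0]
      exact ((integrable_finsetSum _ hintL).add hintR).aestronglyMeasurable)
    (Eventually.of_forall hbound) (integrable_decay _)
    (Eventually.of_forall fun β t _ => hdiff β t)).2
  unfold HasCoord
  rw [horbit]
  refine key.congr_deriv ?_
  rw [hG'0, integral_add (integrable_finsetSum _ hintL) hintR, integral_finsetSum _ hintL,
    integral_smul, ← smear_apply, smul_add, smul_smul, Finset.smul_sum, add_comm]
  congr 1
  · congr 1
    rw [← mul_assoc, Complex.I_mul_I]; ring
  · refine Finset.sum_congr rfl fun ν _ => ?_
    rw [integral_smul, ← smear_apply, smul_smul]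
    congr 1
    ring

end RegularRep

end

end QST

namespace QST

open Filter Topology MeasureTheory

noncomputable section

variable {H : Type*} [NormedAddCommGroup H] [InnerProductSpace ℂ H] [CompleteSpace H]

namespace RegularRep

variable (π : RegularRep H)

/-! ### The smooth vectors -/

theorem hasCoord_q (j μ : Fin 4) (ψ : π.smooth) : π.HasCoord j μ ψ (π.q j μ ψ) :=
  hasCoord_coord (π := π) ⟨ψ, (π.smooth_isInvariant j μ).1 ψ.2⟩

theorem coe_q_eq {j μ : Fin 4} {ψ : π.smooth} {y : H} (h : π.HasCoord j μ ψ y) :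
    (π.q j μ ψ : H) = y :=
  (π.hasCoord_q j μ ψ).unique h

/-- Maximality of `smooth`: to show that a vector is smooth, it suffices to place it in a subspace
stable under all the coordinates. -/
theorem le_smooth {D : Submodule ℂ H}
    (h : ∀ j μ, ∀ x ∈ D, ∃ y ∈ D, π.HasCoord j μ x y) : D ≤ π.smooth := by
  refine le_sSup fun j μ => ⟨fun x hx => ?_, fun ψ => ?_⟩
  · obtain ⟨y, -, hxy⟩ := h j μ x hx
    exact hxy.mem
  · obtain ⟨y, hy, hxy⟩ := h j μ ψ ψ.2
    rw [hxy.coord_eq]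
    exact hy

theorem span_le_smooth {S : Set H}
    (h : ∀ j μ, ∀ x ∈ S, ∃ y ∈ Submodule.span ℂ S, π.HasCoord j μ x y) :
    Submodule.span ℂ S ≤ π.smooth := by
  refine π.le_smooth fun j μ x hx => ?_
  induction hx using Submodule.span_induction with
  | mem x hx => exact h j μ x hx
  | zero => exact ⟨0, Submodule.zero_mem _, hasCoord_zero j μ⟩
  | add x y _ _ hx hy =>
    obtain ⟨x', hx', hx⟩ := hx
    obtain ⟨y', hy', hy⟩ := hy
    exact ⟨x' + y', Submodule.add_mem _ hx' hy', hx.add hy⟩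
  | smul c x _ hx =>
    obtain ⟨x', hx', hx⟩ := hx
    exact ⟨c • x', Submodule.smul_mem _ c hx', hx.smul c⟩

theorem central_mem_smooth (f : jointSpectrum →ᵇ ℂ) {x : H} (hx : x ∈ π.smooth) :
    π.central f x ∈ π.smooth := by
  refine π.span_le_smooth (S := {z | ∃ ψ : π.smooth, z = π.central f ψ}) ?_
    (Submodule.subset_span ⟨⟨x, hx⟩, rfl⟩)
  rintro j μ _ ⟨ψ, rfl⟩
  exact ⟨_, Submodule.subset_span ⟨π.q j μ ψ, rfl⟩, (π.hasCoord_q j μ ψ).central f⟩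

theorem smear_mem_smooth {Λ : Fin 4 → ℝ} (hΛ : ∀ μ, Λ μ ≠ 0) (j : Fin 4)
    (p : MvPolynomial (Fin 4) ℂ) {g : jointSpectrum →ᵇ ℂ} (hg : HasCompactSupport g)
    {x : H} (hx : x ∈ π.smooth) : π.smear Λ j p (π.central g x) ∈ π.smooth := by
  refine π.span_le_smooth (S := {z | ∃ (p : MvPolynomial (Fin 4) ℂ) (g : jointSpectrum →ᵇ ℂ)
    (_ : HasCompactSupport g) (ψ : π.smooth), z = π.smear Λ j p (π.central g ψ)}) ?_
    (Submodule.subset_span ⟨p, g, hg, ⟨x, hx⟩, rfl⟩)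
  rintro k μ _ ⟨p, g, hg, ψ, rfl⟩
  by_cases hjk : k = j
  · subst hjk
    refine ⟨_, ?_, π.hasCoord_smear (hΛ μ) k p g hg ψ⟩
    refine Submodule.add_mem _ (Submodule.smul_mem _ _ (Submodule.subset_span ⟨_, g, hg, ψ, rfl⟩))
      (Submodule.sum_mem _ fun ν _ => Submodule.smul_mem _ _
        (Submodule.subset_span ⟨_, _, hasCompactSupport_cutMul _ hg, ψ, rfl⟩))
  · exact ⟨_, Submodule.subset_span ⟨p, g, hg, π.q k μ ψ, rfl⟩,
      ((π.hasCoord_q k μ ψ).central g).smear hjk Λ p⟩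

/-- The product of Gaussian averages over all four events. -/
def smearAll (Λ : Fin 4 → ℝ) (p : Fin 4 → MvPolynomial (Fin 4) ℂ) : H →L[ℂ] H :=
  π.smear Λ 0 (p 0) * π.smear Λ 1 (p 1) * π.smear Λ 2 (p 2) * π.smear Λ 3 (p 3)

theorem smearAll_apply (Λ : Fin 4 → ℝ) (p : Fin 4 → MvPolynomial (Fin 4) ℂ) (x : H) :
    π.smearAll Λ p x =
      π.smear Λ 0 (p 0) (π.smear Λ 1 (p 1) (π.smear Λ 2 (p 2) (π.smear Λ 3 (p 3) x))) := rfl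

/-- `smearAll` with the factor of the event `j` moved to the right. -/
theorem exists_smearAll_eq (Λ : Fin 4 → ℝ) (p : Fin 4 → MvPolynomial (Fin 4) ℂ) (j : Fin 4) :
    ∃ a b c : Fin 4, a ≠ j ∧ b ≠ j ∧ c ≠ j ∧ ∀ (r : MvPolynomial (Fin 4) ℂ) (x : H),
      π.smearAll Λ (Function.update p j r) x =
        π.smear Λ a (p a) (π.smear Λ b (p b) (π.smear Λ c (p c) (π.smear Λ j r x))) := by
  fin_cases j
  · refine ⟨1, 2, 3, by decide, by decide, by decide, fun r x => ?_⟩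
    rw [smearAll_apply]
    simp only [Fin.zero_eta, Function.update_self, ne_eq, one_ne_zero, not_false_eq_true,
      Function.update_of_ne, Fin.reduceEq]
    rw [π.smear_smear (j := 0) (k := 1) (by decide), π.smear_smear (j := 0) (k := 2) (by decide),
      π.smear_smear (j := 0) (k := 3) (by decide)]
  · refine ⟨0, 2, 3, by decide, by decide, by decide, fun r x => ?_⟩
    rw [smearAll_apply]
    simp only [Fin.mk_one, Function.update_self, ne_eq, zero_ne_one, not_false_eq_true,
      Function.update_of_ne, Fin.reduceEq]
    rw [π.smear_smear (j := 1) (k := 2) (by decide), π.smear_smear (j := 1) (k := 3) (by decide)]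
  · refine ⟨0, 1, 3, by decide, by decide, by decide, fun r x => ?_⟩
    rw [smearAll_apply]
    simp only [Fin.reduceFinMk, Function.update_self, ne_eq, not_false_eq_true,
      Function.update_of_ne, Fin.reduceEq]
    rw [π.smear_smear (j := 2) (k := 3) (by decide)]
  · refine ⟨0, 1, 2, by decide, by decide, by decide, fun r x => ?_⟩
    rw [smearAll_apply]
    simp only [Fin.reduceFinMk, Function.update_self, ne_eq, not_false_eq_true,
      Function.update_of_ne, Fin.reduceEq]

/-- With all four events averaged no regularity of `x` is needed. Each coordinate acts on the factor
of its own event through `hasCoord_smear` and commutes with the others, so the span over all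
polynomials and all cutoffs is invariant. -/
theorem smearAll_mem_smooth {Λ : Fin 4 → ℝ} (hΛ : ∀ μ, Λ μ ≠ 0)
    (p : Fin 4 → MvPolynomial (Fin 4) ℂ) {g : jointSpectrum →ᵇ ℂ} (hg : HasCompactSupport g)
    (x : H) : π.smearAll Λ p (π.central g x) ∈ π.smooth := by
  refine π.span_le_smooth (S := {z | ∃ (p : Fin 4 → MvPolynomial (Fin 4) ℂ)
    (g : jointSpectrum →ᵇ ℂ) (_ : HasCompactSupport g), z = π.smearAll Λ p (π.central g x)}) ?_
    (Submodule.subset_span ⟨p, g, hg, rfl⟩)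
  rintro j μ _ ⟨p, g, hg, rfl⟩
  obtain ⟨a, b, c, ha, hb, hc, h⟩ := π.exists_smearAll_eq Λ p j
  have key := (((π.hasCoord_smear (hΛ μ) j (p j) g hg x).smear hc.symm Λ (p c)).smear
    hb.symm Λ (p b)).smear ha.symm Λ (p a)
  rw [← h, Function.update_eq_self] at key
  refine ⟨_, ?_, key⟩
  simp only [map_add, map_smul, map_sum, ← h]
  exact Submodule.add_mem _ (Submodule.smul_mem _ _ (Submodule.subset_span ⟨_, g, hg, rfl⟩))
    (Submodule.sum_mem _ fun ν _ => Submodule.smul_mem _ _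
      (Submodule.subset_span ⟨_, _, hasCompactSupport_cutMul _ hg, rfl⟩))

theorem tendsto_smear_one' {Λ : ℕ → Fin 4 → ℝ} (hΛ : Tendsto Λ atTop (𝓝 0)) (j : Fin 4)
    {x : ℕ → H} {y : H} (hx : Tendsto x atTop (𝓝 y)) :
    Tendsto (fun n => π.smear (Λ n) j 1 (x n)) atTop (𝓝 y) := by
  have h1 : Tendsto (fun n => π.smear (Λ n) j 1 (x n - y)) atTop (𝓝 0) := by
    refine squeeze_zero_norm (fun n => π.norm_smear_apply_le (Λ n) j 1 (x n - y)) ?_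
    have h2 : Tendsto (fun n => ‖x n - y‖) atTop (𝓝 0) := by
      have := (hx.sub_const y).norm
      simpa using this
    simpa using h2.const_mul (∫ β, ‖polyGauss 1 β‖)
  have h3 := h1.add (π.tendsto_smear_one hΛ j y)
  simpa using h3

theorem tendsto_smearAll {Λ : ℕ → Fin 4 → ℝ} (hΛ : Tendsto Λ atTop (𝓝 0)) (x : H) :
    Tendsto (fun n => π.smearAll (Λ n) 1 x) atTop (𝓝 x) :=
  π.tendsto_smear_one' hΛ 0 (π.tendsto_smear_one' hΛ 1 (π.tendsto_smear_one' hΛ 2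
    (π.tendsto_smear_one' hΛ 3 tendsto_const_nhds)))

theorem dense_smooth : Dense (π.smooth : Set H) := by
  intro x
  have hmem : ∀ m, π.central (cutoff m) x ∈ closure (π.smooth : Set H) := fun m => by
    have hΛ : Tendsto (fun n : ℕ => (fun _ => 1 / ((n : ℝ) + 1) : Fin 4 → ℝ)) atTop (𝓝 0) :=
      tendsto_pi_nhds.2 fun _ => tendsto_one_div_add_atTop_nhds_zero_nat
    refine mem_closure_of_tendsto (π.tendsto_smearAll hΛ (π.central (cutoff m) x))
      (Eventually.of_forall fun n => ?_)
    exact π.smearAll_mem_smooth (fun μ => by positivity) 1 (hasCompactSupport_cutoff m) x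
  exact isClosed_closure.mem_of_tendsto (π.tendsto_central_cutoff x) (Eventually.of_forall hmem)

theorem eq_of_inner_smooth {x y : H} (h : ∀ χ : π.smooth, inner ℂ (χ : H) x = inner ℂ (χ : H) y) :
    x = y := by
  refine π.dense_smooth.eq_of_inner_left ℂ fun v hv => ?_
  rw [← inner_conj_symm, h ⟨v, hv⟩, inner_conj_symm]

/-! ### Operators on the smooth vectors -/

/-- The operator `f(Q)`, `f` bounded, on the smooth vectors. -/
def centralEnd (f : jointSpectrum →ᵇ ℂ) : Module.End ℂ π.smooth :=
  (π.central f : H →ₗ[ℂ] H).restrict fun _ hx => π.central_mem_smooth f hx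

@[simp] theorem coe_centralEnd (f : jointSpectrum →ᵇ ℂ) (ψ : π.smooth) :
    (π.centralEnd f ψ : H) = π.central f ψ := rfl

theorem q_comm_centralEnd (f : jointSpectrum →ᵇ ℂ) (j μ : Fin 4) :
    Commute (π.q j μ) (π.centralEnd f) := by
  ext ψ
  exact π.coe_q_eq ((π.hasCoord_q j μ ψ).central f)

theorem q_symm (j μ : Fin 4) (ψ χ : π.smooth) :
    inner ℂ (π.q j μ ψ : H) (χ : H) = inner ℂ (ψ : H) (π.q j μ χ : H) :=
  (π.hasCoord_q j μ ψ).inner_eq (π.hasCoord_q j μ χ)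

/-- The Weyl operators of the event `k` commute with the group of the event `j`, hence preserve the
domain of `q_j^μ`. To avoid asking whether orbits stay smooth, `q_j^μ` is moved onto the test vector
`χ` before differentiating at `s = 0`. -/
theorem q_comm_of_ne {j k : Fin 4} (hjk : j ≠ k) (μ ν : Fin 4) :
    Commute (π.q j μ) (π.q k ν) := by
  ext ψ
  refine π.eq_of_inner_smooth fun χ => ?_
  have h1 : ∀ s, inner ℂ (χ : H) (π.orbit k ν (π.q j μ ψ) s) =
      inner ℂ (π.q j μ χ : H) (π.orbit k ν ψ s) := fun s => by
    refine ((π.hasCoord_q j μ χ).inner_eq ((π.hasCoord_q j μ ψ).map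
      (C := (π.weyl k (s • Pi.single ν 1) : H →L[ℂ] H)) fun α x => ?_)).symm
    exact DFunLike.congr_fun (π.weyl_comm k j _ α hjk.symm).eq x
  have h2 := (innerSL ℂ (χ : H)).restrictScalars ℝ |>.hasFDerivAt.comp_hasDerivAt (0 : ℝ)
    (π.hasCoord_q k ν (π.q j μ ψ))
  have h3 := (innerSL ℂ (π.q j μ χ : H)).restrictScalars ℝ |>.hasFDerivAt.comp_hasDerivAt (0 : ℝ)
    (π.hasCoord_q k ν ψ)
  have h4 := h2.unique (by convert h3 using 1; exact funext h1)
  simp only [ContinuousLinearMap.coe_restrictScalars', innerSL_apply_apply, inner_smul_right,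
    mul_eq_mul_left_iff, Complex.I_ne_zero, or_false] at h4
  change inner ℂ (χ : H) (π.q j μ (π.q k ν ψ) : H) = inner ℂ (χ : H) (π.q k ν (π.q j μ ψ) : H)
  rw [h4, q_symm]

/-- The Weyl relation, differentiated once in each parameter. It is used in weak form, with the
operators on both sides of the inner product, since an orbit is not known to stay smooth; `g` makes
the phase differentiable in norm. -/
theorem inner_commutator (j μ ν : Fin 4) {g : jointSpectrum →ᵇ ℂ} (hg : HasCompactSupport g)
    (χ ψ : π.smooth) :
    inner ℂ (π.q j μ χ : H) (π.q j ν (π.centralEnd g ψ) : H) -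
      inner ℂ (π.q j ν χ : H) (π.q j μ (π.centralEnd g ψ) : H) =
      Complex.I * inner ℂ (χ : H) (π.central (cutMul (entry μ ν) g hg) ψ) := by
  set e : Fin 4 → ℝ := Pi.single μ 1 with he
  set e' : Fin 4 → ℝ := Pi.single ν 1 with he'
  have hneg : ∀ (κ : Fin 4) (φ : π.smooth),
      HasDerivAt (fun t : ℝ => π.orbit j κ φ (-t)) (-(Complex.I • (π.q j κ φ : H))) 0 := by
    intro κ φ
    have h4 : HasDerivAt (π.orbit j κ φ) (Complex.I • (π.q j κ φ : H)) (-(0 : ℝ)) := by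
      rw [neg_zero]; exact π.hasCoord_q j κ φ
    have := HasDerivAt.scomp (0 : ℝ) h4 (hasDerivAt_neg (0 : ℝ))
    simpa [Function.comp_def] using this
  -- By antisymmetry, exchanging the two Weyl operators multiplies by the square of their phase; the
  -- correction is written as one phase with argument `-2t`, so that `hasDerivAt_weylPhase_mul`
  -- applies to it.
  have hphase : ∀ t s : ℝ, weylPhase (t • e) (s • e') =
      weylPhase (s • e') (t • e) * weylPhase (s • e') ((-2 * t) • e) := by
    intro t s
    ext σ
    rw [BoundedContinuousFunction.mul_apply]
    simp only [he, he', weylPhase_single_apply, Matrix.mulVec_smul, Matrix.mulVec_single_one,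
      Pi.smul_apply, Matrix.col_apply, smul_eq_mul]
    rw [← Complex.exp_add, entry_antisymm σ μ ν]
    congr 1
    push_cast
    ring
  have h1 : ∀ t s : ℝ, inner ℂ (π.orbit j μ χ (-t)) (π.orbit j ν (π.centralEnd g ψ) s) =
      inner ℂ (π.orbit j ν χ (-s)) ((π.weyl j (t • e) : H →L[ℂ] H)
        (π.central (weylPhase (s • e') ((-2 * t) • e) * g) ψ)) := by
    intro t s
    rw [orbit, orbit, orbit, weyl_inner_left, weyl_inner_left, ← neg_smul, ← neg_smul, neg_neg,
      neg_neg, weyl_mul_apply, weyl_mul_apply, coe_centralEnd, ← central_mul_apply,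
      ← central_mul_apply, hphase, mul_assoc, add_comm]
  have hpd : ∀ t : ℝ, phaseDeriv ν ((-2 * t) • e) g hg =
      (-(Complex.I * t)) • cutMul (entry μ ν) g hg := by
    intro t
    ext σ
    rw [phaseDeriv_apply]
    simp only [he, Matrix.mulVec_smul, Matrix.mulVec_single_one, Pi.smul_apply, Matrix.col_apply,
      smul_eq_mul, BoundedContinuousFunction.coe_smul, cutMul_apply, entry_apply]
    rw [entry_antisymm σ ν μ]
    push_cast
    ring
  -- The derivative of `h1` in `s` at zero. The phase contributes a term with an explicit factor
  -- `t`, so the remaining derivative in `t` at zero involves that term only through its value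
  -- there.
  have h2 : ∀ t : ℝ, inner ℂ (π.orbit j μ χ (-t))
      (Complex.I • (π.q j ν (π.centralEnd g ψ) : H)) =
      t * inner ℂ (χ : H) (π.orbit j μ ((-Complex.I) •
        π.centralEnd (cutMul (entry μ ν) g hg) ψ : π.smooth) t) +
      inner ℂ (-(Complex.I • (π.q j ν χ : H))) (π.orbit j μ (π.centralEnd g ψ) t) := by
    intro t
    have d1 := HasDerivAt.inner ℂ (hasDerivAt_const (0 : ℝ) (π.orbit j μ χ (-t)))
      (π.hasCoord_q j ν (π.centralEnd g ψ))
    have d2 := (((π.weyl j (t • e) : H →L[ℂ] H) ∘L π.centralAt (ψ : H)).restrictScalars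
      ℝ).hasFDerivAt.comp_hasDerivAt (0 : ℝ)
        (hasDerivAt_weylPhase_mul ν ((-2 * t) • e) g hg 0)
    have d3 := HasDerivAt.inner ℂ (hneg ν χ) d2
    have d4 := d1.unique (d3.congr_of_eventuallyEq (Eventually.of_forall (h1 t)))
    have hph : weylPhase ((0 : ℝ) • (Pi.single ν 1 : Fin 4 → ℝ)) ((-2 * t) • e) = 1 := by
      ext s
      simp [weylPhase_apply]
    have ho : π.orbit j ν (χ : H) (-0) = χ := by
      simp [orbit, weyl_zero]
    rw [inner_zero_left, add_zero, ho] at d4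
    rw [d4]
    simp only [ContinuousLinearMap.coe_restrictScalars', ContinuousLinearMap.comp_apply,
      Function.comp_apply, centralAt_apply, hph, one_mul, hpd, orbit, coe_centralEnd,
      Submodule.coe_smul, map_smul, inner_smul_right]
    congr 1
    ring
  -- The derivative of `h2` in `t` at zero, computed on both sides.
  have d1 := HasDerivAt.inner ℂ (hneg μ χ)
    (hasDerivAt_const (0 : ℝ) (Complex.I • (π.q j ν (π.centralEnd g ψ) : H)))
  have d2 := HasDerivAt.fun_mul (Complex.ofRealCLM.hasDerivAt (x := (0 : ℝ)))
    (HasDerivAt.inner ℂ (hasDerivAt_const (0 : ℝ) (χ : H))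
      (π.hasCoord_q j μ ((-Complex.I) • π.centralEnd (cutMul (entry μ ν) g hg) ψ)))
  have d3 := HasDerivAt.inner ℂ (hasDerivAt_const (0 : ℝ) (-(Complex.I • (π.q j ν χ : H))))
    (π.hasCoord_q j μ (π.centralEnd g ψ))
  have d4 := d1.unique (by convert d2.fun_add d3 using 1; exact funext h2)
  have ho : π.orbit j μ ((((-Complex.I) • π.centralEnd (cutMul (entry μ ν) g hg) ψ :
      π.smooth)) : H) 0 = (-Complex.I) • π.central (cutMul (entry μ ν) g hg) ψ := by
    simp [orbit, weyl_zero]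
  simp only [inner_zero_right, inner_zero_left, zero_add, add_zero, ho, Complex.ofRealCLM_apply,
    Complex.ofReal_zero, Complex.ofReal_one, zero_mul, one_mul, inner_neg_left, inner_smul_left,
    inner_smul_right, Complex.conj_I] at d4
  have hI : Complex.I * Complex.I = -1 := Complex.I_mul_I
  linear_combination -d4 - (inner ℂ (π.q j ν χ : H) (π.q j μ (π.centralEnd g ψ) : H) -
    inner ℂ (π.q j μ χ : H) (π.q j ν (π.centralEnd g ψ) : H)) * hI

/-- The commutator is the unbounded function `Q^{μν}` of the centre, whatever the event `j`.
Uniqueness of central application then identifies the commutators of all events with that of the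
first. -/
theorem commutator_isCentralApply (j μ ν : Fin 4) (ψ : π.smooth) :
    π.IsCentralApply (entry μ ν) ψ
      (((-Complex.I) • (π.q j μ * π.q j ν - π.q j ν * π.q j μ)) ψ : π.smooth) := by
  rw [isCentralApply_iff]
  intro g hg
  refine π.eq_of_inner_smooth fun χ => ?_
  have h := π.inner_commutator j μ ν hg χ ψ
  rw [q_symm, q_symm, ← inner_sub_right] at h
  have h1 : ∀ κ τ, (π.q j κ (π.q j τ (π.centralEnd g ψ)) : H) =
      π.central g (π.q j κ (π.q j τ ψ)) := by
    intro κ τ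
    have e1 : π.q j τ (π.centralEnd g ψ) = π.centralEnd g (π.q j τ ψ) :=
      LinearMap.congr_fun (π.q_comm_centralEnd g j τ).eq ψ
    have e2 : π.q j κ (π.centralEnd g (π.q j τ ψ)) = π.centralEnd g (π.q j κ (π.q j τ ψ)) :=
      LinearMap.congr_fun (π.q_comm_centralEnd g j κ).eq _
    rw [e1, e2, coe_centralEnd]
  rw [h1, h1, ← map_sub] at h
  simp only [LinearMap.smul_apply, LinearMap.sub_apply, Module.End.mul_apply, Submodule.coe_smul,
    Submodule.coe_sub, map_smul, inner_smul_right]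
  rw [h, ← mul_assoc, neg_mul, Complex.I_mul_I]
  ring

end RegularRep

end

end QST

namespace QST

open Filter Topology MeasureTheory

noncomputable section

/-! ### Alternating sums -/

/-- The alternating sum over the six orderings of three indices. -/
def alt {E : Type*} [Ring E] (f : Fin 4 → Fin 4 → Fin 4 → E) (a b c : Fin 4) : E :=
  f a b c + f b c a + f c a b - f b a c - f a c b - f c b a

/-- The three indices other than `σ`, in the order `(a, b, c)` with `ε_{abcσ} = 1`. -/
def triple (σ : Fin 4) : Fin 4 × Fin 4 × Fin 4 :=
  ![(2, 1, 3), (0, 2, 3), (1, 0, 3), (0, 1, 2)] σ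

theorem eps_eq (μ ν ρ σ : Fin 4) : eps μ ν ρ σ =
    if (μ, ν, ρ) = triple σ ∨ (ν, ρ, μ) = triple σ ∨ (ρ, μ, ν) = triple σ then 1
    else if (ν, μ, ρ) = triple σ ∨ (μ, ρ, ν) = triple σ ∨ (ρ, ν, μ) = triple σ then -1 else 0 := by
  simp only [eps, Matrix.det_succ_row_zero, Fin.sum_univ_succ]
  revert μ ν ρ σ
  decide +kernel

theorem sum_eps_smul {E : Type*} [Ring E] (f : Fin 4 → Fin 4 → Fin 4 → E) (σ : Fin 4) :
    ∑ μ, ∑ ν, ∑ ρ, eps μ ν ρ σ • f μ ν ρ =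
      alt f (triple σ).1 (triple σ).2.1 (triple σ).2.2 := by
  simp only [eps_eq]
  fin_cases σ <;> simp [triple, Fin.sum_univ_four, alt] <;> abel

theorem triple_ne (σ : Fin 4) : (triple σ).1 ≠ σ ∧ (triple σ).2.1 ≠ σ ∧ (triple σ).2.2 ≠ σ := by
  revert σ; decide

/-- The order and bracketing of the 24 terms are those of the recursive enumeration of permutations,
so that `rfl` closes the goal. -/
theorem sum_perm_four {R : Type*} [Ring R] (f : Fin 4 → Fin 4 → Fin 4 → Fin 4 → R) :
    ∑ p : Equiv.Perm (Fin 4), (Equiv.Perm.sign p : ℤ) • f (p 0) (p 1) (p 2) (p 3) =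
      ((f 0 1 2 3 + -f 0 1 3 2) + ((-f 0 2 1 3 + f 0 2 3 1) + (-f 0 3 2 1 + f 0 3 1 2))) +
      (((-f 1 0 2 3 + f 1 0 3 2) + ((f 1 2 0 3 + -f 1 2 3 0) + (f 1 3 2 0 + -f 1 3 0 2))) +
      (((-f 2 1 0 3 + f 2 1 3 0) + ((f 2 0 1 3 + -f 2 0 3 1) + (f 2 3 0 1 + -f 2 3 1 0))) +
      ((-f 3 1 2 0 + f 3 1 0 2) + ((f 3 2 1 0 + -f 3 2 0 1) + (f 3 0 2 1 + -f 3 0 1 2))))) := by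
  simp only [Finset.univ_perm_fin_succ, Finset.sum_map, ← Finset.univ_product_univ,
    Finset.sum_product, Fin.sum_univ_succ]
  simp
  rfl

/-! ### Algebra of the coordinates -/

section Algebra

variable {R : Type*} [Ring R] [Algebra ℂ R]

/-- The product of coordinates of three events. -/
def qqq (q : Fin 4 → Fin 4 → R) (j k l μ ν ρ : Fin 4) : R := q j μ * q k ν * q l ρ

/-- The alternating sum of the products of coordinates of three distinct events. -/
def volumeSum (q : Fin 4 → Fin 4 → R) (μ ν ρ : Fin 4) : R :=
  qqq q 1 2 3 μ ν ρ - qqq q 0 2 3 μ ν ρ + qqq q 0 1 3 μ ν ρ - qqq q 0 1 2 μ ν ρ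

/-- Coordinates of distinct events commute, so each term of the determinant can be sorted by events
at the cost of permuting its indices. Under the alternation the six orderings of each set of three
events contribute equally, which cancels the factor `1/6`. -/
theorem alt_rowDet {q : Fin 4 → Fin 4 → R}
    (hc : ∀ j k, j ≠ k → ∀ μ ν, q j μ * q k ν = q k ν * q j μ) (a b c : Fin 4) :
    (1 / 6 : ℂ) • alt (fun μ ν ρ => rowDet (Matrix.of fun j => ![1, q j μ, q j ν, q j ρ])) a b c =
      alt (volumeSum q) a b c := by
  -- The first column is constant, so `p 0` is the omitted event and drops out of the product.
  have h' : ∀ μ ν ρ, rowDet (Matrix.of fun j => ![1, q j μ, q j ν, q j ρ]) =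
      ∑ p : Equiv.Perm (Fin 4), (Equiv.Perm.sign p : ℤ) •
        (fun _ j k l => qqq q j k l μ ν ρ) (p 0) (p 1) (p 2) (p 3) := by
    intro μ ν ρ
    simp [rowDet, qqq]
  have h := fun μ ν ρ => (h' μ ν ρ).trans (sum_perm_four fun _ j k l => qqq q j k l μ ν ρ)
  simp only [h]
  have c10 : ∀ μ ν, q 1 μ * q 0 ν = q 0 ν * q 1 μ :=
    fun μ ν => hc _ _ (by decide) μ ν
  have c20 : ∀ μ ν, q 2 μ * q 0 ν = q 0 ν * q 2 μ :=
    fun μ ν => hc _ _ (by decide) μ ν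
  have c30 : ∀ μ ν, q 3 μ * q 0 ν = q 0 ν * q 3 μ :=
    fun μ ν => hc _ _ (by decide) μ ν
  have c21 : ∀ μ ν, q 2 μ * q 1 ν = q 1 ν * q 2 μ :=
    fun μ ν => hc _ _ (by decide) μ ν
  have c31 : ∀ μ ν, q 3 μ * q 1 ν = q 1 ν * q 3 μ :=
    fun μ ν => hc _ _ (by decide) μ ν
  have c32 : ∀ μ ν, q 3 μ * q 2 ν = q 2 ν * q 3 μ :=
    fun μ ν => hc _ _ (by decide) μ ν
  have s132 : ∀ μ ν ρ, qqq q 1 3 2 μ ν ρ = qqq q 1 2 3 μ ρ ν := fun μ ν ρ => by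
    simp only [qqq, mul_assoc, c32]
  have s213 : ∀ μ ν ρ, qqq q 2 1 3 μ ν ρ = qqq q 1 2 3 ν μ ρ := fun μ ν ρ => by
    simp only [qqq, c21]
  have s231 : ∀ μ ν ρ, qqq q 2 3 1 μ ν ρ = qqq q 1 2 3 ρ μ ν := fun μ ν ρ => by
    simp only [qqq, mul_assoc, c31]; simp only [← mul_assoc, c21]
  have s321 : ∀ μ ν ρ, qqq q 3 2 1 μ ν ρ = qqq q 1 2 3 ρ ν μ := fun μ ν ρ => by
    simp only [qqq, mul_assoc, c21]; simp only [← mul_assoc, c31]; simp only [mul_assoc, c32]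
  have s312 : ∀ μ ν ρ, qqq q 3 1 2 μ ν ρ = qqq q 1 2 3 ν ρ μ := fun μ ν ρ => by
    simp only [qqq, c31]; simp only [mul_assoc, c32]
  have s032 : ∀ μ ν ρ, qqq q 0 3 2 μ ν ρ = qqq q 0 2 3 μ ρ ν := fun μ ν ρ => by
    simp only [qqq, mul_assoc, c32]
  have s203 : ∀ μ ν ρ, qqq q 2 0 3 μ ν ρ = qqq q 0 2 3 ν μ ρ := fun μ ν ρ => by
    simp only [qqq, c20]
  have s230 : ∀ μ ν ρ, qqq q 2 3 0 μ ν ρ = qqq q 0 2 3 ρ μ ν := fun μ ν ρ => by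
    simp only [qqq, mul_assoc, c30]; simp only [← mul_assoc, c20]
  have s320 : ∀ μ ν ρ, qqq q 3 2 0 μ ν ρ = qqq q 0 2 3 ρ ν μ := fun μ ν ρ => by
    simp only [qqq, mul_assoc, c20]; simp only [← mul_assoc, c30]; simp only [mul_assoc, c32]
  have s302 : ∀ μ ν ρ, qqq q 3 0 2 μ ν ρ = qqq q 0 2 3 ν ρ μ := fun μ ν ρ => by
    simp only [qqq, c30]; simp only [mul_assoc, c32]
  have s031 : ∀ μ ν ρ, qqq q 0 3 1 μ ν ρ = qqq q 0 1 3 μ ρ ν := fun μ ν ρ => by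
    simp only [qqq, mul_assoc, c31]
  have s103 : ∀ μ ν ρ, qqq q 1 0 3 μ ν ρ = qqq q 0 1 3 ν μ ρ := fun μ ν ρ => by
    simp only [qqq, c10]
  have s130 : ∀ μ ν ρ, qqq q 1 3 0 μ ν ρ = qqq q 0 1 3 ρ μ ν := fun μ ν ρ => by
    simp only [qqq, mul_assoc, c30]; simp only [← mul_assoc, c10]
  have s310 : ∀ μ ν ρ, qqq q 3 1 0 μ ν ρ = qqq q 0 1 3 ρ ν μ := fun μ ν ρ => by
    simp only [qqq, mul_assoc, c10]; simp only [← mul_assoc, c30]; simp only [mul_assoc, c31]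
  have s301 : ∀ μ ν ρ, qqq q 3 0 1 μ ν ρ = qqq q 0 1 3 ν ρ μ := fun μ ν ρ => by
    simp only [qqq, c30]; simp only [mul_assoc, c31]
  have s021 : ∀ μ ν ρ, qqq q 0 2 1 μ ν ρ = qqq q 0 1 2 μ ρ ν := fun μ ν ρ => by
    simp only [qqq, mul_assoc, c21]
  have s102 : ∀ μ ν ρ, qqq q 1 0 2 μ ν ρ = qqq q 0 1 2 ν μ ρ := fun μ ν ρ => by
    simp only [qqq, c10]
  have s120 : ∀ μ ν ρ, qqq q 1 2 0 μ ν ρ = qqq q 0 1 2 ρ μ ν := fun μ ν ρ => by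
    simp only [qqq, mul_assoc, c20]; simp only [← mul_assoc, c10]
  have s210 : ∀ μ ν ρ, qqq q 2 1 0 μ ν ρ = qqq q 0 1 2 ρ ν μ := fun μ ν ρ => by
    simp only [qqq, mul_assoc, c10]; simp only [← mul_assoc, c20]; simp only [mul_assoc, c21]
  have s201 : ∀ μ ν ρ, qqq q 2 0 1 μ ν ρ = qqq q 0 1 2 ν ρ μ := fun μ ν ρ => by
    simp only [qqq, c20]; simp only [mul_assoc, c21]
  simp only [s132, s213, s231, s321, s312, s032, s203, s230, s320, s302, s031, s103, s130, s310,
    s301, s021, s102, s120, s210, s201, alt, volumeSum]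
  module

theorem alt_Q_mul {Q : Fin 4 → Fin 4 → R} (hQ : ∀ μ ν, Q μ ν = -Q ν μ) (y : Fin 4 → R)
    (a b c : Fin 4) :
    (1 / 2 : ℂ) • alt (fun μ ν ρ => Q μ ν * y ρ) a b c =
      Q a b * y c + Q b c * y a + Q c a * y b := by
  rw [alt, hQ b a, hQ a c, hQ c b]
  simp only [neg_mul]
  module

/-- Of the eight products in the expansion, four have distinct events and form `volumeSum`. The
others contain the events 122, 113, 112, 022, counted from zero, with signs `-, -, +, +`.
Alternation turns the repeated, adjacent pair into a commutator and leaves the coordinate of the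
event 1, 3, 2, 0; this is the sign pattern of `B`. -/
theorem alt_differences {q Q : Fin 4 → Fin 4 → R}
    (hqQ : ∀ j κ μ ν, q j κ * Q μ ν = Q μ ν * q j κ)
    (hq : ∀ j μ ν, q j μ * q j ν - q j ν * q j μ = Complex.I • Q μ ν) (a b c : Fin 4) :
    alt (fun μ ν ρ => (q 1 μ - q 0 μ) * (q 2 ν - q 1 ν) * (q 3 ρ - q 2 ρ)) a b c =
      alt (volumeSum q) a b c + Complex.I • (Q a b * (q 0 c - q 1 c + q 2 c - q 3 c) +
        Q b c * (q 0 a - q 1 a + q 2 a - q 3 a) + Q c a * (q 0 b - q 1 b + q 2 b - q 3 b)) := by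
  have e1 : ∀ j k, alt (qqq q j k k) a b c =
      Complex.I • (Q a b * q j c + Q b c * q j a + Q c a * q j b) := by
    intro j k
    have : alt (qqq q j k k) a b c = q j a * (q k b * q k c - q k c * q k b) +
        q j b * (q k c * q k a - q k a * q k c) + q j c * (q k a * q k b - q k b * q k a) := by
      simp only [alt, qqq]; noncomm_ring
    rw [this, hq, hq, hq]
    simp only [mul_smul_comm, hqQ]
    module
  have e2 : ∀ j k, alt (qqq q k k j) a b c =
      Complex.I • (Q a b * q j c + Q b c * q j a + Q c a * q j b) := by
    intro j k
    have : alt (qqq q k k j) a b c = (q k b * q k c - q k c * q k b) * q j a +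
        (q k c * q k a - q k a * q k c) * q j b + (q k a * q k b - q k b * q k a) * q j c := by
      simp only [alt, qqq]; noncomm_ring
    rw [this, hq, hq, hq]
    simp only [smul_mul_assoc]
    module
  have e3 : alt (fun μ ν ρ => (q 1 μ - q 0 μ) * (q 2 ν - q 1 ν) * (q 3 ρ - q 2 ρ)) a b c =
      alt (volumeSum q) a b c - alt (qqq q 1 2 2) a b c - alt (qqq q 1 1 3) a b c +
        alt (qqq q 1 1 2) a b c + alt (qqq q 0 2 2) a b c := by
    simp only [alt, volumeSum, qqq]; noncomm_ring
  rw [e3, e1, e1, e2, e2]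
  simp only [mul_add, mul_sub]
  module

end Algebra

variable {H : Type*} [NormedAddCommGroup H] [InnerProductSpace ℂ H] [CompleteSpace H]

namespace RegularRep

variable (π : RegularRep H)

/-! ### The commutator tensor -/

theorem Q_isCentralApply (μ ν : Fin 4) (ψ : π.smooth) :
    π.IsCentralApply (entry μ ν) ψ (π.Q μ ν ψ) :=
  π.commutator_isCentralApply 0 μ ν ψ

theorem q_mul_sub (j μ ν : Fin 4) :
    π.q j μ * π.q j ν - π.q j ν * π.q j μ = Complex.I • π.Q μ ν := by
  have h : (-Complex.I) • (π.q j μ * π.q j ν - π.q j ν * π.q j μ) = π.Q μ ν := by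
    ext ψ
    exact (π.commutator_isCentralApply j μ ν ψ).unique (π.Q_isCentralApply μ ν ψ)
  rw [← h, smul_smul]
  simp

theorem q_commutator (j k μ ν : Fin 4) : π.q j μ * π.q k ν - π.q k ν * π.q j μ =
    if j = k then Complex.I • π.Q μ ν else 0 := by
  split_ifs with h
  · subst h; exact π.q_mul_sub j μ ν
  · rw [sub_eq_zero]; exact (π.q_comm_of_ne h μ ν).eq

theorem central_Q (μ ν : Fin 4) {g : jointSpectrum →ᵇ ℂ} (hg : HasCompactSupport g)
    (ψ : π.smooth) : π.central g (π.Q μ ν ψ) = π.central (cutMul (entry μ ν) g hg) ψ :=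
  (((π.isCentralApply_iff _ _ _).1 (π.Q_isCentralApply μ ν ψ)) g hg).symm

theorem comm_Q {X : Module.End ℂ π.smooth} (hX : ∀ f, Commute X (π.centralEnd f)) (μ ν : Fin 4) :
    Commute X (π.Q μ ν) := by
  ext ψ
  refine π.eq_of_central_eq fun g hg => ?_
  have h1 : ∀ f φ, X (π.centralEnd f φ) = π.centralEnd f (X φ) := fun f φ =>
    LinearMap.congr_fun (hX f).eq φ
  have h2 : π.centralEnd g (π.Q μ ν ψ) = π.centralEnd (cutMul (entry μ ν) g hg) ψ :=
    Subtype.ext (π.central_Q μ ν hg ψ)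
  change π.central g (X (π.Q μ ν ψ)) = π.central g (π.Q μ ν (X ψ))
  rw [central_Q _ _ _ hg, ← coe_centralEnd, ← coe_centralEnd, ← h1, h2, h1]

theorem q_comm_Q (j κ μ ν : Fin 4) : Commute (π.q j κ) (π.Q μ ν) :=
  π.comm_Q (fun f => π.q_comm_centralEnd f j κ) μ ν

theorem Q_comm_Q (κ τ μ ν : Fin 4) : Commute (π.Q κ τ) (π.Q μ ν) := by
  refine Commute.smul_left (Commute.sub_left ?_ ?_) _
  · exact (π.q_comm_Q _ _ _ _).mul_left (π.q_comm_Q _ _ _ _)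
  · exact (π.q_comm_Q _ _ _ _).mul_left (π.q_comm_Q _ _ _ _)

theorem Q_antisymm (μ ν : Fin 4) : π.Q μ ν = -π.Q ν μ := by
  ext ψ
  simp only [Q, LinearMap.smul_apply, LinearMap.neg_apply, LinearMap.sub_apply]
  rw [← smul_neg, neg_sub]

/-- The alternating sum `q_1 - q_2 + q_3 - q_4` over the events. -/
def y (ρ : Fin 4) : Module.End ℂ π.smooth := π.q 0 ρ - π.q 1 ρ + π.q 2 ρ - π.q 3 ρ

theorem y_comm_Q (κ μ ν : Fin 4) : Commute (π.y κ) (π.Q μ ν) :=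
  (((π.q_comm_Q _ _ _ _).sub_left (π.q_comm_Q _ _ _ _)).add_left (π.q_comm_Q _ _ _ _)).sub_left
    (π.q_comm_Q _ _ _ _)

theorem B_eq (σ : Fin 4) : π.B σ =
    π.Q (triple σ).1 (triple σ).2.1 * π.y (triple σ).2.2 +
    π.Q (triple σ).2.1 (triple σ).2.2 * π.y (triple σ).1 +
    π.Q (triple σ).2.2 (triple σ).1 * π.y (triple σ).2.1 := by
  have h : π.B σ = (1 / 2 : ℂ) • ∑ μ, ∑ ν, ∑ ρ, eps μ ν ρ σ • (π.Q μ ν * π.y ρ) := rfl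
  rw [h, sum_eps_smul]
  exact alt_Q_mul π.Q_antisymm π.y _ _ _

theorem A_eq (σ : Fin 4) : π.A σ =
    alt (volumeSum π.q) (triple σ).1 (triple σ).2.1 (triple σ).2.2 := by
  have h := alt_rowDet (q := π.q) (fun j k hjk μ ν => (π.q_comm_of_ne hjk μ ν).eq)
    (triple σ).1 (triple σ).2.1 (triple σ).2.2
  have hA : π.A σ = (1 / 6 : ℂ) •
      alt (fun μ ν ρ => rowDet (Matrix.of fun j => ![1, π.q j μ, π.q j ν, π.q j ρ]))
        (triple σ).1 (triple σ).2.1 (triple σ).2.2 := by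
    unfold A
    rw [sum_eps_smul]
  rw [hA, h]

theorem V_eq (σ : Fin 4) : π.V σ = π.A σ + Complex.I • π.B σ := by
  have h := alt_differences (q := π.q) (Q := π.Q) (fun j κ μ ν => (π.q_comm_Q j κ μ ν).eq)
    π.q_mul_sub (triple σ).1 (triple σ).2.1 (triple σ).2.2
  have hV : π.V σ = alt (fun μ ν ρ => (π.q 1 μ - π.q 0 μ) * (π.q 2 ν - π.q 1 ν) *
      (π.q 3 ρ - π.q 2 ρ)) (triple σ).1 (triple σ).2.1 (triple σ).2.2 := by
    rw [V, sum_eps_smul]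
  have hB := π.B_eq σ
  simp only [y] at hB
  rw [hV, h, A_eq, hB]

end RegularRep

end

end QST

/-! ### Commutation of `A` with `B`, formal adjoints, and the commutators of the `B_σ`. -/

namespace QST

open Filter Topology MeasureTheory

noncomputable section

section Algebra

variable {R : Type*} [Ring R] [Algebra ℂ R]

/-- The commutator is `z` times `Q^{ab}Q^{κc} + Q^{bc}Q^{κa} + Q^{ca}Q^{κb}`. For κ among `a, b, c`
one term contains `Q^{κκ} = 0` and the other two cancel: the axial vector of an antisymmetric 3×3
matrix lies in its kernel. -/
theorem comm_cyclic {Q : Fin 4 → Fin 4 → R} {x : R} {y : Fin 4 → R} {z : ℂ} {a b c κ : Fin 4}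
    (hκ : κ = a ∨ κ = b ∨ κ = c) (hQ : ∀ μ ν, Q μ ν = -Q ν μ)
    (hQQ : ∀ μ ν ρ σ, Q μ ν * Q ρ σ = Q ρ σ * Q μ ν) (hx : ∀ μ ν, x * Q μ ν = Q μ ν * x)
    (hxy : ∀ ρ, x * y ρ = y ρ * x + z • Q κ ρ) :
    Commute x (Q a b * y c + Q b c * y a + Q c a * y b) := by
  have h0 : ∀ μ, Q μ μ = 0 := fun μ => by
    have h1 : (2 : ℂ) • Q μ μ = 0 := by
      rw [two_smul]; nth_rewrite 1 [hQ]; exact neg_add_cancel _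
    exact (smul_eq_zero_iff_right (two_ne_zero)).1 h1
  have key : ∀ μ ν ρ, x * (Q μ ν * y ρ) = Q μ ν * y ρ * x + z • (Q μ ν * Q κ ρ) := by
    intro μ ν ρ
    rw [← mul_assoc, hx, mul_assoc, hxy, mul_add, mul_smul_comm, ← mul_assoc]
  have hz : Q a b * Q κ c + Q b c * Q κ a + Q c a * Q κ b = 0 := by
    rcases hκ with rfl | rfl | rfl
    · rw [h0, mul_zero, add_zero, hQ κ c, mul_neg, hQQ c κ κ b]; abel
    · rw [h0, mul_zero, add_zero, hQ κ a, mul_neg, hQQ κ c a κ]; abel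
    · rw [h0, mul_zero, zero_add, hQ κ b, mul_neg, hQQ b κ κ a]; abel
  rw [commute_iff_eq, mul_add, mul_add, key, key, key, add_mul, add_mul]
  have : z • (Q a b * Q κ c) + z • (Q b c * Q κ a) + z • (Q c a * Q κ b) = 0 := by
    rw [← smul_add, ← smul_add, hz, smul_zero]
  rw [← sub_eq_zero]
  refine Eq.trans ?_ this
  abel

end Algebra

theorem alt_commute {R : Type*} [Ring R] {x : R} {q : Fin 4 → Fin 4 → R} {a b c : Fin 4}
    (h : ∀ j κ, κ = a ∨ κ = b ∨ κ = c → Commute (q j κ) x) :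
    Commute (alt (volumeSum q) a b c) x := by
  have h3 : ∀ j k l μ ν ρ, (μ = a ∨ μ = b ∨ μ = c) → (ν = a ∨ ν = b ∨ ν = c) →
      (ρ = a ∨ ρ = b ∨ ρ = c) → Commute (qqq q j k l μ ν ρ) x :=
    fun j k l μ ν ρ hμ hν hρ => ((h j μ hμ).mul_left (h k ν hν)).mul_left (h l ρ hρ)
  have h4 : ∀ μ ν ρ, (μ = a ∨ μ = b ∨ μ = c) → (ν = a ∨ ν = b ∨ ν = c) →
      (ρ = a ∨ ρ = b ∨ ρ = c) → Commute (volumeSum q μ ν ρ) x :=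
    fun μ ν ρ hμ hν hρ => (((h3 _ _ _ _ _ _ hμ hν hρ).sub_left (h3 _ _ _ _ _ _ hμ hν hρ)).add_left
      (h3 _ _ _ _ _ _ hμ hν hρ)).sub_left (h3 _ _ _ _ _ _ hμ hν hρ)
  unfold alt
  refine Commute.sub_left (Commute.sub_left (Commute.sub_left (Commute.add_left (Commute.add_left
    ?_ ?_) ?_) ?_) ?_) ?_ <;> apply h4 <;> simp

variable {H : Type*} [NormedAddCommGroup H] [InnerProductSpace ℂ H] [CompleteSpace H]

namespace RegularRep

variable (π : RegularRep H)

theorem q_mul_y (j κ ρ : Fin 4) : π.q j κ * π.y ρ = π.y ρ * π.q j κ +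
    (![1, -1, 1, -1] j * Complex.I : ℂ) • π.Q κ ρ := by
  have h : ∀ k, π.q j κ * π.q k ρ = π.q k ρ * π.q j κ +
      (if j = k then Complex.I • π.Q κ ρ else 0) := fun k => by
    rw [← π.q_commutator j k κ ρ]; abel
  rw [y, mul_sub, mul_add, mul_sub, h, h, h, h, sub_mul, add_mul, sub_mul]
  ext ψ
  fin_cases j <;> simp <;> module

theorem y_mul_sub (κ ρ : Fin 4) :
    π.y κ * π.y ρ - π.y ρ * π.y κ = (4 * Complex.I) • π.Q κ ρ := by
  have h : π.y κ * π.y ρ - π.y ρ * π.y κ = (π.q 0 κ * π.y ρ - π.y ρ * π.q 0 κ) -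
      (π.q 1 κ * π.y ρ - π.y ρ * π.q 1 κ) + (π.q 2 κ * π.y ρ - π.y ρ * π.q 2 κ) -
      (π.q 3 κ * π.y ρ - π.y ρ * π.q 3 κ) := by
    conv_lhs => rw [show π.y κ = π.q 0 κ - π.q 1 κ + π.q 2 κ - π.q 3 κ from rfl]
    simp only [sub_mul, add_mul, mul_sub, mul_add]
    abel
  rw [h, q_mul_y, q_mul_y, q_mul_y, q_mul_y]
  simp only [add_sub_cancel_left]
  ext ψ
  simp
  module

theorem q_comm_B (j : Fin 4) {κ σ : Fin 4} (hκ : κ ≠ σ) : Commute (π.q j κ) (π.B σ) := by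
  rw [B_eq]
  have hκ' : κ = (triple σ).1 ∨ κ = (triple σ).2.1 ∨ κ = (triple σ).2.2 := by
    revert hκ; revert κ σ; decide
  exact comm_cyclic hκ' π.Q_antisymm (fun μ ν ρ σ => (π.Q_comm_Q μ ν ρ σ).eq)
    (fun μ ν => (π.q_comm_Q j κ μ ν).eq) (fun ρ => π.q_mul_y j κ ρ)

theorem A_comm_B (σ : Fin 4) : Commute (π.A σ) (π.B σ) := by
  rw [A_eq]
  refine alt_commute fun j κ hκ => π.q_comm_B j ?_
  revert hκ; revert κ σ; decide

/-! ### Formal adjoints on the smooth vectors -/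

/-- Two operators on the smooth vectors are formally adjoint. -/
def FormalAdj (T T' : Module.End ℂ π.smooth) : Prop :=
  ∀ ψ χ : π.smooth, inner ℂ (T ψ : H) (χ : H) = inner ℂ (ψ : H) (T' χ : H)

variable {π}

theorem FormalAdj.symm {T T' : Module.End ℂ π.smooth} (h : π.FormalAdj T T') :
    π.FormalAdj T' T := fun ψ χ => by
  rw [← inner_conj_symm, ← h χ ψ, inner_conj_symm]

theorem FormalAdj.add {T T' S S' : Module.End ℂ π.smooth} (h : π.FormalAdj T T')
    (h' : π.FormalAdj S S') : π.FormalAdj (T + S) (T' + S') := fun ψ χ => by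
  simp only [LinearMap.add_apply, Submodule.coe_add, inner_add_left, inner_add_right, h ψ χ,
    h' ψ χ]

theorem FormalAdj.sub {T T' S S' : Module.End ℂ π.smooth} (h : π.FormalAdj T T')
    (h' : π.FormalAdj S S') : π.FormalAdj (T - S) (T' - S') := fun ψ χ => by
  simp only [LinearMap.sub_apply, Submodule.coe_sub, inner_sub_left, inner_sub_right, h ψ χ,
    h' ψ χ]

theorem FormalAdj.smul {T T' : Module.End ℂ π.smooth} (c : ℂ) (h : π.FormalAdj T T') :
    π.FormalAdj (c • T) (star c • T') := fun ψ χ => by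
  simp only [LinearMap.smul_apply, Submodule.coe_smul, inner_smul_left, inner_smul_right, h ψ χ]
  rfl

theorem FormalAdj.mul {T T' S S' : Module.End ℂ π.smooth} (h : π.FormalAdj T T')
    (h' : π.FormalAdj S S') : π.FormalAdj (T * S) (S' * T') := fun ψ χ => by
  rw [Module.End.mul_apply, Module.End.mul_apply, h, h']

theorem FormalAdj.mul_comm {T S : Module.End ℂ π.smooth} (h : π.FormalAdj T T)
    (h' : π.FormalAdj S S) (hc : Commute T S) : π.FormalAdj (T * S) (T * S) := by
  nth_rewrite 2 [hc.eq]
  exact h.mul h'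

variable (π)

theorem formalAdj_q (j μ : Fin 4) : π.FormalAdj (π.q j μ) (π.q j μ) := π.q_symm j μ

theorem formalAdj_Q (μ ν : Fin 4) : π.FormalAdj (π.Q μ ν) (π.Q μ ν) := by
  have h := (((π.formalAdj_q 0 μ).mul (π.formalAdj_q 0 ν)).sub
    ((π.formalAdj_q 0 ν).mul (π.formalAdj_q 0 μ))).smul (-Complex.I)
  have e : star (-Complex.I) • (π.q 0 ν * π.q 0 μ - π.q 0 μ * π.q 0 ν) = π.Q μ ν := by
    ext ψ
    simp [Q]
    module
  rw [e] at h
  exact h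

theorem formalAdj_y (ρ : Fin 4) : π.FormalAdj (π.y ρ) (π.y ρ) :=
  (((π.formalAdj_q _ _).sub (π.formalAdj_q _ _)).add (π.formalAdj_q _ _)).sub (π.formalAdj_q _ _)

theorem formalAdj_B (σ : Fin 4) : π.FormalAdj (π.B σ) (π.B σ) := by
  have h : ∀ μ ν ρ, π.FormalAdj (π.Q μ ν * π.y ρ) (π.Q μ ν * π.y ρ) := fun μ ν ρ =>
    (π.formalAdj_Q μ ν).mul_comm (π.formalAdj_y ρ) (π.y_comm_Q ρ μ ν).symm
  rw [B_eq]
  exact ((h _ _ _).add (h _ _ _)).add (h _ _ _)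

theorem formalAdj_qqq {j k l : Fin 4} (hjk : j ≠ k) (hjl : j ≠ l) (hkl : k ≠ l) (μ ν ρ : Fin 4) :
    π.FormalAdj (qqq π.q j k l μ ν ρ) (qqq π.q j k l μ ν ρ) :=
  ((π.formalAdj_q j μ).mul_comm (π.formalAdj_q k ν) (π.q_comm_of_ne hjk μ ν)).mul_comm
    (π.formalAdj_q l ρ) ((π.q_comm_of_ne hjl μ ρ).mul_left (π.q_comm_of_ne hkl ν ρ))

theorem formalAdj_A (σ : Fin 4) : π.FormalAdj (π.A σ) (π.A σ) := by
  have h : ∀ μ ν ρ, π.FormalAdj (volumeSum π.q μ ν ρ) (volumeSum π.q μ ν ρ) := fun μ ν ρ =>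
    (((π.formalAdj_qqq (by decide) (by decide) (by decide) μ ν ρ).sub
      (π.formalAdj_qqq (by decide) (by decide) (by decide) μ ν ρ)).add
      (π.formalAdj_qqq (by decide) (by decide) (by decide) μ ν ρ)).sub
      (π.formalAdj_qqq (by decide) (by decide) (by decide) μ ν ρ)
  rw [A_eq]
  exact (((((h _ _ _).add (h _ _ _)).add (h _ _ _)).sub (h _ _ _)).sub (h _ _ _)).sub (h _ _ _)

theorem formalAdj_V (σ : Fin 4) : π.FormalAdj (π.V σ) (π.A σ - Complex.I • π.B σ) := by
  have h := (π.formalAdj_A σ).add ((π.formalAdj_B σ).smul Complex.I)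
  rw [← V_eq] at h
  have e : π.A σ - Complex.I • π.B σ = π.A σ + star Complex.I • π.B σ := by
    ext ψ
    simp
    rw [sub_eq_add_neg]
  rw [e]
  exact h

/-! ### The commutators of the `B_σ` -/

/-- The dual tensor `½ ε_{μνρσ} Q^{μν}` on the smooth vectors. -/
def dualQ (ρ σ : Fin 4) : Module.End ℂ π.smooth :=
  (1 / 2 : ℂ) • ∑ μ, ∑ ν, eps μ ν ρ σ • π.Q μ ν

end RegularRep

/-- The dual tensor `½ ε_{μνρσ} s^{μν}`, as a function on the joint spectrum. -/
def dualEntry (ρ σ : Fin 4) : C(jointSpectrum, ℂ) :=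
  (1 / 2 : ℂ) • ∑ μ, ∑ ν, (eps μ ν ρ σ : ℂ) • entry μ ν

/-- The dual of an antisymmetric matrix: the electric and magnetic parts are exchanged. -/
def dualMatrix (s : Matrix (Fin 4) (Fin 4) ℝ) : Matrix (Fin 4) (Fin 4) ℝ :=
  !![0, s 2 3, s 3 1, s 1 2; -s 2 3, 0, s 0 3, -s 0 2; -s 3 1, -s 0 3, 0, s 0 1;
    -s 1 2, s 0 2, -s 0 1, 0]

theorem eq_of_jointSpectrum (s : jointSpectrum) : s.1 =
    !![0, s.1 0 1, s.1 0 2, s.1 0 3; -s.1 0 1, 0, s.1 1 2, -s.1 3 1;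
      -s.1 0 2, -s.1 1 2, 0, s.1 2 3; -s.1 0 3, s.1 3 1, -s.1 2 3, 0] := by
  ext i j
  fin_cases i <;> fin_cases j <;> simp [entry_self] <;> exact entry_antisymm s _ _

theorem dualEntry_apply (s : jointSpectrum) (ρ σ : Fin 4) :
    dualEntry ρ σ s = (dualMatrix s.1 ρ σ : ℂ) := by
  have h : dualEntry ρ σ s = (1 / 2 : ℂ) * ∑ μ, ∑ ν, (eps μ ν ρ σ : ℂ) * (s.1 μ ν : ℂ) := by
    simp [dualEntry, ContinuousMap.coe_sum]
  rw [h]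
  simp only [eps_eq]
  have a10 := entry_antisymm s 1 0
  have a20 := entry_antisymm s 2 0
  have a30 := entry_antisymm s 3 0
  have a32 := entry_antisymm s 3 2
  have a31 := entry_antisymm s 1 3
  have a21 := entry_antisymm s 2 1
  fin_cases ρ <;> fin_cases σ <;>
    simp [triple, Fin.sum_univ_four, dualMatrix, a10, a20, a30, a32, a31, a21] <;> ring

/-- The sign `e · m` of a point of the joint spectrum. -/
def chirality (s : Matrix (Fin 4) (Fin 4) ℝ) : ℝ := elec s ⬝ᵥ magn s

theorem chirality_mul_self (s : jointSpectrum) : chirality s.1 * chirality s.1 = 1 := by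
  rcases s.2.2.2 with h | h <;> simp [chirality, h]

/-- An antisymmetric 4×4 matrix times its dual is scalar, the scalar being its Pfaffian `e·m` up to
sign. -/
theorem mul_dualMatrix (s : jointSpectrum) : s.1 * dualMatrix s.1 = (-chirality s.1) • 1 := by
  rw [eq_of_jointSpectrum s]
  ext i j
  fin_cases i <;> fin_cases j <;>
    simp [Matrix.mul_apply, Fin.sum_univ_four, dualMatrix, chirality, elec, magn, dotProduct,
      Fin.sum_univ_three] <;> ring

theorem dualMatrix_transpose (s : Matrix (Fin 4) (Fin 4) ℝ) :
    (dualMatrix s)ᵀ = -dualMatrix s := by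
  ext i j
  fin_cases i <;> fin_cases j <;> simp [dualMatrix]

theorem inv_transpose_eq (s : jointSpectrum) : (s.1ᵀ)⁻¹ = chirality s.1 • dualMatrix s.1 := by
  refine Matrix.inv_eq_right_inv ?_
  rw [s.2.1, Matrix.neg_mul, Matrix.mul_smul, mul_dualMatrix, smul_smul, ← neg_smul]
  rw [mul_neg, neg_neg, chirality_mul_self, one_smul]

/-- This is the coefficient of `4i` in `[B_σ, B_σ']`. The inner product `Q (*Q)` is scalar, so what
remains is a multiple of the dual, which is the inverse because `(e·m)² = 1`. -/
theorem dual_sandwich (s : jointSpectrum) (σ σ' : Fin 4) :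
    ∑ ρ, ∑ τ, dualMatrix s.1 ρ σ * dualMatrix s.1 τ σ' * s.1 ρ τ = (s.1ᵀ)⁻¹ σ σ' := by
  have h : (dualMatrix s.1)ᵀ * (s.1 * dualMatrix s.1) = (s.1ᵀ)⁻¹ := by
    rw [mul_dualMatrix, dualMatrix_transpose, inv_transpose_eq]
    simp
  rw [← h]
  simp only [Matrix.mul_apply, Matrix.transpose_apply, Finset.mul_sum]
  refine Finset.sum_congr rfl fun ρ _ => Finset.sum_congr rfl fun τ _ => ?_
  ring

namespace RegularRep

variable (π : RegularRep H)

theorem B_eq_sum (σ : Fin 4) : π.B σ = ∑ ρ, π.dualQ ρ σ * π.y ρ := by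
  have h : π.B σ = (1 / 2 : ℂ) • ∑ μ, ∑ ν, ∑ ρ, eps μ ν ρ σ • (π.Q μ ν * π.y ρ) := rfl
  rw [h]
  simp only [dualQ, smul_mul_assoc, Finset.sum_mul, Finset.smul_sum]
  rw [Finset.sum_congr rfl fun μ _ => Finset.sum_comm, Finset.sum_comm]

theorem dualQ_isCentralApply (ρ σ : Fin 4) (ψ : π.smooth) :
    π.IsCentralApply (dualEntry ρ σ) ψ (π.dualQ ρ σ ψ) := by
  have h := (isCentralApply_sum Finset.univ fun μ _ => isCentralApply_sum Finset.univ fun ν _ =>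
    (π.Q_isCentralApply μ ν ψ).smul (eps μ ν ρ σ : ℂ)).smul (1 / 2 : ℂ)
  have e : (π.dualQ ρ σ ψ : H) = (1 / 2 : ℂ) • ∑ μ, ∑ ν, (eps μ ν ρ σ : ℂ) • (π.Q μ ν ψ : H) := by
    simp [dualQ, LinearMap.sum_apply, Int.cast_smul_eq_zsmul]
  rw [e]
  exact h

theorem dualQ_comm {X : Module.End ℂ π.smooth} (hX : ∀ μ ν, Commute (π.Q μ ν) X) (ρ σ : Fin 4) :
    Commute (π.dualQ ρ σ) X :=
  Commute.smul_left (Commute.sum_left _ _ _ fun μ _ => Commute.sum_left _ _ _ fun ν _ =>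
    (hX μ ν).smul_left _) _

theorem B_mul_sub (σ σ' : Fin 4) : π.B σ * π.B σ' - π.B σ' * π.B σ =
    (4 * Complex.I) • ∑ ρ, ∑ τ, π.dualQ ρ σ * π.dualQ τ σ' * π.Q ρ τ := by
  have hy : ∀ ρ σ κ, Commute (π.dualQ ρ σ) (π.y κ) := fun ρ σ κ =>
    π.dualQ_comm (fun μ ν => (π.y_comm_Q κ μ ν).symm) ρ σ
  have hd : ∀ ρ σ κ τ, Commute (π.dualQ ρ σ) (π.dualQ κ τ) := fun ρ σ κ τ =>
    π.dualQ_comm (fun μ ν => (π.dualQ_comm (fun μ' ν' => π.Q_comm_Q μ' ν' μ ν) κ τ).symm) ρ σ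
  rw [B_eq_sum, B_eq_sum, Finset.sum_mul_sum, Finset.sum_mul_sum, Finset.smul_sum]
  rw [Finset.sum_comm (f := fun i j => π.dualQ i σ' * π.y i * (π.dualQ j σ * π.y j)),
    ← Finset.sum_sub_distrib]
  refine Finset.sum_congr rfl fun ρ _ => ?_
  rw [← Finset.sum_sub_distrib, Finset.smul_sum]
  refine Finset.sum_congr rfl fun τ _ => ?_
  have e1 : π.dualQ ρ σ * π.y ρ * (π.dualQ τ σ' * π.y τ) =
      π.dualQ ρ σ * π.dualQ τ σ' * (π.y ρ * π.y τ) := by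
    rw [mul_assoc, ← mul_assoc (π.y ρ), ← (hy τ σ' ρ).eq]; noncomm_ring
  have e2 : π.dualQ τ σ' * π.y τ * (π.dualQ ρ σ * π.y ρ) =
      π.dualQ ρ σ * π.dualQ τ σ' * (π.y τ * π.y ρ) := by
    rw [mul_assoc, ← mul_assoc (π.y τ), ← (hy ρ σ τ).eq, (hd ρ σ τ σ').eq]; noncomm_ring
  rw [e1, e2, ← mul_sub, y_mul_sub, mul_smul_comm]

theorem B_commutator_isCentralApply (σ σ' : Fin 4) (ψ : π.smooth) : π.IsCentralApply
    (fun s => 4 * Complex.I * ((s.1ᵀ)⁻¹ σ σ' : ℂ)) ψ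
      ((π.B σ * π.B σ' - π.B σ' * π.B σ) ψ : π.smooth) := by
  have h := (isCentralApply_sum Finset.univ fun ρ _ => isCentralApply_sum Finset.univ fun τ _ =>
    ((π.Q_isCentralApply ρ τ ψ).comp (π.dualQ_isCentralApply τ σ' _)).comp
      (π.dualQ_isCentralApply ρ σ _)).smul (4 * Complex.I)
  have e : ((π.B σ * π.B σ' - π.B σ' * π.B σ) ψ : H) = (4 * Complex.I) •
      ∑ ρ, ∑ τ, (π.dualQ ρ σ (π.dualQ τ σ' (π.Q ρ τ ψ)) : H) := by
    rw [B_mul_sub]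
    simp [LinearMap.sum_apply, mul_assoc]
  rw [e]
  convert h using 1
  funext s
  refine (congrArg (fun x : ℝ => 4 * Complex.I * (x : ℂ)) (dual_sandwich s σ σ').symm).trans ?_
  simp only [ContinuousMap.smul_apply, ContinuousMap.coe_sum, Finset.sum_apply,
    ContinuousMap.mul_apply, entry_apply, dualEntry_apply, smul_eq_mul]
  push_cast
  congr 1
  refine Finset.sum_congr rfl fun ρ _ => Finset.sum_congr rfl fun τ _ => ?_
  ring

end RegularRep

end

end QST

/-! ### Alternating trilinear forms under an antisymmetric tensor, and rearrangement of products. -/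

namespace QST

open Filter Topology MeasureTheory

noncomputable section

section Algebra

variable {R : Type*} [Ring R] [Algebra ℂ R]

/-- The action of an antisymmetric tensor with central entries on vectors with three components. -/
def tensorAct (Q : Fin 4 → Fin 4 → R) (a b c : Fin 4) (X : Fin 4 → R) (μ : Fin 4) : R :=
  Q μ a * X a + Q μ b * X b + Q μ c * X c

/-- The alternating trilinear form of three vectors with three components. -/
def altMul (a b c : Fin 4) (X Y Z : Fin 4 → R) : R := alt (fun μ ν ρ => X μ * Y ν * Z ρ) a b c

/-- The first sum is the trace of the 3×3 block of `Q` times the form, the second expression its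
determinant times the form; both vanish by antisymmetry in odd dimension. The components of `X, Y,
Z` need not commute with each other, as only the entries of `Q` are moved to the left. -/
theorem altMul_tensorAct {Q : Fin 4 → Fin 4 → R} {X Y Z : Fin 4 → R}
    (hQ : ∀ μ ν, Q μ ν = -Q ν μ) (hQQ : ∀ μ ν ρ σ, Q μ ν * Q ρ σ = Q ρ σ * Q μ ν)
    (hX : ∀ κ μ ν, X κ * Q μ ν = Q μ ν * X κ) (hY : ∀ κ μ ν, Y κ * Q μ ν = Q μ ν * Y κ)
    (a b c : Fin 4) :
    altMul a b c (tensorAct Q a b c X) Y Z + altMul a b c X (tensorAct Q a b c Y) Z +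
      altMul a b c X Y (tensorAct Q a b c Z) = 0 ∧
    altMul a b c (tensorAct Q a b c X) (tensorAct Q a b c Y) (tensorAct Q a b c Z) = 0 := by
  have h0 : ∀ μ, Q μ μ = 0 := fun μ => by
    have h1 : (2 : ℂ) • Q μ μ = 0 := by
      rw [two_smul]; nth_rewrite 1 [hQ]; exact neg_add_cancel _
    exact (smul_eq_zero_iff_right (two_ne_zero)).1 h1
  have hX' : ∀ κ μ ν W, X κ * (Q μ ν * W) = Q μ ν * (X κ * W) := fun κ μ ν W => by
    rw [← mul_assoc, hX, mul_assoc]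
  have hY' : ∀ κ μ ν W, Y κ * (Q μ ν * W) = Q μ ν * (Y κ * W) := fun κ μ ν W => by
    rw [← mul_assoc, hY, mul_assoc]
  have r1 := hQ b a
  have r2 := hQ a c
  have r3 := hQ c b
  have s1 : ∀ W, Q c a * (Q a b * W) = Q a b * (Q c a * W) := fun W => by
    rw [← mul_assoc, hQQ, mul_assoc]
  have s2 : ∀ W, Q b c * (Q a b * W) = Q a b * (Q b c * W) := fun W => by
    rw [← mul_assoc, hQQ, mul_assoc]
  have s3 : ∀ W, Q c a * (Q b c * W) = Q b c * (Q c a * W) := fun W => by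
    rw [← mul_assoc, hQQ, mul_assoc]
  constructor
  · simp only [altMul, alt, tensorAct, h0, r1, r2, r3, zero_mul, zero_add, add_zero, mul_add,
      add_mul, neg_mul, mul_neg, mul_assoc, hX', hY']
    abel
  · simp only [altMul, alt, tensorAct, h0, r1, r2, r3, zero_mul, zero_add, add_zero, mul_add,
      add_mul, neg_mul, mul_neg, mul_assoc, hX', hY', s1, s2, s3]
    abel

/-- The two sides differ by the parts of odd degree in `w`, namely the first and the third, and
`altMul_tensorAct` annihilates both. -/
theorem altMul_add_eq_altMul_sub {Q : Fin 4 → Fin 4 → R} {X Y Z : Fin 4 → R}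
    (hQ : ∀ μ ν, Q μ ν = -Q ν μ) (hQQ : ∀ μ ν ρ σ, Q μ ν * Q ρ σ = Q ρ σ * Q μ ν)
    (hX : ∀ κ μ ν, X κ * Q μ ν = Q μ ν * X κ) (hY : ∀ κ μ ν, Y κ * Q μ ν = Q μ ν * Y κ)
    (a b c : Fin 4) (w : ℂ) :
    altMul a b c (fun μ => X μ + w • tensorAct Q a b c X μ)
        (fun μ => Y μ + w • tensorAct Q a b c Y μ) (fun μ => Z μ + w • tensorAct Q a b c Z μ) =
      altMul a b c (fun μ => X μ - w • tensorAct Q a b c X μ)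
        (fun μ => Y μ - w • tensorAct Q a b c Y μ) (fun μ => Z μ - w • tensorAct Q a b c Z μ) := by
  obtain ⟨h1, h2⟩ := altMul_tensorAct hQ hQQ hX hY a b c
  have key : altMul a b c (fun μ => X μ + w • tensorAct Q a b c X μ)
        (fun μ => Y μ + w • tensorAct Q a b c Y μ) (fun μ => Z μ + w • tensorAct Q a b c Z μ) -
      altMul a b c (fun μ => X μ - w • tensorAct Q a b c X μ)
        (fun μ => Y μ - w • tensorAct Q a b c Y μ) (fun μ => Z μ - w • tensorAct Q a b c Z μ) =
      (2 * w) • (altMul a b c (tensorAct Q a b c X) Y Z + altMul a b c X (tensorAct Q a b c Y) Z +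
      altMul a b c X Y (tensorAct Q a b c Z)) + (2 * w ^ 3) •
      altMul a b c (tensorAct Q a b c X) (tensorAct Q a b c Y) (tensorAct Q a b c Z) := by
    generalize tensorAct Q a b c X = X'
    generalize tensorAct Q a b c Y = Y'
    generalize tensorAct Q a b c Z = Z'
    have e : ∀ μ ν ρ, (X μ + w • X' μ) * (Y ν + w • Y' ν) * (Z ρ + w • Z' ρ) =
        (X μ - w • X' μ) * (Y ν - w • Y' ν) * (Z ρ - w • Z' ρ) +
        ((2 * w) • (X' μ * Y ν * Z ρ + X μ * Y' ν * Z ρ + X μ * Y ν * Z' ρ) +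
        (2 * w ^ 3) • (X' μ * Y' ν * Z' ρ)) := fun μ ν ρ => by
      simp only [mul_add, add_mul, mul_sub, sub_mul, smul_mul_assoc, mul_smul_comm]
      module
    simp only [altMul, alt, e]
    module
  rw [h1, h2, smul_zero, smul_zero, add_zero, sub_eq_zero] at key
  exact key

end Algebra

section Products

variable {R : Type*} [Ring R]

/-- Each average is brought next to the coordinate of its own event, where the splitting into
symmetric and antisymmetric parts applies. -/
theorem qqq_mul_prod {q : Fin 4 → Fin 4 → R} {K : Fin 4 → R}
    (hqK : ∀ j k, j ≠ k → ∀ μ, q j μ * K k = K k * q j μ) {j k l : Fin 4}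
    (hjk : j ≠ k) (hjl : j ≠ l) (hkl : k ≠ l) (m μ ν ρ : Fin 4) :
    qqq q j k l μ ν ρ * (K j * K k * K l * K m) =
      q j μ * K j * (q k ν * K k) * (q l ρ * K l) * K m := by
  simp only [qqq, mul_assoc]
  rw [← mul_assoc (q l ρ) (K j), hqK l j hjl.symm, mul_assoc, ← mul_assoc (q l ρ) (K k),
    hqK l k hkl.symm, mul_assoc, ← mul_assoc (q k ν) (K j), hqK k j hjk.symm, mul_assoc]

theorem prod_mul_qqq {q : Fin 4 → Fin 4 → R} {K : Fin 4 → R}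
    (hqK : ∀ j k, j ≠ k → ∀ μ, q j μ * K k = K k * q j μ) {j k l m : Fin 4}
    (hjk : j ≠ k) (hjl : j ≠ l) (hkl : k ≠ l) (hjm : j ≠ m) (hkm : k ≠ m) (hlm : l ≠ m)
    (μ ν ρ : Fin 4) :
    K j * K k * K l * K m * qqq q j k l μ ν ρ =
      K j * q j μ * (K k * q k ν) * (K l * q l ρ) * K m := by
  have h : ∀ i n, i ≠ n → ∀ κ W, K n * (q i κ * W) = q i κ * (K n * W) := fun i n hin κ W => by
    rw [← mul_assoc, ← hqK i n hin, mul_assoc]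
  simp only [qqq, mul_assoc, h j k hjk, h j l hjl, h j m hjm, h k l hkl, h k m hkm,
    ← hqK l m hlm]

end Products

end

end QST

namespace QST

open Filter Topology MeasureTheory

noncomputable section

variable {H : Type*} [NormedAddCommGroup H] [InnerProductSpace ℂ H] [CompleteSpace H]

namespace RegularRep

variable (π : RegularRep H)

/-! ### Bounded operators on the smooth vectors -/

/-- The operator `X` on the smooth vectors is bounded, with norm at most `c`. -/
def BoundedBy (X : Module.End ℂ π.smooth) (c : ℝ) : Prop :=
  ∀ ψ, ‖(X ψ : H)‖ ≤ c * ‖(ψ : H)‖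

variable {π}

theorem BoundedBy.mono {X : Module.End ℂ π.smooth} {c d : ℝ} (h : π.BoundedBy X c) (hcd : c ≤ d) :
    π.BoundedBy X d := fun ψ => (h ψ).trans (by gcongr)

theorem BoundedBy.add {X Y : Module.End ℂ π.smooth} {c d : ℝ} (h : π.BoundedBy X c)
    (h' : π.BoundedBy Y d) : π.BoundedBy (X + Y) (c + d) := fun ψ => by
  rw [LinearMap.add_apply, Submodule.coe_add, add_mul]
  exact (norm_add_le _ _).trans (add_le_add (h ψ) (h' ψ))

theorem BoundedBy.sub {X Y : Module.End ℂ π.smooth} {c d : ℝ} (h : π.BoundedBy X c)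
    (h' : π.BoundedBy Y d) : π.BoundedBy (X - Y) (c + d) := fun ψ => by
  rw [LinearMap.sub_apply, Submodule.coe_sub, add_mul]
  exact (norm_sub_le _ _).trans (add_le_add (h ψ) (h' ψ))

theorem BoundedBy.smul {X : Module.End ℂ π.smooth} {c : ℝ} (z : ℂ) (h : π.BoundedBy X c) :
    π.BoundedBy (z • X) (‖z‖ * c) := fun ψ => by
  rw [LinearMap.smul_apply, Submodule.coe_smul, norm_smul, mul_assoc]
  gcongr
  exact h ψ

theorem BoundedBy.mul {X Y : Module.End ℂ π.smooth} {c d : ℝ} (hc : 0 ≤ c) (h : π.BoundedBy X c)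
    (h' : π.BoundedBy Y d) : π.BoundedBy (X * Y) (c * d) := fun ψ => by
  rw [Module.End.mul_apply, mul_assoc]
  exact (h _).trans (by gcongr; exact h' ψ)

theorem BoundedBy.sum {ι : Type*} (t : Finset ι) {X : ι → Module.End ℂ π.smooth} {c : ι → ℝ}
    (h : ∀ i ∈ t, π.BoundedBy (X i) (c i)) : π.BoundedBy (∑ i ∈ t, X i) (∑ i ∈ t, c i) :=
  fun ψ => by
  rw [LinearMap.sum_apply, Submodule.coe_sum, Finset.sum_mul]
  exact norm_sum_le_of_le _ fun i hi => h i hi ψ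

/-- A perturbation bound for the alternating trilinear form. -/
theorem BoundedBy.altMul_sub {X Y Z r s t : Fin 4 → Module.End ℂ π.smooth} {C δ : ℝ}
    (hC : 0 ≤ C) (hδ : 0 ≤ δ) {a b c : Fin 4}
    (hX : ∀ μ, μ = a ∨ μ = b ∨ μ = c → π.BoundedBy (X μ) C)
    (hY : ∀ μ, μ = a ∨ μ = b ∨ μ = c → π.BoundedBy (Y μ + s μ) C)
    (hY' : ∀ μ, μ = a ∨ μ = b ∨ μ = c → π.BoundedBy (Y μ) C)
    (hZ' : ∀ μ, μ = a ∨ μ = b ∨ μ = c → π.BoundedBy (Z μ + t μ) C)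
    (hr : ∀ μ, μ = a ∨ μ = b ∨ μ = c → π.BoundedBy (r μ) δ)
    (hs : ∀ μ, μ = a ∨ μ = b ∨ μ = c → π.BoundedBy (s μ) δ)
    (ht : ∀ μ, μ = a ∨ μ = b ∨ μ = c → π.BoundedBy (t μ) δ) :
    π.BoundedBy (altMul a b c (fun μ => X μ + r μ) (fun μ => Y μ + s μ) (fun μ => Z μ + t μ) -
      altMul a b c X Y Z) (18 * (C ^ 2 * δ)) := by
  have key : ∀ μ ν ρ, (μ = a ∨ μ = b ∨ μ = c) → (ν = a ∨ ν = b ∨ ν = c) →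
      (ρ = a ∨ ρ = b ∨ ρ = c) →
      π.BoundedBy (r μ * (Y ν + s ν) * (Z ρ + t ρ) + X μ * s ν * (Z ρ + t ρ) + X μ * Y ν * t ρ)
        (3 * (C ^ 2 * δ)) := by
    intro μ ν ρ hμ hν hρ
    have h1 := ((hr μ hμ).mul hδ (hY ν hν)).mul (by positivity) (hZ' ρ hρ)
    have h2 := ((hX μ hμ).mul hC (hs ν hν)).mul (by positivity) (hZ' ρ hρ)
    have h3 := ((hX μ hμ).mul hC (hY' ν hν)).mul (by positivity) (ht ρ hρ)
    exact ((h1.add h2).add h3).mono (le_of_eq (by ring))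
  -- Telescoping from the left: three terms with one perturbation each, which over the six orderings
  -- makes the constant 18.
  have e : ∀ μ ν ρ, (X μ + r μ) * (Y ν + s ν) * (Z ρ + t ρ) - X μ * Y ν * Z ρ =
      r μ * (Y ν + s ν) * (Z ρ + t ρ) + X μ * s ν * (Z ρ + t ρ) + X μ * Y ν * t ρ := by
    intro μ ν ρ
    simp only [mul_add, add_mul]
    abel
  have e' : altMul a b c (fun μ => X μ + r μ) (fun μ => Y μ + s μ) (fun μ => Z μ + t μ) -
      altMul a b c X Y Z = alt (fun μ ν ρ => (X μ + r μ) * (Y ν + s ν) * (Z ρ + t ρ) -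
        X μ * Y ν * Z ρ) a b c := by
    simp only [altMul, alt]
    abel
  rw [e']
  simp only [e, alt]
  refine ((((((key a b c ?_ ?_ ?_).add (key b c a ?_ ?_ ?_)).add (key c a b ?_ ?_ ?_)).sub
    (key b a c ?_ ?_ ?_)).sub (key a c b ?_ ?_ ?_)).sub (key c b a ?_ ?_ ?_)).mono
    (le_of_eq (by ring)) <;> simp

/-! ### Gaussian averages as operators on the smooth vectors -/

variable (π)

/-- The Gaussian average, cut off in the centre, as an operator on the smooth vectors. -/
def smearEnd {Λ : Fin 4 → ℝ} (hΛ : ∀ μ, Λ μ ≠ 0) (j : Fin 4) (p : MvPolynomial (Fin 4) ℂ)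
    {g : jointSpectrum →ᵇ ℂ} (hg : HasCompactSupport g) : Module.End ℂ π.smooth :=
  ((π.smear Λ j p * π.central g : H →L[ℂ] H) : H →ₗ[ℂ] H).restrict fun _ hx =>
    π.smear_mem_smooth hΛ j p hg hx

@[simp] theorem coe_smearEnd {Λ : Fin 4 → ℝ} (hΛ : ∀ μ, Λ μ ≠ 0) (j : Fin 4)
    (p : MvPolynomial (Fin 4) ℂ) {g : jointSpectrum →ᵇ ℂ} (hg : HasCompactSupport g)
    (ψ : π.smooth) : (π.smearEnd hΛ j p hg ψ : H) = π.smear Λ j p (π.central g ψ) := rfl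

section

variable {Λ : Fin 4 → ℝ} (hΛ : ∀ μ, Λ μ ≠ 0) {g : jointSpectrum →ᵇ ℂ} (hg : HasCompactSupport g)

theorem smearEnd_comm_centralEnd (j : Fin 4) (p : MvPolynomial (Fin 4) ℂ)
    (f : jointSpectrum →ᵇ ℂ) : Commute (π.smearEnd hΛ j p hg) (π.centralEnd f) := by
  ext ψ
  change π.smear Λ j p (π.central g (π.central f ψ)) = π.central f (π.smear Λ j p (π.central g ψ))
  rw [central_smear, ← central_mul_apply, ← central_mul_apply, mul_comm]

theorem smearEnd_comm_Q (j : Fin 4) (p : MvPolynomial (Fin 4) ℂ) (μ ν : Fin 4) :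
    Commute (π.smearEnd hΛ j p hg) (π.Q μ ν) :=
  π.comm_Q (fun f => π.smearEnd_comm_centralEnd hΛ hg j p f) μ ν

theorem smearEnd_comm_of_ne {j k : Fin 4} (hjk : j ≠ k) (p p' : MvPolynomial (Fin 4) ℂ) :
    Commute (π.smearEnd hΛ j p hg) (π.smearEnd hΛ k p' hg) := by
  ext ψ
  change π.smear Λ j p (π.central g (π.smear Λ k p' (π.central g ψ))) =
    π.smear Λ k p' (π.central g (π.smear Λ j p (π.central g ψ)))
  rw [central_smear, central_smear, smear_smear _ hjk]

theorem q_comm_smearEnd {j k : Fin 4} (hjk : j ≠ k) (μ : Fin 4) (p : MvPolynomial (Fin 4) ℂ) :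
    Commute (π.q j μ) (π.smearEnd hΛ k p hg) := by
  ext ψ
  exact π.coe_q_eq (((π.hasCoord_q j μ ψ).central g).smear hjk Λ p)

theorem smearEnd_cutMul (j : Fin 4) (p : MvPolynomial (Fin 4) ℂ) (μ ν : Fin 4) :
    π.smearEnd hΛ j p (hasCompactSupport_cutMul (entry μ ν) hg) =
      π.Q μ ν * π.smearEnd hΛ j p hg := by
  rw [← (π.smearEnd_comm_Q hΛ hg j p μ ν).eq]
  ext ψ
  change π.smear Λ j p (π.central (cutMul (entry μ ν) g hg) ψ) =
    π.smear Λ j p (π.central g (π.Q μ ν ψ))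
  rw [central_Q _ _ _ hg]

/-- The symmetric part of the product of `q_j^μ` and the Gaussian average. -/
def symmPart (j μ : Fin 4) : Module.End ℂ π.smooth :=
  (-2 * Complex.I * (Λ μ : ℂ)⁻¹) • π.smearEnd hΛ j (MvPolynomial.X μ) hg

/-- The antisymmetric part of the product of `q_j^μ` and the Gaussian average. -/
def skewPart (j μ : Fin 4) : Module.End ℂ π.smooth :=
  ∑ ν, (-(1 / 2) * (Λ ν : ℂ)) • (π.Q μ ν * π.smearEnd hΛ j (MvPolynomial.X ν) hg)

/-- `symmPart` comes from the derivative of the Gaussian and carries the inverse scale; `skewPart`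
comes from the Weyl phase and carries the scale itself. -/
theorem q_mul_smearEnd (j μ : Fin 4) : π.q j μ * π.smearEnd hΛ j 1 hg =
    π.symmPart hΛ hg j μ + π.skewPart hΛ hg j μ := by
  ext ψ
  refine (π.coe_q_eq (π.hasCoord_smear (hΛ μ) j 1 g hg ψ)).trans ?_
  simp only [symmPart, skewPart, ← smearEnd_cutMul, LinearMap.add_apply, LinearMap.sum_apply,
    LinearMap.smul_apply, Submodule.coe_add, Submodule.coe_sum, Submodule.coe_smul, coe_smearEnd,
    gaussDeriv_one, smear_smul, mul_one, smul_smul]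
  congr 2
  ring

theorem FormalAdj.unique {π : RegularRep H} {T S S' : Module.End ℂ π.smooth}
    (h : π.FormalAdj T S) (h' : π.FormalAdj T S') : S = S' := by
  ext χ
  exact π.eq_of_inner_smooth fun ψ => (h ψ χ).symm.trans (h' ψ χ)

theorem FormalAdj.sum {π : RegularRep H} {ι : Type*} (t : Finset ι)
    {X X' : ι → Module.End ℂ π.smooth} (h : ∀ i ∈ t, π.FormalAdj (X i) (X' i)) :
    π.FormalAdj (∑ i ∈ t, X i) (∑ i ∈ t, X' i) := fun ψ χ => by
  simp only [LinearMap.sum_apply, Submodule.coe_sum, sum_inner, inner_sum]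
  exact Finset.sum_congr rfl fun i hi => h i hi ψ χ

theorem gauss_neg (β : Fin 4 → ℝ) : gauss (-β) = gauss β := by simp [gauss]

theorem formalAdj_smearEnd_one (j : Fin 4) : π.FormalAdj
    (π.smearEnd hΛ j 1 (hasCompactSupport_star hg)) (π.smearEnd hΛ j 1 hg) := fun ψ χ => by
  rw [coe_smearEnd, coe_smearEnd, π.smear_inner_left Λ j (q := 1), central_inner_left, star_star,
    central_smear]
  intro β
  simp [polyGauss_one, gauss_neg]

theorem formalAdj_smearEnd_X (j ν : Fin 4) : π.FormalAdj
    (π.smearEnd hΛ j (MvPolynomial.X ν) (hasCompactSupport_star hg))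
    ((-1 : ℂ) • π.smearEnd hΛ j (MvPolynomial.X ν) hg) := fun ψ χ => by
  have h : (π.smear Λ j ((-1 : ℂ) • MvPolynomial.X ν) (π.central g χ)) =
      (((-1 : ℂ) • π.smearEnd hΛ j (MvPolynomial.X ν) hg) χ : H) := by
    rw [smear_smul]; rfl
  rw [← h, coe_smearEnd, π.smear_inner_left Λ j (q := (-1 : ℂ) • MvPolynomial.X ν),
    central_inner_left, star_star, central_smear]
  intro β
  rw [polyGauss_smul, ← mul_one (MvPolynomial.X ν), polyGauss_X_mul, polyGauss_X_mul,
    polyGauss_one, polyGauss_one, gauss_neg]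
  simp

/-- Take the formal adjoint of `q_mul_smearEnd`. Averages with weight `X ν` change sign under
adjunction; the coefficient in `symmPart` is imaginary and that in `skewPart` real, so only the
latter changes sign. -/
theorem smearEnd_mul_q (j μ : Fin 4) : π.smearEnd hΛ j 1 hg * π.q j μ =
    π.symmPart hΛ hg j μ - π.skewPart hΛ hg j μ := by
  have h1 := (π.formalAdj_q j μ).mul (π.formalAdj_smearEnd_one hΛ hg j)
  rw [q_mul_smearEnd] at h1
  refine h1.unique ?_
  have h2 := ((π.formalAdj_smearEnd_X hΛ hg j μ).smul (-2 * Complex.I * (Λ μ : ℂ)⁻¹)).add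
    (FormalAdj.sum Finset.univ fun ν _ => (((π.formalAdj_Q μ ν).mul
      (π.formalAdj_smearEnd_X hΛ hg j ν))).smul (-(1 / 2) * (Λ ν : ℂ)))
  refine fun ψ χ => (h2 ψ χ).trans ?_
  congr 2
  generalize χ = ψ
  have hc : ∀ ν, π.Q μ ν (π.smearEnd hΛ j (MvPolynomial.X ν) hg ψ) =
      π.smearEnd hΛ j (MvPolynomial.X ν) hg (π.Q μ ν ψ) := fun ν =>
    (LinearMap.congr_fun (π.smearEnd_comm_Q hΛ hg j (MvPolynomial.X ν) μ ν).eq ψ).symm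
  simp only [symmPart, skewPart, LinearMap.add_apply, LinearMap.sum_apply, LinearMap.smul_apply,
    Module.End.mul_apply, smul_smul, sub_eq_add_neg, ← Finset.sum_neg_distrib]
  simp [hc]

end

end RegularRep

end

end QST

/-! ### Norm estimates for commutators with the mollifiers. -/

namespace QST

open Filter Topology MeasureTheory

noncomputable section

theorem sum_eq_triple {M : Type*} [AddCommMonoid M] (σ : Fin 4) (f : Fin 4 → M) :
    ∑ ν, f ν = f (triple σ).1 + f (triple σ).2.1 + f (triple σ).2.2 + f σ := by
  fin_cases σ <;> simp only [triple, Fin.sum_univ_four] <;> simp <;> abel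

theorem alt_mul {E : Type*} [Ring E] (f : Fin 4 → Fin 4 → Fin 4 → E) (P : E) (a b c : Fin 4) :
    alt f a b c * P = alt (fun μ ν ρ => f μ ν ρ * P) a b c := by
  simp only [alt, add_mul, sub_mul]

theorem mul_alt {E : Type*} [Ring E] (f : Fin 4 → Fin 4 → Fin 4 → E) (P : E) (a b c : Fin 4) :
    P * alt f a b c = alt (fun μ ν ρ => P * f μ ν ρ) a b c := by
  simp only [alt, mul_add, mul_sub]

theorem alt_volumeSum {E : Type*} [Ring E] (q : Fin 4 → Fin 4 → E) (a b c : Fin 4) :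
    alt (volumeSum q) a b c = alt (qqq q 1 2 3) a b c - alt (qqq q 0 2 3) a b c +
      alt (qqq q 0 1 3) a b c - alt (qqq q 0 1 2) a b c := by
  simp only [alt, volumeSum]
  abel

theorem commutator_add_sub {E : Type*} [Ring E] (a b c d P : E) :
    (a - b + c - d) * P - P * (a - b + c - d) =
      (a * P - P * a) - (b * P - P * b) + (c * P - P * c) - (d * P - P * d) := by
  simp only [add_mul, sub_mul, mul_add, mul_sub]
  abel

/-- Averaging scales that are much finer in the direction `σ` than in the others. -/
def scale (σ : Fin 4) (ε : ℝ) (μ : Fin 4) : ℝ := if μ = σ then ε ^ 3 else ε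

theorem scale_ne_zero (σ : Fin 4) {ε : ℝ} (hε : 0 < ε) (μ : Fin 4) : scale σ ε μ ≠ 0 := by
  unfold scale; split_ifs <;> positivity

theorem abs_scale_le (σ : Fin 4) {ε : ℝ} (hε : 0 < ε) (h1 : ε ≤ 1) (μ : Fin 4) :
    |scale σ ε μ| ≤ ε := by
  unfold scale
  split_ifs
  · rw [abs_of_pos (by positivity)]
    exact pow_le_of_le_one hε.le h1 (by norm_num)
  · rw [abs_of_pos hε]

variable {H : Type*} [NormedAddCommGroup H] [InnerProductSpace ℂ H] [CompleteSpace H]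

namespace RegularRep

variable (π : RegularRep H)

section

variable {g : jointSpectrum →ᵇ ℂ} (hg : HasCompactSupport g)

theorem boundedBy_smearEnd {Λ : Fin 4 → ℝ} (hΛ : ∀ μ, Λ μ ≠ 0) (j : Fin 4)
    (p : MvPolynomial (Fin 4) ℂ) :
    π.BoundedBy (π.smearEnd hΛ j p hg) ((∫ β, ‖polyGauss p β‖) * ‖g‖) := fun ψ => by
  rw [coe_smearEnd, mul_assoc]
  refine (π.norm_smear_apply_le Λ j p _).trans ?_
  exact mul_le_mul_of_nonneg_left (π.norm_central_apply_le g ψ)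
    (integral_nonneg fun _ => norm_nonneg _)

/-- `M` bounds the Gaussian averages that occur in products with the coordinates. -/
def SmearBound (M : ℝ) : Prop :=
  0 ≤ M ∧ ∀ (Λ : Fin 4 → ℝ) (hΛ : ∀ μ, Λ μ ≠ 0) (j μ ν ρ : Fin 4),
    π.BoundedBy (π.smearEnd hΛ j 1 hg) M ∧
    π.BoundedBy (π.smearEnd hΛ j (MvPolynomial.X ρ) hg) M ∧
    π.BoundedBy (π.Q μ ν * π.smearEnd hΛ j 1 hg) M ∧
    π.BoundedBy (π.Q μ ν * π.smearEnd hΛ j (MvPolynomial.X ρ) hg) M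

/-- The bound is uniform in the scales: the Weyl operators are unitary, so only the `L¹` norm of the
weight enters. A factor `Q^{μν}` is absorbed into the cutoff. -/
theorem exists_smearBound : ∃ M, π.SmearBound hg M := by
  set I : MvPolynomial (Fin 4) ℂ → ℝ := fun p => ∫ β, ‖polyGauss p β‖ with hI
  have hI0 : ∀ p, 0 ≤ I p := fun p => integral_nonneg fun _ => norm_nonneg _
  set a := I 1 + ∑ ρ, I (MvPolynomial.X ρ)
  set b := ‖g‖ + ∑ μ, ∑ ν, ‖cutMul (entry μ ν) g hg‖
  have hs0 : 0 ≤ ∑ ρ, I (MvPolynomial.X ρ) := Finset.sum_nonneg fun ρ _ => hI0 _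
  have ha1 : I 1 ≤ a := le_add_of_nonneg_right hs0
  have ha2 : ∀ ρ, I (MvPolynomial.X ρ) ≤ a := fun ρ =>
    (Finset.single_le_sum (f := fun ρ => I (MvPolynomial.X ρ)) (fun ρ _ => hI0 _)
      (Finset.mem_univ ρ)).trans (le_add_of_nonneg_left (hI0 1))
  have ha : 0 ≤ a := (hI0 1).trans ha1
  have hb1 : ‖g‖ ≤ b := le_add_of_nonneg_right (by positivity)
  have hb2 : ∀ μ ν, ‖cutMul (entry μ ν) g hg‖ ≤ b := fun μ ν =>
    ((Finset.single_le_sum (f := fun ν => ‖cutMul (entry μ ν) g hg‖) (fun ν _ => norm_nonneg _)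
      (Finset.mem_univ ν)).trans (Finset.single_le_sum
        (f := fun μ => ∑ ν, ‖cutMul (entry μ ν) g hg‖) (fun μ _ => by positivity)
        (Finset.mem_univ μ))).trans (le_add_of_nonneg_left (norm_nonneg _))
  have hb : 0 ≤ b := (norm_nonneg g).trans hb1
  refine ⟨a * b, mul_nonneg ha hb, fun Λ hΛ j μ ν ρ => ⟨?_, ?_, ?_, ?_⟩⟩
  · exact (π.boundedBy_smearEnd hg hΛ j 1).mono (mul_le_mul ha1 hb1 (norm_nonneg _) ha)
  · exact (π.boundedBy_smearEnd hg hΛ j _).mono (mul_le_mul (ha2 ρ) hb1 (norm_nonneg _) ha)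
  · rw [← smearEnd_cutMul]
    exact (π.boundedBy_smearEnd _ hΛ j 1).mono (mul_le_mul ha1 (hb2 μ ν) (norm_nonneg _) ha)
  · rw [← smearEnd_cutMul]
    exact (π.boundedBy_smearEnd _ hΛ j _).mono (mul_le_mul (ha2 ρ) (hb2 μ ν) (norm_nonneg _) ha)

variable {Λ : Fin 4 → ℝ} (hΛ : ∀ μ, Λ μ ≠ 0)

/-- The Gaussian mollifier of all four events. -/
def moll : Module.End ℂ π.smooth :=
  π.smearEnd hΛ 0 1 hg * π.smearEnd hΛ 1 1 hg * π.smearEnd hΛ 2 1 hg * π.smearEnd hΛ 3 1 hg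

theorem coe_moll (ψ : π.smooth) :
    (π.moll hg hΛ ψ : H) = π.smearAll Λ 1 (π.central (g * g * g * g) ψ) := by
  change π.smear Λ 0 1 (π.central g (π.smear Λ 1 1 (π.central g (π.smear Λ 2 1 (π.central g
    (π.smear Λ 3 1 (π.central g ψ))))))) = π.smear Λ 0 1 (π.smear Λ 1 1 (π.smear Λ 2 1
    (π.smear Λ 3 1 _)))
  simp only [central_smear, central_mul_apply]

theorem moll_eq {j k l m : Fin 4} (h : [j, k, l, m].Nodup) : π.moll hg hΛ =
    π.smearEnd hΛ j 1 hg * π.smearEnd hΛ k 1 hg * π.smearEnd hΛ l 1 hg * π.smearEnd hΛ m 1 hg := by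
  have hp : List.Perm [0, 1, 2, 3] [j, k, l, m] := by
    revert j k l m; decide
  have := (hp.map fun i => π.smearEnd hΛ i 1 hg).prod_eq' ?_
  · simpa [moll, mul_assoc] using this
  · refine List.Pairwise.map _ (fun i i' hi => ?_) (by decide : ([0, 1, 2, 3] : List (Fin 4)).Nodup)
    exact π.smearEnd_comm_of_ne hΛ hg hi 1 1

theorem moll_comm_Q (μ ν : Fin 4) : Commute (π.moll hg hΛ) (π.Q μ ν) :=
  (((π.smearEnd_comm_Q hΛ hg _ _ μ ν).mul_left (π.smearEnd_comm_Q hΛ hg _ _ μ ν)).mul_left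
    (π.smearEnd_comm_Q hΛ hg _ _ μ ν)).mul_left (π.smearEnd_comm_Q hΛ hg _ _ μ ν)

variable {hg}

theorem SmearBound.skewPart {π : RegularRep H} {M : ℝ} (hM : π.SmearBound hg M) {δ : ℝ}
    (hδ : ∀ μ, |Λ μ| ≤ δ) (j μ : Fin 4) : π.BoundedBy (π.skewPart hΛ hg j μ) (2 * δ * M) := by
  have h : ∀ ν ∈ Finset.univ, π.BoundedBy ((-(1 / 2) * (Λ ν : ℂ)) •
      (π.Q μ ν * π.smearEnd hΛ j (MvPolynomial.X ν) hg)) (1 / 2 * δ * M) := fun ν _ => by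
    refine ((hM.2 Λ hΛ j μ ν ν).2.2.2.smul _).mono ?_
    have : ‖-(1 / 2) * (Λ ν : ℂ)‖ ≤ 1 / 2 * δ := by
      rw [norm_mul, norm_neg, Complex.norm_real, Real.norm_eq_abs]
      norm_num
      exact hδ ν
    exact mul_le_mul_of_nonneg_right this hM.1
  refine (BoundedBy.sum _ h).mono (le_of_eq ?_)
  simp
  ring

/-- Only the average of the event `j` fails to commute with `q_j^c`, and the commutator is twice
`skewPart`. The unbounded factor `Q^{ab}` is attached to the average of another event, where it is
bounded. -/
theorem SmearBound.q_commutator_moll {π : RegularRep H} {M : ℝ} (hM : π.SmearBound hg M) {δ : ℝ}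
    (hδ : ∀ μ, |Λ μ| ≤ δ) (j a b c : Fin 4) :
    π.BoundedBy (π.Q a b * π.q j c * π.moll hg hΛ - π.moll hg hΛ * (π.Q a b * π.q j c))
      (4 * δ * M ^ 4) := by
  obtain ⟨k, l, m, h⟩ : ∃ k l m, [j, k, l, m].Nodup := by revert j; decide
  have hj : j ≠ k ∧ j ≠ l ∧ j ≠ m := by
    simp only [List.nodup_cons, List.mem_cons, not_or] at h; tauto
  have e : π.Q a b * π.q j c * π.moll hg hΛ - π.moll hg hΛ * (π.Q a b * π.q j c) =
      (π.skewPart hΛ hg j c + π.skewPart hΛ hg j c) * (π.Q a b * π.smearEnd hΛ k 1 hg) *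
        π.smearEnd hΛ l 1 hg * π.smearEnd hΛ m 1 hg := by
    have h1 := π.q_mul_smearEnd hΛ hg j c
    have h2 := π.smearEnd_mul_q hΛ hg j c
    have h3 : π.q j c * π.smearEnd hΛ j 1 hg - π.smearEnd hΛ j 1 hg * π.q j c =
        π.skewPart hΛ hg j c + π.skewPart hΛ hg j c := by rw [h1, h2]; abel
    rw [← h3, ← mul_assoc, (π.moll_comm_Q hg hΛ a b).eq, mul_assoc, mul_assoc,
      π.moll_eq hg hΛ h]
    have hk := (π.q_comm_smearEnd hΛ hg hj.1 c 1).eq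
    have hl := (π.q_comm_smearEnd hΛ hg hj.2.1 c 1).eq
    have hm := (π.q_comm_smearEnd hΛ hg hj.2.2 c 1).eq
    have hQj := (π.smearEnd_comm_Q hΛ hg j 1 a b).eq
    have hQq := (π.q_comm_Q j c a b).eq
    generalize π.smearEnd hΛ j 1 hg = Kj at *
    generalize π.smearEnd hΛ k 1 hg = Kk at *
    generalize π.smearEnd hΛ l 1 hg = Kl at *
    generalize π.smearEnd hΛ m 1 hg = Km at *
    generalize π.q j c = x at *
    generalize π.Q a b = Q at *
    have hk' : ∀ W, Kk * (x * W) = x * (Kk * W) := fun W => by rw [← mul_assoc, ← hk, mul_assoc]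
    have hl' : ∀ W, Kl * (x * W) = x * (Kl * W) := fun W => by rw [← mul_assoc, ← hl, mul_assoc]
    have hj' : ∀ W, Kj * (Q * W) = Q * (Kj * W) := fun W => by rw [← mul_assoc, hQj, mul_assoc]
    have hx' : ∀ W, x * (Q * W) = Q * (x * W) := fun W => by rw [← mul_assoc, hQq, mul_assoc]
    simp only [mul_assoc, sub_mul, ← hm, hk', hl', hj', hx']
  rw [e]
  have hs := hM.skewPart hΛ hδ j c
  have hδ0 : 0 ≤ δ := (abs_nonneg _).trans (hδ 0)
  have hM0 := hM.1
  refine ((((hs.add hs).mul (by positivity) (hM.2 Λ hΛ k a b 0).2.2.1).mul (by positivity)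
    (hM.2 Λ hΛ l 0 0 0).1).mul (by positivity) (hM.2 Λ hΛ m 0 0 0).1).mono (le_of_eq (by ring))

theorem SmearBound.B_commutator_moll {π : RegularRep H} {M : ℝ} (hM : π.SmearBound hg M) {δ : ℝ}
    (hδ : ∀ μ, |Λ μ| ≤ δ) (σ : Fin 4) :
    π.BoundedBy (π.B σ * π.moll hg hΛ - π.moll hg hΛ * π.B σ) (48 * δ * M ^ 4) := by
  have h : ∀ a b c, π.BoundedBy (π.Q a b * π.y c * π.moll hg hΛ -
      π.moll hg hΛ * (π.Q a b * π.y c)) (16 * δ * M ^ 4) := fun a b c => by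
    have e : π.Q a b * π.y c =
        π.Q a b * π.q 0 c - π.Q a b * π.q 1 c + π.Q a b * π.q 2 c - π.Q a b * π.q 3 c := by
      simp only [y, mul_add, mul_sub]
    rw [e, commutator_add_sub]
    exact ((((hM.q_commutator_moll hΛ hδ 0 a b c).sub (hM.q_commutator_moll hΛ hδ 1 a b c)).add
      (hM.q_commutator_moll hΛ hδ 2 a b c)).sub (hM.q_commutator_moll hΛ hδ 3 a b c)).mono
      (le_of_eq (by ring))
  rw [B_eq]
  have e : ∀ x y z P : Module.End ℂ π.smooth, (x + y + z) * P - P * (x + y + z) =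
      (x * P - P * x) + (y * P - P * y) + (z * P - P * z) := fun x y z P => by
    simp only [add_mul, mul_add]; abel
  rw [e]
  exact (((h _ _ _).add (h _ _ _)).add (h _ _ _)).mono (le_of_eq (by ring))

end

section

variable {g : jointSpectrum →ᵇ ℂ} {hg : HasCompactSupport g}

/-- The part of `skewPart` that comes from the direction `σ`. -/
def skewRest (hg : HasCompactSupport g) (σ : Fin 4) {ε : ℝ} (hε : 0 < ε) (j μ : Fin 4) :
    Module.End ℂ π.smooth :=
  (-(1 / 2) * (ε : ℂ) ^ 3) •
    (π.Q μ σ * π.smearEnd (scale_ne_zero σ hε) j (MvPolynomial.X σ) hg)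

/-- In the three directions other than σ the scales coincide, so one constant relates the terms of
`skewPart` to `Q` applied to `symmPart`: it is the quotient of `-ε/2` by `-2i/ε`. -/
theorem skewPart_scale (σ : Fin 4) {ε : ℝ} (hε : 0 < ε) (j μ : Fin 4) :
    π.skewPart (scale_ne_zero σ hε) hg j μ =
      ((ε : ℂ) ^ 2 / (4 * Complex.I)) • tensorAct π.Q (triple σ).1 (triple σ).2.1 (triple σ).2.2
        (π.symmPart (scale_ne_zero σ hε) hg j) μ + π.skewRest hg σ hε j μ := by
  obtain ⟨h1, h2, h3⟩ := triple_ne σ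
  have hε' : (ε : ℂ) ≠ 0 := by exact_mod_cast hε.ne'
  have hw : ((ε : ℂ) ^ 2 / (4 * Complex.I)) * (-2 * Complex.I * (ε : ℂ)⁻¹) =
      -(1 / 2) * (ε : ℂ) := by
    field_simp
    norm_num
  rw [skewPart, sum_eq_triple σ, skewRest]
  ext ψ
  simp only [tensorAct, symmPart, scale, if_neg h1, if_neg h2, if_neg h3, if_true,
    LinearMap.add_apply, LinearMap.smul_apply, Module.End.mul_apply, map_smul, smul_add, smul_smul,
    hw, Complex.ofReal_pow]

/-- The commutator is the difference of the alternating forms at `s + wQs + r` and `s - wQs - r`.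
Without `r` they agree exactly, which removes the contributions of order `1/ε`; what is left has one
factor `r` of order `ε³` and two factors of order `1/ε`. -/
theorem SmearBound.A_term_commutator_moll {π : RegularRep H} {M : ℝ} (hM : π.SmearBound hg M)
    (σ : Fin 4) {ε : ℝ} (hε : 0 < ε) (hε1 : ε ≤ 1) {j k l m : Fin 4} (h : [j, k, l, m].Nodup) :
    π.BoundedBy (alt (qqq π.q j k l) (triple σ).1 (triple σ).2.1 (triple σ).2.2 *
        π.moll hg (scale_ne_zero σ hε) - π.moll hg (scale_ne_zero σ hε) *
        alt (qqq π.q j k l) (triple σ).1 (triple σ).2.1 (triple σ).2.2) (450 * ε * M ^ 4) := by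
  have hM0 := hM.1
  have hne : j ≠ k ∧ j ≠ l ∧ k ≠ l ∧ j ≠ m ∧ k ≠ m ∧ l ≠ m := by
    simp only [List.nodup_cons, List.mem_cons, not_or] at h; tauto
  obtain ⟨hjk, hjl, hkl, hjm, hkm, hlm⟩ := hne
  obtain ⟨ha, hb, hc⟩ := triple_ne σ
  have hqK : ∀ j k, j ≠ k → ∀ μ, π.q j μ * π.smearEnd (scale_ne_zero σ hε) k 1 hg =
      π.smearEnd (scale_ne_zero σ hε) k 1 hg * π.q j μ := fun j k hjk μ =>
    (π.q_comm_smearEnd _ hg hjk μ 1).eq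
  have hT : ∀ i κ μ ν, π.symmPart (scale_ne_zero σ hε) hg i κ * π.Q μ ν =
      π.Q μ ν * π.symmPart (scale_ne_zero σ hε) hg i κ := fun i κ μ ν =>
    ((π.smearEnd_comm_Q (scale_ne_zero σ hε) hg i (MvPolynomial.X κ) μ ν).smul_left _).eq
  set a := (triple σ).1
  set b := (triple σ).2.1
  set c := (triple σ).2.2
  set w : ℂ := (ε : ℂ) ^ 2 / (4 * Complex.I) with hw
  set s := π.symmPart (scale_ne_zero σ hε) hg with hs
  set d := π.skewPart (scale_ne_zero σ hε) hg with hd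
  set r := π.skewRest hg σ hε with hr
  have hdr : ∀ i μ, d i μ = w • tensorAct π.Q a b c (s i) μ + r i μ := π.skewPart_scale σ hε
  -- bounds for the single factors
  have bs : ∀ i μ, μ = a ∨ μ = b ∨ μ = c → π.BoundedBy (s i μ) (2 * M / ε) := fun i μ hμ => by
    have : scale σ ε μ = ε := if_neg (by rcases hμ with rfl | rfl | rfl <;> assumption)
    refine ((hM.2 _ (scale_ne_zero σ hε) i 0 0 μ).2.1.smul _).mono (le_of_eq ?_)
    rw [this]
    simp [abs_of_pos hε]
    ring
  have bd : ∀ i μ, π.BoundedBy (d i μ) (2 * ε * M) := fun i μ =>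
    hM.skewPart _ (abs_scale_le σ hε hε1) i μ
  have br : ∀ i μ, π.BoundedBy (r i μ) (1 / 2 * ε ^ 3 * M) := fun i μ => by
    refine ((hM.2 _ (scale_ne_zero σ hε) i μ σ σ).2.2.2.smul _).mono (le_of_eq ?_)
    simp [abs_of_pos hε]
  -- For `ε ≤ 1` the smaller pieces are absorbed into multiples of `M/ε`; the coefficients `2`, `2`
  -- and `1/2` add up to less than 5.
  have hε2 : ε * M ≤ M / ε := by
    rw [le_div_iff₀ hε]
    nlinarith [mul_nonneg hM0 hε.le, mul_le_mul hε1 hε1 hε.le zero_le_one]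
  have hε3 : ε ^ 3 * M ≤ M / ε := by
    refine le_trans ?_ hε2
    exact mul_le_mul_of_nonneg_right (pow_le_of_le_one hε.le hε1 (by norm_num)) hM0
  have hsum : 2 * M / ε = 2 * (M / ε) := by ring
  have hdiv : 0 ≤ M / ε := by positivity
  have bp : ∀ i μ, μ = a ∨ μ = b ∨ μ = c →
      π.BoundedBy (s i μ + w • tensorAct π.Q a b c (s i) μ) (5 * M / ε) := fun i μ hμ => by
    have e : s i μ + w • tensorAct π.Q a b c (s i) μ = s i μ + (d i μ - r i μ) := by
      rw [hdr, add_sub_cancel_right]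
    rw [e]
    refine ((bs i μ hμ).add ((bd i μ).sub (br i μ))).mono ?_
    have : 5 * M / ε = 5 * (M / ε) := by ring
    linarith
  have bm : ∀ i μ, μ = a ∨ μ = b ∨ μ = c →
      π.BoundedBy (s i μ - w • tensorAct π.Q a b c (s i) μ) (5 * M / ε) := fun i μ hμ => by
    have e : s i μ - w • tensorAct π.Q a b c (s i) μ = s i μ - (d i μ - r i μ) := by
      rw [hdr, add_sub_cancel_right]
    rw [e]
    refine ((bs i μ hμ).sub ((bd i μ).sub (br i μ))).mono ?_
    have : 5 * M / ε = 5 * (M / ε) := by ring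
    linarith
  have bpr : ∀ i μ, μ = a ∨ μ = b ∨ μ = c →
      π.BoundedBy (s i μ + w • tensorAct π.Q a b c (s i) μ + r i μ) (5 * M / ε) := fun i μ hμ => by
    rw [add_assoc, ← hdr]
    refine ((bs i μ hμ).add (bd i μ)).mono ?_
    have : 5 * M / ε = 5 * (M / ε) := by ring
    linarith
  have bmr : ∀ i μ, μ = a ∨ μ = b ∨ μ = c →
      π.BoundedBy (s i μ - w • tensorAct π.Q a b c (s i) μ + -r i μ) (5 * M / ε) := fun i μ hμ => by
    rw [← sub_eq_add_neg, sub_sub, ← hdr]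
    refine ((bs i μ hμ).sub (bd i μ)).mono ?_
    have : 5 * M / ε = 5 * (M / ε) := by ring
    linarith
  have brn : ∀ i μ, π.BoundedBy (-r i μ) (1 / 2 * ε ^ 3 * M) := fun i μ ψ => by
    rw [LinearMap.neg_apply, Submodule.coe_neg, norm_neg]
    exact br i μ ψ
  have key := altMul_add_eq_altMul_sub (Q := π.Q) (X := s j) (Y := s k) (Z := s l) π.Q_antisymm
    (fun μ ν ρ κ => (π.Q_comm_Q μ ν ρ κ).eq) (hT j) (hT k) a b c w
  have h1 := BoundedBy.altMul_sub (π := π) (by positivity) (by positivity) (bp j) (bpr k) (bp k)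
    (bpr l) (fun μ _ => br j μ) (fun μ _ => br k μ) (fun μ _ => br l μ)
  have h2 := BoundedBy.altMul_sub (π := π) (by positivity) (by positivity) (bm j) (bmr k) (bm k)
    (bmr l) (fun μ _ => brn j μ) (fun μ _ => brn k μ) (fun μ _ => brn l μ)
  have h3 := (h1.sub h2).mul (by positivity) (hM.2 _ (scale_ne_zero σ hε) m 0 0 0).1
  have e1 : ∀ i μ, s i μ + w • tensorAct π.Q a b c (s i) μ + r i μ =
      π.q i μ * π.smearEnd (scale_ne_zero σ hε) i 1 hg := fun i μ => by
    rw [add_assoc, ← hdr, q_mul_smearEnd]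
  have e2 : ∀ i μ, s i μ - w • tensorAct π.Q a b c (s i) μ + -r i μ =
      π.smearEnd (scale_ne_zero σ hε) i 1 hg * π.q i μ := fun i μ => by
    rw [← sub_eq_add_neg, sub_sub, ← hdr, smearEnd_mul_q]
  rw [key, sub_sub_sub_cancel_right] at h3
  simp only [e1, e2] at h3
  have e : alt (qqq π.q j k l) a b c * π.moll hg (scale_ne_zero σ hε) -
      π.moll hg (scale_ne_zero σ hε) * alt (qqq π.q j k l) a b c =
      (altMul a b c (fun μ => π.q j μ * π.smearEnd (scale_ne_zero σ hε) j 1 hg)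
        (fun μ => π.q k μ * π.smearEnd (scale_ne_zero σ hε) k 1 hg)
        (fun μ => π.q l μ * π.smearEnd (scale_ne_zero σ hε) l 1 hg) -
      altMul a b c (fun μ => π.smearEnd (scale_ne_zero σ hε) j 1 hg * π.q j μ)
        (fun μ => π.smearEnd (scale_ne_zero σ hε) k 1 hg * π.q k μ)
        (fun μ => π.smearEnd (scale_ne_zero σ hε) l 1 hg * π.q l μ)) *
        π.smearEnd (scale_ne_zero σ hε) m 1 hg := by
    rw [sub_mul, altMul, altMul, alt_mul, alt_mul, alt_mul, mul_alt, π.moll_eq hg _ h]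
    congr 1
    · congr 1
      funext μ ν ρ
      exact qqq_mul_prod (K := fun i => π.smearEnd (scale_ne_zero σ hε) i 1 hg) hqK hjk hjl hkl
        m μ ν ρ
    · congr 1
      funext μ ν ρ
      exact prod_mul_qqq (K := fun i => π.smearEnd (scale_ne_zero σ hε) i 1 hg) hqK hjk hjl hkl
        hjm hkm hlm μ ν ρ
  rw [e]
  -- `450 = 2 · 18 · 5² · 1/2`: two perturbation bounds with factors `5M/ε` and perturbations
  -- `ε³M/2`; the last factor `M` is the average of the event `m`.
  refine h3.mono (le_of_eq ?_)
  field_simp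
  ring

theorem SmearBound.A_commutator_moll {π : RegularRep H} {M : ℝ} (hM : π.SmearBound hg M)
    (σ : Fin 4) {ε : ℝ} (hε : 0 < ε) (hε1 : ε ≤ 1) :
    π.BoundedBy (π.A σ * π.moll hg (scale_ne_zero σ hε) -
      π.moll hg (scale_ne_zero σ hε) * π.A σ) (1800 * ε * M ^ 4) := by
  rw [A_eq, alt_volumeSum, commutator_add_sub]
  exact ((((hM.A_term_commutator_moll σ hε hε1 (j := 1) (k := 2) (l := 3) (m := 0)
    (by decide)).sub (hM.A_term_commutator_moll σ hε hε1 (j := 0) (k := 2) (l := 3) (m := 1)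
    (by decide))).add (hM.A_term_commutator_moll σ hε hε1 (j := 0) (k := 1) (l := 3) (m := 2)
    (by decide))).sub (hM.A_term_commutator_moll σ hε hε1 (j := 0) (k := 1) (l := 2) (m := 3)
    (by decide))).mono (le_of_eq (by ring))

/-- The mollifiers with the scales of the direction `σ` commute asymptotically with `T`. -/
def MollComm (σ : Fin 4) (T : Module.End ℂ π.smooth) : Prop :=
  ∀ (g : jointSpectrum →ᵇ ℂ) (hg : HasCompactSupport g), ∃ C : ℝ, ∀ (ε : ℝ) (hε : 0 < ε), ε ≤ 1 →
    π.BoundedBy (T * π.moll hg (scale_ne_zero σ hε) - π.moll hg (scale_ne_zero σ hε) * T) (C * ε)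

theorem mollComm_A (σ : Fin 4) : π.MollComm σ (π.A σ) := fun g hg => by
  obtain ⟨M, hM⟩ := π.exists_smearBound hg
  exact ⟨1800 * M ^ 4, fun ε hε hε1 => (hM.A_commutator_moll σ hε hε1).mono (le_of_eq (by ring))⟩

/-- The direction σ of the fine scale is independent of σ', so a single sequence of mollifiers
serves all four `B_σ'` at once. -/
theorem mollComm_B (σ σ' : Fin 4) : π.MollComm σ (π.B σ') := fun g hg => by
  obtain ⟨M, hM⟩ := π.exists_smearBound hg
  exact ⟨48 * M ^ 4, fun ε hε hε1 => (hM.B_commutator_moll (scale_ne_zero σ hε)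
    (abs_scale_le σ hε hε1) σ').mono (le_of_eq (by ring))⟩

theorem MollComm.add_smul {π : RegularRep H} {σ : Fin 4} {T S : Module.End ℂ π.smooth}
    (hT : π.MollComm σ T) (hS : π.MollComm σ S) (z : ℂ) : π.MollComm σ (T + z • S) :=
  fun g hg => by
  obtain ⟨C, hC⟩ := hT g hg
  obtain ⟨C', hC'⟩ := hS g hg
  refine ⟨C + ‖z‖ * C', fun ε hε hε1 => ?_⟩
  have e : ∀ P : Module.End ℂ π.smooth, (T + z • S) * P - P * (T + z • S) =
      (T * P - P * T) + z • (S * P - P * S) := fun P => by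
    ext ψ
    simp only [LinearMap.add_apply, LinearMap.sub_apply, LinearMap.smul_apply,
      Module.End.mul_apply, map_add, map_smul, Submodule.coe_add, Submodule.coe_sub,
      Submodule.coe_smul]
    module
  rw [e]
  exact ((hC ε hε hε1).add ((hC' ε hε hε1).smul z)).mono (le_of_eq (by ring))

end

end RegularRep

end

end QST

/-! ### Closures, adjoints, selfadjointness and normality. -/

namespace QST

open Filter Topology MeasureTheory

noncomputable section

/-- The fourth power of the cutoff function. -/
def cutoffPow (m : ℕ) : jointSpectrum →ᵇ ℂ := cutoff m * cutoff m * cutoff m * cutoff m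

theorem hasCompactSupport_cutoffPow (m : ℕ) : HasCompactSupport (cutoffPow m) :=
  hasCompactSupport_mul_left _ (hasCompactSupport_cutoff m)

theorem star_cutoffPow (m : ℕ) : star (cutoffPow m) = cutoffPow m := by
  simp [cutoffPow, star_mul, star_cutoff, mul_assoc]

/-- A sequence of scales in `(0, 1]` that tends to `0`. -/
def mesh (n : ℕ) : ℝ := 1 / ((n : ℝ) + 1)

theorem mesh_pos (n : ℕ) : 0 < mesh n := by unfold mesh; positivity

theorem mesh_le_one (n : ℕ) : mesh n ≤ 1 := by
  unfold mesh
  rw [div_le_one (by positivity)]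
  linarith [(Nat.cast_nonneg n : (0 : ℝ) ≤ n)]

theorem tendsto_mesh : Tendsto mesh atTop (𝓝 0) := tendsto_one_div_add_atTop_nhds_zero_nat

theorem tendsto_scale_mesh (σ : Fin 4) : Tendsto (fun n => scale σ (mesh n)) atTop (𝓝 0) := by
  refine tendsto_pi_nhds.2 fun μ => ?_
  by_cases h : μ = σ
  · simpa [scale, h] using tendsto_mesh.pow 3
  · simpa [scale, h] using tendsto_mesh

theorem ofReal_norm_sq {E : Type*} [NormedAddCommGroup E] [InnerProductSpace ℂ E] (x : E) :
    ((‖x‖ ^ 2 : ℝ) : ℂ) = inner ℂ x x := by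
  rw [inner_self_eq_norm_sq_to_K]; norm_cast

variable {H : Type*} [NormedAddCommGroup H] [InnerProductSpace ℂ H] [CompleteSpace H]

namespace RegularRep

variable (π : RegularRep H)

theorem smearAll_central_inner_left (Λ : Fin 4 → ℝ) {g : jointSpectrum →ᵇ ℂ} (hg : star g = g)
    (x y : H) : inner ℂ (π.smearAll Λ 1 (π.central g x)) y =
      inner ℂ x (π.smearAll Λ 1 (π.central g y)) := by
  have h : ∀ j x y, inner ℂ (π.smear Λ j 1 x) y = inner ℂ x (π.smear Λ j 1 y) := fun j x y =>
    π.smear_inner_left Λ j (fun β => by simp [polyGauss_one, gauss_neg]) x y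
  have hs : ∀ x, π.smearAll Λ 1 x =
      π.smear Λ 0 1 (π.smear Λ 1 1 (π.smear Λ 2 1 (π.smear Λ 3 1 x))) := fun _ => rfl
  rw [hs, hs, h, h, h, h, central_inner_left, hg]
  simp only [central_smear]
  rw [π.smear_smear (by decide : (3 : Fin 4) ≠ 2), π.smear_smear (by decide : (3 : Fin 4) ≠ 1),
    π.smear_smear (by decide : (3 : Fin 4) ≠ 0), π.smear_smear (by decide : (2 : Fin 4) ≠ 1),
    π.smear_smear (by decide : (2 : Fin 4) ≠ 0), π.smear_smear (by decide : (1 : Fin 4) ≠ 0)]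

theorem tendsto_central_cutoffPow (x : H) :
    Tendsto (fun m => π.central (cutoffPow m) x) atTop (𝓝 x) := by
  have step : ∀ {u : ℕ → H}, Tendsto u atTop (𝓝 x) →
      Tendsto (fun m => π.central (cutoff m) (u m)) atTop (𝓝 x) := fun {u} hu => by
    have h1 : Tendsto (fun m => π.central (cutoff m) (u m - x)) atTop (𝓝 0) := by
      refine squeeze_zero_norm (fun m => ?_) (tendsto_iff_norm_sub_tendsto_zero.1 hu)
      refine (π.norm_central_apply_le _ _).trans ?_
      exact mul_le_of_le_one_left (norm_nonneg _) (norm_cutoff_le m)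
    simpa using h1.add (π.tendsto_central_cutoff x)
  have h := step (step (step (π.tendsto_central_cutoff x)))
  refine h.congr fun m => ?_
  simp only [cutoffPow, central_mul_apply]

/-- Smooth approximations of a vector. -/
def approx (σ : Fin 4) (m n : ℕ) (φ : H) : π.smooth :=
  ⟨π.smearAll (scale σ (mesh n)) 1 (π.central (cutoffPow m) φ),
    π.smearAll_mem_smooth (scale_ne_zero σ (mesh_pos n)) 1 (hasCompactSupport_cutoffPow m) φ⟩

theorem coe_approx (σ : Fin 4) (m n : ℕ) (φ : H) : (π.approx σ m n φ : H) =
    π.smearAll (scale σ (mesh n)) 1 (π.central (cutoffPow m) φ) := rfl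

theorem tendsto_approx (σ : Fin 4) (m : ℕ) (φ : H) :
    Tendsto (fun n => (π.approx σ m n φ : H)) atTop (𝓝 (π.central (cutoffPow m) φ)) :=
  π.tendsto_smearAll (tendsto_scale_mesh σ) _

/-- The adjoint of `T` is defined at the first vector, and maps it to the second one. -/
def AdjPair (T : Module.End ℂ π.smooth) (φ φ' : H) : Prop :=
  ∀ χ : π.smooth, inner ℂ φ (T χ : H) = inner ℂ φ' (χ : H)

variable {π}

theorem norm_le_of_inner_smooth {x : H} {c : ℝ} (hc : 0 ≤ c)
    (h : ∀ χ : π.smooth, ‖inner ℂ x (χ : H)‖ ≤ c * ‖(χ : H)‖) : ‖x‖ ≤ c := by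
  have h' : ∀ y : H, ‖inner ℂ x y‖ ≤ c * ‖y‖ := fun y => by
    refine π.dense_smooth.induction (P := fun y => ‖inner ℂ x y‖ ≤ c * ‖y‖)
      (fun y hy => h ⟨y, hy⟩) (isClosed_le (by fun_prop) (by fun_prop)) y
  have := h' x
  rw [inner_self_eq_norm_sq_to_K] at this
  by_contra hlt
  push Not at hlt
  have hx : 0 < ‖x‖ := hc.trans_lt hlt
  have h2 : ‖((‖x‖ : ℝ) : ℂ) ^ 2‖ = ‖x‖ * ‖x‖ := by
    rw [norm_pow, Complex.norm_real, norm_norm, sq]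
  have h3 : ‖x‖ * ‖x‖ ≤ c * ‖x‖ := h2 ▸ this
  exact absurd (le_of_mul_le_mul_right h3 hx) (not_le.2 hlt)

/-- Tested against `χ`, the difference between `T'` of the mollified `φ` and the mollified `φ'` is
`-⟨φ, [T, P]χ⟩`, where `P` is the mollifier. Its norm is therefore at most that of `φ` times that of
the commutator, which tends to zero. -/
theorem tendsto_apply_approx {σ : Fin 4} {T T' : Module.End ℂ π.smooth} (h : π.FormalAdj T T')
    (hT : π.MollComm σ T) {φ φ' : H} (hφ : π.AdjPair T φ φ') (m : ℕ) :
    Tendsto (fun n => (T' (π.approx σ m n φ) : H)) atTop (𝓝 (π.central (cutoffPow m) φ')) := by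
  obtain ⟨C, hC⟩ := hT (cutoff m) (hasCompactSupport_cutoff m)
  have bound : ∀ n, ‖(T' (π.approx σ m n φ) : H) -
      π.smearAll (scale σ (mesh n)) 1 (π.central (cutoffPow m) φ')‖ ≤ ‖φ‖ * (|C| * mesh n) := by
    intro n
    have hm := (mesh_pos n).le
    refine norm_le_of_inner_smooth (π := π) (by positivity) fun χ => ?_
    set P := π.moll (hasCompactSupport_cutoff m) (scale_ne_zero σ (mesh_pos n)) with hP
    have hPc : ∀ χ : π.smooth, (P χ : H) =
        π.smearAll (scale σ (mesh n)) 1 (π.central (cutoffPow m) χ) := fun χ => π.coe_moll _ _ χ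
    have e : inner ℂ ((T' (π.approx σ m n φ) : H) -
        π.smearAll (scale σ (mesh n)) 1 (π.central (cutoffPow m) φ')) (χ : H) =
        -inner ℂ φ (((T * P - P * T) χ : π.smooth) : H) := by
      rw [inner_sub_left, h.symm, coe_approx,
        π.smearAll_central_inner_left _ (star_cutoffPow m), ← hPc,
        π.smearAll_central_inner_left _ (star_cutoffPow m), ← hPc, LinearMap.sub_apply,
        Submodule.coe_sub, inner_sub_right, Module.End.mul_apply, Module.End.mul_apply, hφ (P χ)]
      ring
    rw [e, norm_neg]
    refine (norm_inner_le_norm _ _).trans ?_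
    rw [mul_assoc]
    refine mul_le_mul_of_nonneg_left ((hC _ (mesh_pos n) (mesh_le_one n) χ).trans ?_)
      (norm_nonneg _)
    gcongr
    exact le_abs_self C
  have h0 : Tendsto (fun n => ‖φ‖ * (|C| * mesh n)) atTop (𝓝 0) := by
    simpa using (tendsto_mesh.const_mul |C|).const_mul ‖φ‖
  have h1 := (squeeze_zero_norm bound h0).add
    (π.tendsto_smearAll (tendsto_scale_mesh σ) (π.central (cutoffPow m) φ'))
  simpa using h1

/-! ### Closures and adjoints -/

variable (π) in
/-- An operator on the smooth vectors as a partially defined operator. -/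
def pmap (T : Module.End ℂ π.smooth) : H →ₗ.[ℂ] H :=
  LinearPMap.mk π.smooth (π.smooth.subtype ∘ₗ T)

theorem mem_graph_pmap {T : Module.End ℂ π.smooth} {z : H × H} :
    z ∈ (π.pmap T).graph ↔ ∃ ψ : π.smooth, z = ((ψ : H), (T ψ : H)) := by
  rw [LinearPMap.mem_graph_iff']
  exact ⟨fun ⟨ψ, h⟩ => ⟨ψ, h.symm⟩, fun ⟨ψ, h⟩ => ⟨ψ, h.symm⟩⟩

theorem FormalAdj.isClosable {T T' : Module.End ℂ π.smooth} (h : π.FormalAdj T T') :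
    (π.pmap T).IsClosable := by
  have hd : Dense ((π.pmap T').domain : Set H) := π.dense_smooth
  have hf : (π.pmap T').IsFormalAdjoint (π.pmap T) := fun x y => h.symm x y
  exact (LinearPMap.adjoint_isClosed hd).isClosable.leIsClosable (hf.le_adjoint hd)

theorem FormalAdj.mem_graph_cl {T T' : Module.End ℂ π.smooth} (h : π.FormalAdj T T') {z : H × H} :
    z ∈ (π.cl T).graph ↔ z ∈ closure {z : H × H | ∃ ψ : π.smooth, z = ((ψ : H), (T ψ : H))} := by
  have hg : (π.cl T).graph = (π.pmap T).graph.topologicalClosure :=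
    h.isClosable.graph_closure_eq_closure_graph.symm
  rw [hg, ← SetLike.mem_coe, Submodule.topologicalClosure_coe]
  have : ((π.pmap T).graph : Set (H × H)) = {z | ∃ ψ : π.smooth, z = ((ψ : H), (T ψ : H))} :=
    Set.ext fun z => mem_graph_pmap
  rw [this]

theorem FormalAdj.exists_seq {T T' : Module.End ℂ π.smooth} (h : π.FormalAdj T T') {x y : H}
    (hxy : (x, y) ∈ (π.cl T).graph) : ∃ u : ℕ → π.smooth,
      Tendsto (fun n => (u n : H)) atTop (𝓝 x) ∧ Tendsto (fun n => (T (u n) : H)) atTop (𝓝 y) := by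
  rw [h.mem_graph_cl, mem_closure_iff_seq_limit] at hxy
  obtain ⟨z, hz, hlim⟩ := hxy
  choose u hu using hz
  refine ⟨u, ?_, ?_⟩
  · exact ((continuous_fst.tendsto _).comp hlim).congr fun n => congrArg Prod.fst (hu n)
  · exact ((continuous_snd.tendsto _).comp hlim).congr fun n => congrArg Prod.snd (hu n)

theorem FormalAdj.mem_graph_of_tendsto {T T' : Module.End ℂ π.smooth} (h : π.FormalAdj T T')
    {x y : H} {u : ℕ → π.smooth} (hx : Tendsto (fun n => (u n : H)) atTop (𝓝 x))
    (hy : Tendsto (fun n => (T (u n) : H)) atTop (𝓝 y)) : (x, y) ∈ (π.cl T).graph :=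
  h.mem_graph_cl.2 (mem_closure_of_tendsto (hx.prodMk_nhds hy)
    (Eventually.of_forall fun n => ⟨u n, rfl⟩))

theorem isClosed_cl {T T' : Module.End ℂ π.smooth} (h : π.FormalAdj T T') : (π.cl T).IsClosed :=
  h.isClosable.closure_isClosed

theorem dense_domain_cl (T : Module.End ℂ π.smooth) : Dense ((π.cl T).domain : Set H) :=
  π.dense_smooth.mono (π.pmap T).le_closure.1

theorem mem_graph_cl_apply (T : Module.End ℂ π.smooth) (ψ : π.smooth) :
    ((ψ : H), (T ψ : H)) ∈ (π.cl T).graph :=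
  LinearPMap.le_graph_of_le (π.pmap T).le_closure (mem_graph_pmap.2 ⟨ψ, rfl⟩)

theorem FormalAdj.mem_graph_adjoint {T T' : Module.End ℂ π.smooth} (h : π.FormalAdj T T')
    {φ φ' : H} : (φ, φ') ∈ (π.cl T)†.graph ↔ π.AdjPair T φ φ' := by
  have hd := dense_domain_cl T
  constructor
  · intro hφ χ
    obtain ⟨y, rfl, rfl⟩ := (LinearPMap.mem_graph_iff _).1 hφ
    obtain ⟨x, hx, hTx⟩ := (LinearPMap.mem_graph_iff _).1 (mem_graph_cl_apply T χ)
    simp only at hx hTx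
    rw [← hTx, ← hx]
    exact ((π.cl T).adjoint_isFormalAdjoint hd y x).symm
  · intro hφ
    have key : ∀ x : (π.cl T).domain, inner ℂ φ' (x : H) = inner ℂ φ (π.cl T x) := fun x => by
      obtain ⟨u, hu, hTu⟩ := h.exists_seq ((π.cl T).mem_graph x)
      refine tendsto_nhds_unique (tendsto_const_nhds.inner hu) ?_
      refine (tendsto_const_nhds.inner hTu).congr fun n => hφ (u n)
    have hm := LinearPMap.mem_adjoint_domain_of_exists φ ⟨φ', key⟩
    exact (LinearPMap.mem_graph_iff _).2 ⟨⟨φ, hm⟩, rfl, LinearPMap.adjoint_apply_eq hd _ key⟩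

theorem FormalAdj.adjPair_of_mem_graph {T T' : Module.End ℂ π.smooth} (h : π.FormalAdj T T')
    {φ φ' : H} (hφ : (φ, φ') ∈ (π.cl T').graph) : π.AdjPair T φ φ' := fun χ => by
  obtain ⟨u, hu, hTu⟩ := h.symm.exists_seq hφ
  refine tendsto_nhds_unique (hu.inner tendsto_const_nhds) ?_
  exact (hTu.inner tendsto_const_nhds).congr fun n => h.symm (u n) χ

/-- Two limits in order: for a fixed central cutoff the mollification is removed, since the
commutator bound depends on the cutoff; then the cutoff is removed by closedness of the graph. -/
theorem FormalAdj.mem_graph_cl_iff {σ : Fin 4} {T T' : Module.End ℂ π.smooth}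
    (h : π.FormalAdj T T') (hT : π.MollComm σ T) {φ φ' : H} :
    (φ, φ') ∈ (π.cl T').graph ↔ π.AdjPair T φ φ' := by
  refine ⟨h.adjPair_of_mem_graph, fun hφ => ?_⟩
  have hm : ∀ m, (π.central (cutoffPow m) φ, π.central (cutoffPow m) φ') ∈ (π.cl T').graph :=
    fun m => h.symm.mem_graph_of_tendsto (π.tendsto_approx σ m φ) (tendsto_apply_approx h hT hφ m)
  exact (isClosed_cl h.symm).mem_of_tendsto ((π.tendsto_central_cutoffPow φ).prodMk_nhds
    (π.tendsto_central_cutoffPow φ')) (Eventually.of_forall hm)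

theorem FormalAdj.adjoint_cl {σ : Fin 4} {T T' : Module.End ℂ π.smooth}
    (h : π.FormalAdj T T') (hT : π.MollComm σ T) : (π.cl T)† = π.cl T' := by
  refine LinearPMap.eq_of_eq_graph (Submodule.ext fun z => ?_)
  exact h.mem_graph_adjoint.trans (h.mem_graph_cl_iff hT).symm

/-- A norm inequality between operators on smooth vectors passes to the closures, domains included:
a sequence whose images under `T` converge has Cauchy images under `S`. -/
theorem FormalAdj.exists_mem_graph_cl {T T' S S' : Module.End ℂ π.smooth} (h : π.FormalAdj T T')
    (h' : π.FormalAdj S S') (hST : ∀ ψ, ‖(S ψ : H)‖ ≤ ‖(T ψ : H)‖) {x y : H}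
    (hxy : (x, y) ∈ (π.cl T).graph) : ∃ y', (x, y') ∈ (π.cl S).graph ∧ ‖y'‖ ≤ ‖y‖ := by
  obtain ⟨u, hu, hTu⟩ := h.exists_seq hxy
  have hc : CauchySeq fun n => (S (u n) : H) := by
    have hc := hTu.cauchySeq
    rw [Metric.cauchySeq_iff] at hc ⊢
    intro ε hε
    obtain ⟨N, hN⟩ := hc ε hε
    refine ⟨N, fun a ha b hb => lt_of_le_of_lt ?_ (hN a ha b hb)⟩
    rw [dist_eq_norm, dist_eq_norm, ← Submodule.coe_sub, ← Submodule.coe_sub, ← map_sub, ← map_sub]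
    exact hST _
  obtain ⟨y', hy'⟩ := cauchySeq_tendsto_of_complete hc
  exact ⟨y', h'.mem_graph_of_tendsto hu hy',
    le_of_tendsto_of_tendsto' hy'.norm hTu.norm fun n => hST _⟩

variable (π)

theorem isSelfAdjoint_cl_A (σ : Fin 4) : IsSelfAdjoint (π.cl (π.A σ)) :=
  LinearPMap.isSelfAdjoint_def.2 ((π.formalAdj_A σ).adjoint_cl (π.mollComm_A σ))

theorem isSelfAdjoint_cl_B (σ : Fin 4) : IsSelfAdjoint (π.cl (π.B σ)) :=
  LinearPMap.isSelfAdjoint_def.2 ((π.formalAdj_B σ).adjoint_cl (π.mollComm_B σ σ))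

theorem mollComm_V (σ : Fin 4) : π.MollComm σ (π.V σ) := by
  rw [V_eq]
  exact (π.mollComm_A σ).add_smul (π.mollComm_B σ σ) Complex.I

theorem adj_V_mul_V (σ : Fin 4) : (π.A σ - Complex.I • π.B σ) * π.V σ =
    π.A σ * π.A σ + π.B σ * π.B σ := by
  have hc := π.A_comm_B σ
  rw [V_eq]
  ext ψ
  have hc' := LinearMap.congr_fun hc.eq ψ
  simp only [Module.End.mul_apply] at hc'
  simp only [Module.End.mul_apply, LinearMap.add_apply, LinearMap.sub_apply, LinearMap.smul_apply,
    map_add, map_smul, hc', Submodule.coe_add, Submodule.coe_sub, Submodule.coe_smul]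
  match_scalars <;> simp

theorem V_mul_adj_V (σ : Fin 4) : π.V σ * (π.A σ - Complex.I • π.B σ) =
    π.A σ * π.A σ + π.B σ * π.B σ := by
  have hc := π.A_comm_B σ
  rw [V_eq]
  ext ψ
  have hc' := LinearMap.congr_fun hc.eq ψ
  simp only [Module.End.mul_apply] at hc'
  simp only [Module.End.mul_apply, LinearMap.add_apply, LinearMap.sub_apply, LinearMap.smul_apply,
    map_sub, map_smul, hc', Submodule.coe_add, Submodule.coe_sub, Submodule.coe_smul]
  match_scalars <;> simp

theorem inner_V_V (σ : Fin 4) (ψ χ : π.smooth) : inner ℂ (π.V σ ψ : H) (π.V σ χ : H) =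
    inner ℂ ((π.A σ * π.A σ + π.B σ * π.B σ) ψ : H) (χ : H) := by
  rw [← adj_V_mul_V, Module.End.mul_apply, (π.formalAdj_V σ).symm]

theorem norm_V_sq (σ : Fin 4) (ψ : π.smooth) :
    ‖(π.V σ ψ : H)‖ ^ 2 = ‖(π.A σ ψ : H)‖ ^ 2 + ‖(π.B σ ψ : H)‖ ^ 2 := by
  have h : ((‖(π.V σ ψ : H)‖ ^ 2 : ℝ) : ℂ) =
      ((‖(π.A σ ψ : H)‖ ^ 2 + ‖(π.B σ ψ : H)‖ ^ 2 : ℝ) : ℂ) := by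
    rw [Complex.ofReal_add, ofReal_norm_sq, ofReal_norm_sq, ofReal_norm_sq, inner_V_V,
      LinearMap.add_apply, Submodule.coe_add, inner_add_left, Module.End.mul_apply,
      Module.End.mul_apply, π.formalAdj_A σ, π.formalAdj_B σ]
  exact_mod_cast h

theorem norm_adj_V (σ : Fin 4) (ψ : π.smooth) :
    ‖((π.A σ - Complex.I • π.B σ) ψ : H)‖ = ‖(π.V σ ψ : H)‖ := by
  have h : ((‖((π.A σ - Complex.I • π.B σ) ψ : H)‖ ^ 2 : ℝ) : ℂ) =
      ((‖(π.V σ ψ : H)‖ ^ 2 : ℝ) : ℂ) := by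
    rw [ofReal_norm_sq, ofReal_norm_sq, inner_V_V, ← V_mul_adj_V, Module.End.mul_apply,
      π.formalAdj_V σ]
  have h' : ‖((π.A σ - Complex.I • π.B σ) ψ : H)‖ ^ 2 = ‖(π.V σ ψ : H)‖ ^ 2 := by exact_mod_cast h
  exact (sq_eq_sq₀ (norm_nonneg _) (norm_nonneg _)).1 h'

/-- The adjoint of the closure is the closure of `A_σ - iB_σ`, which has the same norms as `V_σ` on
smooth vectors because `A_σ` and `B_σ` commute. The comparison of closures, used in both directions,
gives equal domains and equal norms. -/
theorem isNormalOp_cl_V (σ : Fin 4) : IsNormalOp (π.cl (π.V σ)) := by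
  have hV := π.formalAdj_V σ
  have hadj := hV.adjoint_cl (π.mollComm_V σ)
  have h1 : ∀ {x y : H}, (x, y) ∈ (π.cl (π.V σ)).graph →
      ∃ y', (x, y') ∈ (π.cl (π.V σ))†.graph ∧ ‖y'‖ ≤ ‖y‖ := by
    rw [hadj]
    exact hV.exists_mem_graph_cl hV.symm fun ψ => (π.norm_adj_V σ ψ).le
  have h2 : ∀ {x y : H}, (x, y) ∈ (π.cl (π.V σ))†.graph →
      ∃ y', (x, y') ∈ (π.cl (π.V σ)).graph ∧ ‖y'‖ ≤ ‖y‖ := by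
    rw [hadj]
    exact hV.symm.exists_mem_graph_cl hV fun ψ => (π.norm_adj_V σ ψ).ge
  refine ⟨dense_domain_cl _, isClosed_cl hV, ?_, ?_⟩
  · ext x
    constructor
    · intro hx
      obtain ⟨y, hy, -⟩ := h1 ((π.cl (π.V σ)).mem_graph ⟨x, hx⟩)
      exact LinearPMap.mem_domain_of_mem_graph hy
    · intro hx
      obtain ⟨y, hy, -⟩ := h2 ((π.cl (π.V σ))†.mem_graph ⟨x, hx⟩)
      exact LinearPMap.mem_domain_of_mem_graph hy
  · intro x y hxy
    obtain ⟨y', hy', hle⟩ := h1 ((π.cl (π.V σ)).mem_graph x)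
    obtain ⟨x', hx', hle'⟩ := h2 ((π.cl (π.V σ))†.mem_graph y)
    have e1 : y' = (π.cl (π.V σ))† y :=
      LinearPMap.mem_graph_snd_inj _ hy' ((π.cl (π.V σ))†.mem_graph y) hxy
    have e2 : x' = π.cl (π.V σ) x :=
      LinearPMap.mem_graph_snd_inj _ hx' ((π.cl (π.V σ)).mem_graph x) hxy.symm
    exact le_antisymm (e2 ▸ hle') (e1 ▸ hle)

theorem V_mem_graph_adjoint (σ : Fin 4) (ψ : π.smooth) :
    ((π.V σ ψ : H), ((π.A σ * π.A σ + π.B σ * π.B σ) ψ : H)) ∈ (π.cl (π.V σ))†.graph :=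
  (π.formalAdj_V σ).mem_graph_adjoint.2 fun χ => π.inner_V_V σ ψ χ

theorem exists_norm_cl_B_le (σ : Fin 4) {ψ : H} (hV : ψ ∈ (π.cl (π.V σ)).domain) :
    ∃ hB : ψ ∈ (π.cl (π.B σ)).domain, ‖π.cl (π.B σ) ⟨ψ, hB⟩‖ ≤ ‖π.cl (π.V σ) ⟨ψ, hV⟩‖ := by
  have hle : ∀ χ, ‖(π.B σ χ : H)‖ ≤ ‖(π.V σ χ : H)‖ := fun χ => by
    refine le_of_sq_le_sq ?_ (norm_nonneg _)
    rw [norm_V_sq]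
    exact le_add_of_nonneg_left (sq_nonneg _)
  obtain ⟨y, hy, hyle⟩ := (π.formalAdj_V σ).exists_mem_graph_cl (π.formalAdj_B σ) hle
    ((π.cl (π.V σ)).mem_graph ⟨ψ, hV⟩)
  obtain ⟨x, rfl, rfl⟩ := (LinearPMap.mem_graph_iff _).1 hy
  exact ⟨x.2, hyle⟩

end RegularRep

end

end QST

namespace QST

open Filter Topology MeasureTheory

noncomputable section

/-! ### The lower bound for the sum of the squares of the `B_σ` -/

/-- The vector `e + (e · m) m`. -/
def selfDual (s : Matrix (Fin 4) (Fin 4) ℝ) (i : Fin 3) : ℝ := elec s i + chirality s * magn s i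

/-- The length of `e + (e · m) m`. -/
def selfDualNorm (s : Matrix (Fin 4) (Fin 4) ℝ) : ℝ := √(selfDual s ⬝ᵥ selfDual s)

theorem four_le_selfDual_sq (s : jointSpectrum) : 4 ≤ selfDual s.1 ⬝ᵥ selfDual s.1 := by
  have hc := chirality_mul_self s
  obtain ⟨-, h1, -⟩ := s.2
  have hcd : chirality s.1 = elec s.1 ⬝ᵥ magn s.1 := rfl
  have e1 : selfDual s.1 ⬝ᵥ selfDual s.1 = elec s.1 ⬝ᵥ elec s.1 +
      2 * chirality s.1 * (elec s.1 ⬝ᵥ magn s.1) +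
      chirality s.1 * chirality s.1 * (magn s.1 ⬝ᵥ magn s.1) := by
    simp only [selfDual, dotProduct, Fin.sum_univ_three]
    ring
  have e2 : 0 ≤ elec s.1 ⬝ᵥ elec s.1 - 2 * chirality s.1 * (elec s.1 ⬝ᵥ magn s.1) +
      chirality s.1 * chirality s.1 * (magn s.1 ⬝ᵥ magn s.1) := by
    have : elec s.1 ⬝ᵥ elec s.1 - 2 * chirality s.1 * (elec s.1 ⬝ᵥ magn s.1) +
      chirality s.1 * chirality s.1 * (magn s.1 ⬝ᵥ magn s.1) =
      ∑ i, (elec s.1 i - chirality s.1 * magn s.1 i) ^ 2 := by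
      simp only [dotProduct, Fin.sum_univ_three]
      ring
    rw [this]
    positivity
  rw [← hcd, mul_assoc, hc, ← h1] at e1 e2
  linarith

theorem two_le_selfDualNorm (s : jointSpectrum) : 2 ≤ selfDualNorm s.1 :=
  Real.le_sqrt_of_sq_le (by linarith [four_le_selfDual_sq s])

theorem selfDualNorm_mul_self (s : jointSpectrum) :
    selfDualNorm s.1 * selfDualNorm s.1 = selfDual s.1 ⬝ᵥ selfDual s.1 :=
  Real.mul_self_sqrt (by linarith [four_le_selfDual_sq s])

/-- The unit vector in the direction of `e + (e · m) m`. -/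
def unitVec (s : Matrix (Fin 4) (Fin 4) ℝ) (i : Fin 3) : ℝ := selfDual s i / selfDualNorm s

theorem unitVec_dot_selfDual (s : jointSpectrum) :
    unitVec s.1 ⬝ᵥ selfDual s.1 = selfDualNorm s.1 := by
  have h2 := two_le_selfDualNorm s
  have h : unitVec s.1 ⬝ᵥ selfDual s.1 =
      (selfDual s.1 ⬝ᵥ selfDual s.1) / selfDualNorm s.1 := by
    simp only [unitVec, dotProduct, Fin.sum_univ_three]
    ring
  rw [h, ← selfDualNorm_mul_self, mul_self_div_self]

theorem unitVec_dot_self (s : jointSpectrum) : unitVec s.1 ⬝ᵥ unitVec s.1 = 1 := by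
  have h2 := two_le_selfDualNorm s
  have h : unitVec s.1 ⬝ᵥ unitVec s.1 =
      (selfDual s.1 ⬝ᵥ selfDual s.1) / (selfDualNorm s.1 * selfDualNorm s.1) := by
    simp only [unitVec, dotProduct, Fin.sum_univ_three]
    ring
  rw [h, selfDualNorm_mul_self, div_self]
  linarith [four_le_selfDual_sq s]

/-- The antisymmetric orthogonal matrix with the same chirality as `s` that is best aligned with
the inverse of `s`. -/
def frame (s : Matrix (Fin 4) (Fin 4) ℝ) : Matrix (Fin 4) (Fin 4) ℝ :=
  !![0, unitVec s 0, unitVec s 1, unitVec s 2;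
    -unitVec s 0, 0, chirality s * unitVec s 2, -(chirality s * unitVec s 1);
    -unitVec s 1, -(chirality s * unitVec s 2), 0, chirality s * unitVec s 0;
    -unitVec s 2, chirality s * unitVec s 1, -(chirality s * unitVec s 0), 0]

theorem frame_antisymm (s : Matrix (Fin 4) (Fin 4) ℝ) (σ ρ : Fin 4) :
    frame s σ ρ = -frame s ρ σ := by
  fin_cases σ <;> fin_cases ρ <;> simp [frame]

/-- An antisymmetric matrix with unit electric part `u` and magnetic part `±u` is orthogonal, as for
multiplication by an imaginary unit quaternion. -/
theorem frame_orthogonal (s : jointSpectrum) (ρ τ : Fin 4) :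
    ∑ σ, frame s.1 σ ρ * frame s.1 σ τ = if ρ = τ then 1 else 0 := by
  have hc := chirality_mul_self s
  have hn := unitVec_dot_self s
  simp only [dotProduct, Fin.sum_univ_three] at hn
  fin_cases ρ <;> fin_cases τ <;> simp [frame, Fin.sum_univ_four] <;> grind

/-- With `c = e·m`, the inverse has electric part `cm` and magnetic part `ce`, while `frame` has `u`
and `cu`; the contraction is `2 u·(e + cm)`, largest for the chosen unit vector `u`. -/
theorem frame_dot_inv (s : jointSpectrum) :
    ∑ σ, ∑ ρ, frame s.1 σ ρ * (s.1ᵀ)⁻¹ σ ρ = 2 * selfDualNorm s.1 := by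
  have hc := chirality_mul_self s
  rw [← unitVec_dot_selfDual, inv_transpose_eq]
  simp only [frame, dualMatrix, selfDual, dotProduct, Fin.sum_univ_four, Fin.sum_univ_three, elec,
    magn, Matrix.smul_apply, smul_eq_mul]
  simp
  grind

theorem abs_frame_le (s : jointSpectrum) (σ ρ : Fin 4) : |frame s.1 σ ρ| ≤ 1 := by
  have h := frame_orthogonal s ρ ρ
  rw [if_pos rfl] at h
  rw [← sq_le_one_iff_abs_le_one, ← h, sq]
  exact Finset.single_le_sum (f := fun σ => frame s.1 σ ρ * frame s.1 σ ρ)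
    (fun _ _ => mul_self_nonneg _) (Finset.mem_univ σ)

theorem continuous_matrix_elem (μ ν : Fin 4) : Continuous fun s : jointSpectrum => s.1 μ ν :=
  continuous_subtype_val.matrix_elem μ ν

theorem continuous_chirality : Continuous fun s : jointSpectrum => chirality s.1 := by
  have := continuous_matrix_elem
  simp only [chirality, elec, magn, dotProduct, Fin.sum_univ_three]
  exact (((this 0 1).mul (this 2 3)).add ((this 0 2).mul (this 3 1))).add
    ((this 0 3).mul (this 1 2))

theorem continuous_selfDual (i : Fin 3) : Continuous fun s : jointSpectrum => selfDual s.1 i := by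
  have h := continuous_chirality
  have h' := continuous_matrix_elem
  fin_cases i
  · exact (h' 0 1).add (h.mul (h' 2 3))
  · exact (h' 0 2).add (h.mul (h' 3 1))
  · exact (h' 0 3).add (h.mul (h' 1 2))

theorem continuous_selfDualNorm : Continuous fun s : jointSpectrum => selfDualNorm s.1 := by
  unfold selfDualNorm dotProduct
  have := continuous_selfDual
  fun_prop

theorem continuous_unitVec (i : Fin 3) : Continuous fun s : jointSpectrum => unitVec s.1 i :=
  (continuous_selfDual i).div continuous_selfDualNorm fun s => by
    linarith [two_le_selfDualNorm s]

theorem continuous_frame (σ ρ : Fin 4) : Continuous fun s : jointSpectrum => frame s.1 σ ρ := by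
  have h1 := continuous_chirality
  have h2 := continuous_unitVec
  fin_cases σ <;> fin_cases ρ <;> simp [frame] <;> fun_prop

/-- The entries of `frame` as bounded continuous functions on the joint spectrum. -/
def frameEntry (σ ρ : Fin 4) : jointSpectrum →ᵇ ℂ :=
  BoundedContinuousFunction.ofNormedAddCommGroup (fun s => (frame s.1 σ ρ : ℂ))
    (Complex.continuous_ofReal.comp (continuous_frame σ ρ)) 1 fun s => by
      rw [Complex.norm_real]; exact abs_frame_le s σ ρ

theorem frameEntry_apply (σ ρ : Fin 4) (s : jointSpectrum) :
    frameEntry σ ρ s = (frame s.1 σ ρ : ℂ) := rfl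

theorem star_frameEntry (σ ρ : Fin 4) : star (frameEntry σ ρ) = frameEntry σ ρ := by
  ext s
  exact Complex.conj_ofReal _

theorem frameEntry_antisymm (σ ρ : Fin 4) : frameEntry σ ρ = -frameEntry ρ σ := by
  ext s
  rw [BoundedContinuousFunction.neg_apply, frameEntry_apply, frameEntry_apply, frame_antisymm]
  push_cast
  rfl

theorem sum_frameEntry_mul (ρ τ : Fin 4) :
    ∑ σ, frameEntry σ ρ * frameEntry σ τ = if ρ = τ then 1 else 0 := by
  ext s
  have h := congrArg (fun x : ℝ => (x : ℂ)) (frame_orthogonal s ρ τ)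
  simp only [Complex.ofReal_sum, Complex.ofReal_mul] at h
  rw [BoundedContinuousFunction.coe_sum, Finset.sum_apply]
  simp only [BoundedContinuousFunction.mul_apply, frameEntry_apply]
  rw [h]
  split_ifs <;> simp

variable {H : Type*} [NormedAddCommGroup H] [InnerProductSpace ℂ H] [CompleteSpace H]

namespace RegularRep

variable (π : RegularRep H)

theorem isCentralApply_central (f : jointSpectrum →ᵇ ℂ) (ψ : H) :
    π.IsCentralApply f ψ (π.central f ψ) := fun g h _ hh => by
  have : h = g * f := by
    ext s
    rw [hh, mul_comm]
    rfl
  rw [this, central_mul_apply]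

/-- A function of `Q` that is bounded below by `a` is an operator bounded below by `a`. -/
theorem IsCentralApply.le_re_inner {π : RegularRep H} {r : jointSpectrum → ℝ} (hr : Continuous r)
    {a : ℝ} (ha : ∀ s, a ≤ r s) {ψ φ : H} (h : π.IsCentralApply (fun s => (r s : ℂ)) ψ φ) :
    a * ‖ψ‖ ^ 2 ≤ (inner ℂ ψ φ : ℂ).re := by
  have key : ∀ m, a * ‖π.central (cutoff m) ψ‖ ^ 2 ≤
      (inner ℂ (π.central (cutoff m) ψ) (π.central (cutoff m) φ) : ℂ).re := fun m => by
    set f : C(jointSpectrum, ℂ) := ⟨fun s => (r s : ℂ), by fun_prop⟩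
    -- The nonnegative function `r - a` is written as a square, so that after the cutoff the claim
    -- becomes nonnegativity of a squared norm.
    set k : C(jointSpectrum, ℂ) := ⟨fun s => ((√(r s - a) : ℝ) : ℂ), by fun_prop⟩
    set c := cutoff m
    have hc : HasCompactSupport c := hasCompactSupport_cutoff m
    have hcs : star c = c := star_cutoff m
    have hks : star (cutMul k c hc) = cutMul k c hc := by
      ext s
      have : star (c s) = c s := congrArg (fun f : jointSpectrum →ᵇ ℂ => f s) hcs
      rw [BoundedContinuousFunction.star_apply, cutMul_apply, star_mul', this]
      congr 1
      exact Complex.conj_ofReal _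
    have e1 : π.central c φ = π.central (cutMul f c hc) ψ := ((π.isCentralApply_iff f ψ φ).1 h c hc).symm
    have e2 : cutMul k c hc * cutMul k c hc = c * cutMul f c hc - (a : ℂ) • (c * c) := by
      ext s
      have hs : ((√(r s - a) : ℝ) : ℂ) * ((√(r s - a) : ℝ) : ℂ) = (r s : ℂ) - a := by
        rw [← Complex.ofReal_mul, Real.mul_self_sqrt (sub_nonneg.2 (ha s)), Complex.ofReal_sub]
      change (((√(r s - a) : ℝ) : ℂ) * c s) * (((√(r s - a) : ℝ) : ℂ) * c s) =
        c s * ((r s : ℂ) * c s) - a * (c s * c s)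
      linear_combination (c s * c s) * hs
    have e3 : inner ℂ (π.central (cutMul k c hc) ψ) (π.central (cutMul k c hc) ψ) =
        inner ℂ (π.central c ψ) (π.central c φ) -
          (a : ℂ) * inner ℂ (π.central c ψ) (π.central c ψ) := by
      rw [central_inner_left, hks, ← central_mul_apply, e2, e1, central_inner_left _ c, hcs,
        central_inner_left _ c, hcs, ← central_mul_apply, ← central_mul_apply, map_sub, map_smul,
        _root_.sub_apply, _root_.smul_apply, inner_sub_right, inner_smul_right]
    rw [← ofReal_norm_sq, ← ofReal_norm_sq] at e3
    have e4 := congrArg Complex.re e3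
    rw [Complex.sub_re, ← Complex.ofReal_mul, Complex.ofReal_re, Complex.ofReal_re] at e4
    linarith [sq_nonneg ‖π.central (cutMul k c hc) ψ‖]
  have l1 := ((π.tendsto_central_cutoff ψ).norm.pow 2).const_mul a
  have l2 := (Complex.continuous_re.tendsto _).comp
    ((π.tendsto_central_cutoff ψ).inner (𝕜 := ℂ) (π.tendsto_central_cutoff φ))
  exact le_of_tendsto_of_tendsto' l1 l2 key

theorem Q_comm_centralEnd (f : jointSpectrum →ᵇ ℂ) (μ ν : Fin 4) :
    Commute (π.Q μ ν) (π.centralEnd f) :=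
  ((((π.q_comm_centralEnd f _ _).mul_left (π.q_comm_centralEnd f _ _)).sub_left
    ((π.q_comm_centralEnd f _ _).mul_left (π.q_comm_centralEnd f _ _)))).smul_left _

theorem B_comm_centralEnd (f : jointSpectrum →ᵇ ℂ) (σ : Fin 4) :
    Commute (π.B σ) (π.centralEnd f) := by
  have hy : ∀ ρ, Commute (π.y ρ) (π.centralEnd f) := fun ρ =>
    (((π.q_comm_centralEnd f _ _).sub_left (π.q_comm_centralEnd f _ _)).add_left
      (π.q_comm_centralEnd f _ _)).sub_left (π.q_comm_centralEnd f _ _)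
  rw [B_eq]
  exact (((π.Q_comm_centralEnd f _ _).mul_left (hy _)).add_left
    ((π.Q_comm_centralEnd f _ _).mul_left (hy _))).add_left
    ((π.Q_comm_centralEnd f _ _).mul_left (hy _))

/-- The vector `Σ S_{σρ} b_ρ`, with `S` the orthogonal matrix `frame`. -/
def rotate (b : Fin 4 → H) (σ : Fin 4) : H := ∑ ρ, π.central (frameEntry σ ρ) (b ρ)

theorem sum_norm_rotate_sq (b : Fin 4 → H) : ∑ σ, ‖π.rotate b σ‖ ^ 2 = ∑ σ, ‖b σ‖ ^ 2 := by
  have h : ∑ σ, inner ℂ (π.rotate b σ) (π.rotate b σ) = ∑ σ, inner ℂ (b σ) (b σ) := by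
    have e : ∀ σ, inner ℂ (π.rotate b σ) (π.rotate b σ) =
        ∑ ρ, ∑ τ, inner ℂ (b ρ) (π.central (frameEntry σ ρ * frameEntry σ τ) (b τ)) := fun σ => by
      simp only [rotate, sum_inner, inner_sum]
      rw [Finset.sum_comm]
      refine Finset.sum_congr rfl fun ρ _ => Finset.sum_congr rfl fun τ _ => ?_
      rw [central_inner_left, star_frameEntry, central_mul_apply]
    simp only [e]
    rw [Finset.sum_comm]
    refine Finset.sum_congr rfl fun ρ _ => ?_
    rw [Finset.sum_comm]
    have e' : ∀ τ, ∑ σ, inner ℂ (b ρ) (π.central (frameEntry σ ρ * frameEntry σ τ) (b τ)) =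
        if ρ = τ then inner ℂ (b ρ) (b τ) else 0 := fun τ => by
      rw [← inner_sum, ← _root_.sum_apply, ← map_sum, sum_frameEntry_mul]
      split_ifs <;> simp
    simp only [e']
    simp
  simp only [← ofReal_norm_sq] at h
  exact_mod_cast h

/-- By antisymmetry of `frame`, `Σ S_{σρ} B_σ B_ρ` is half of `Σ S_{σρ} [B_σ, B_ρ]`, which is `4i Σ
S_{σρ} Q⁻¹_{σρ}`. The witness `φ` is `(4i)⁻¹` times the sum of commutators weighted by `S`, hence
the prefactor `2i`. -/
theorem sum_inner_rotate (ψ : π.smooth) : ∃ φ : H,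
    π.IsCentralApply (fun s => ((2 * selfDualNorm s.1 : ℝ) : ℂ)) ψ φ ∧
    ∑ σ, inner ℂ (π.B σ ψ : H) (π.rotate (fun ρ => (π.B ρ ψ : H)) σ) =
      2 * Complex.I * inner ℂ (ψ : H) φ := by
  set K : Fin 4 → Fin 4 → H := fun σ ρ => ((π.B σ * π.B ρ - π.B ρ * π.B σ) ψ : π.smooth)
  have hinv : ∀ σ ρ, Continuous fun s : jointSpectrum => 4 * Complex.I * ((s.1ᵀ)⁻¹ σ ρ : ℂ) := by
    intro σ ρ
    have e : (fun s : jointSpectrum => 4 * Complex.I * ((s.1ᵀ)⁻¹ σ ρ : ℂ)) =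
        fun s => 4 * Complex.I * ((chirality s.1 : ℂ) * dualEntry σ ρ s) := by
      funext s
      rw [inv_transpose_eq, dualEntry_apply, Matrix.smul_apply, smul_eq_mul, Complex.ofReal_mul]
    rw [e]
    have := continuous_chirality
    fun_prop
  have hK : ∀ σ ρ, π.IsCentralApply (⟨_, hinv σ ρ⟩ : C(jointSpectrum, ℂ)) ψ (K σ ρ) :=
    fun σ ρ => π.B_commutator_isCentralApply σ ρ ψ
  have hsum := (isCentralApply_sum Finset.univ fun σ _ => isCentralApply_sum Finset.univ fun ρ _ =>
    (hK σ ρ).comp (f' := (frameEntry σ ρ).toContinuousMap)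
      (π.isCentralApply_central (frameEntry σ ρ) (K σ ρ))).smul (4 * Complex.I)⁻¹
  refine ⟨_, fun g k hg hk => hsum g k hg fun s => ?_, ?_⟩
  · refine (hk s).trans (congrArg (· * g s) ?_)
    change ((2 * selfDualNorm s.1 : ℝ) : ℂ) = _
    rw [← frame_dot_inv]
    simp only [ContinuousMap.smul_apply, ContinuousMap.coe_sum, Finset.sum_apply,
      ContinuousMap.mul_apply, smul_eq_mul, Finset.mul_sum, Complex.ofReal_sum, Complex.ofReal_mul]
    refine Finset.sum_congr rfl fun σ _ => Finset.sum_congr rfl fun ρ _ => ?_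
    change _ = (4 * Complex.I)⁻¹ * (4 * Complex.I * ((s.1ᵀ)⁻¹ σ ρ : ℂ) * (frame s.1 σ ρ : ℂ))
    rw [mul_assoc, inv_mul_cancel_left₀ (by simp), mul_comm]
  · set t : Fin 4 → Fin 4 → ℂ := fun σ ρ =>
      inner ℂ (ψ : H) (π.central (frameEntry σ ρ) (π.B σ (π.B ρ ψ) : π.smooth))
    set t' : Fin 4 → Fin 4 → ℂ := fun σ ρ =>
      inner ℂ (ψ : H) (π.central (frameEntry σ ρ) (π.B ρ (π.B σ ψ) : π.smooth))
    have e1 : ∑ σ, inner ℂ (π.B σ ψ : H) (π.rotate (fun ρ => (π.B ρ ψ : H)) σ) =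
        ∑ σ, ∑ ρ, t σ ρ := by
      refine Finset.sum_congr rfl fun σ _ => ?_
      rw [rotate, inner_sum]
      refine Finset.sum_congr rfl fun ρ _ => ?_
      have h := π.formalAdj_B σ ψ (π.centralEnd (frameEntry σ ρ) (π.B ρ ψ))
      have h' := LinearMap.congr_fun (π.B_comm_centralEnd (frameEntry σ ρ) σ).eq (π.B ρ ψ)
      rw [Module.End.mul_apply, Module.End.mul_apply] at h'
      rw [h'] at h
      exact h
    have e2 : ∑ σ, ∑ ρ, t σ ρ = -∑ σ, ∑ ρ, t' σ ρ := by
      rw [Finset.sum_comm, ← Finset.sum_neg_distrib]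
      refine Finset.sum_congr rfl fun ρ _ => ?_
      rw [← Finset.sum_neg_distrib]
      refine Finset.sum_congr rfl fun σ _ => ?_
      simp only [t, t']
      rw [frameEntry_antisymm, map_neg, _root_.neg_apply, inner_neg_right]
    have e3 : ∑ σ, ∑ ρ, inner ℂ (ψ : H) (π.central (frameEntry σ ρ) (K σ ρ)) =
        ∑ σ, ∑ ρ, t σ ρ - ∑ σ, ∑ ρ, t' σ ρ := by
      rw [← Finset.sum_sub_distrib]
      refine Finset.sum_congr rfl fun σ _ => ?_
      rw [← Finset.sum_sub_distrib]
      refine Finset.sum_congr rfl fun ρ _ => ?_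
      simp only [t, t', K, LinearMap.sub_apply, Submodule.coe_sub, map_sub, inner_sub_right,
        Module.End.mul_apply]
    rw [inner_smul_right, inner_sum]
    simp only [inner_sum]
    rw [e3, e1]
    generalize ∑ σ, ∑ ρ, t σ ρ = x at e2
    generalize ∑ σ, ∑ ρ, t' σ ρ = y at e2
    have hI : 2 * Complex.I * ((4 * Complex.I)⁻¹ * (x - y)) = (x - y) / 2 := by
      field_simp
      norm_num
    rw [hI]
    linear_combination e2 / 2

theorem eight_le_sum_norm_B_sq (ψ : π.smooth) :
    8 * ‖(ψ : H)‖ ^ 2 ≤ ∑ σ, ‖(π.B σ ψ : H)‖ ^ 2 := by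
  obtain ⟨φ, hφ, hsum⟩ := π.sum_inner_rotate ψ
  set b : Fin 4 → H := fun ρ => (π.B ρ ψ : H) with hb
  have h4 := hφ.le_re_inner (continuous_selfDualNorm.const_mul 2) (a := 4)
    fun s => by linarith [two_le_selfDualNorm s]
  -- Completing the square: the rotation preserves the total norm, so the sum over σ is twice the
  -- quantity sought minus the expectation in `h4`, taken four times; `16/2 = 8`.
  have h1 : ∀ σ, ‖b σ + Complex.I • π.rotate b σ‖ ^ 2 = ‖b σ‖ ^ 2 + ‖π.rotate b σ‖ ^ 2 +
      2 * (Complex.I * inner ℂ (b σ) (π.rotate b σ)).re := fun σ => by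
    rw [norm_add_sq (𝕜 := ℂ), norm_smul, Complex.norm_I, one_mul, inner_smul_right]
    change _ + 2 * (Complex.I * _).re + _ = _
    ring
  have h2 : ∑ σ, ‖b σ + Complex.I • π.rotate b σ‖ ^ 2 =
      2 * ∑ σ, ‖b σ‖ ^ 2 - 4 * (inner ℂ (ψ : H) φ : ℂ).re := by
    simp only [h1, Finset.sum_add_distrib, sum_norm_rotate_sq, ← Finset.mul_sum,
      ← Complex.re_sum]
    rw [hsum, ← mul_assoc]
    have : Complex.I * (2 * Complex.I) = ((-2 : ℝ) : ℂ) := by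
      push_cast; linear_combination 2 * Complex.I_sq
    rw [this, Complex.re_ofReal_mul]
    ring
  have h3 : 0 ≤ ∑ σ, ‖b σ + Complex.I • π.rotate b σ‖ ^ 2 := by positivity
  rw [h2] at h3
  linarith

/-- The sequences that define the four closures at `ψ` may differ. The mollified vectors form one
smooth sequence along which all four `B_σ` converge, so the bound on smooth vectors passes to the
limit; the choice of 0 as the fine direction is arbitrary. -/
theorem eight_le_sum_norm_cl_B_sq (ψ : H) (hB : ∀ σ, ψ ∈ (π.cl (π.B σ)).domain) :
    8 * ‖ψ‖ ^ 2 ≤ ∑ σ, ‖π.cl (π.B σ) ⟨ψ, hB σ⟩‖ ^ 2 := by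
  set b : Fin 4 → H := fun σ => π.cl (π.B σ) ⟨ψ, hB σ⟩
  have hb : ∀ σ, π.AdjPair (π.B σ) ψ (b σ) := fun σ =>
    (π.formalAdj_B σ).adjPair_of_mem_graph ((π.cl (π.B σ)).mem_graph ⟨ψ, hB σ⟩)
  have hm : ∀ m, 8 * ‖π.central (cutoffPow m) ψ‖ ^ 2 ≤
      ∑ σ, ‖π.central (cutoffPow m) (b σ)‖ ^ 2 := fun m =>
    le_of_tendsto_of_tendsto' (((π.tendsto_approx 0 m ψ).norm.pow 2).const_mul 8)
      (tendsto_finsetSum _ fun σ _ => (tendsto_apply_approx (π.formalAdj_B σ)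
        (π.mollComm_B 0 σ) (hb σ) m).norm.pow 2) fun n => π.eight_le_sum_norm_B_sq _
  exact le_of_tendsto_of_tendsto' (((π.tendsto_central_cutoffPow ψ).norm.pow 2).const_mul 8)
    (tendsto_finsetSum _ fun σ _ => (π.tendsto_central_cutoffPow (b σ)).norm.pow 2) hm

end RegularRep

end

end QST
-- The main theorem, assembled.
theorem mainTheorem2 {H : Type*} [NormedAddCommGroup H] [InnerProductSpace ℂ H] [CompleteSpace H]
    (π : QST.RegularRep H) :
    -- the coordinates of the four events have the common central commutator `Q`
    (∀ j k μ ν, π.q j μ * π.q k ν - π.q k ν * π.q j μ =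
      if j = k then Complex.I • π.Q μ ν else 0) ∧
    (∀ μ ν (ψ : π.smooth), π.IsCentralApply
      (fun s => ((s : Matrix (Fin 4) (Fin 4) ℝ) μ ν : ℂ)) ψ (π.Q μ ν ψ)) ∧
    -- `V = A + i B` with commuting selfadjoint `A`, `B`, and `V` is normal
    (∀ σ, π.V σ = π.A σ + Complex.I • π.B σ) ∧
    (∀ σ, IsSelfAdjoint (π.cl (π.A σ)) ∧ IsSelfAdjoint (π.cl (π.B σ))) ∧
    (∀ σ, Commute (π.A σ) (π.B σ)) ∧
    (∀ σ, QST.IsNormalOp (π.cl (π.V σ))) ∧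
    -- `[B_σ, B_ρ] = 4 i Q⁻¹_{σρ}`, with `Q⁻¹` normalized by `Q⁻¹_{σρ} Q^{μρ} = δ^μ_σ`
    (∀ σ ρ (ψ : π.smooth), π.IsCentralApply
      (fun s => 4 * Complex.I * (((s : Matrix (Fin 4) (Fin 4) ℝ)ᵀ)⁻¹ σ ρ : ℂ)) ψ
      ((π.B σ * π.B ρ - π.B ρ * π.B σ) ψ)) ∧
    -- `V_σ* V_σ = A_σ² + B_σ²` on the smooth vectors
    (∀ σ (ψ : π.smooth),
      ((π.V σ ψ : H), ((π.A σ * π.A σ + π.B σ * π.B σ) ψ : H)) ∈ (π.cl (π.V σ))†.graph) ∧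
    -- `∑ V_σ* V_σ ≥ ∑ B_σ²`, as quadratic forms
    (∀ (ψ : H) (hV : ∀ σ, ψ ∈ (π.cl (π.V σ)).domain), ∃ hB : ∀ σ, ψ ∈ (π.cl (π.B σ)).domain,
      ∑ σ, ‖π.cl (π.B σ) ⟨ψ, hB σ⟩‖ ^ 2 ≤ ∑ σ, ‖π.cl (π.V σ) ⟨ψ, hV σ⟩‖ ^ 2) ∧
    -- `∑ B_σ² ≥ 8`, as quadratic forms
    (∀ (ψ : H) (hB : ∀ σ, ψ ∈ (π.cl (π.B σ)).domain),
      8 * ‖ψ‖ ^ 2 ≤ ∑ σ, ‖π.cl (π.B σ) ⟨ψ, hB σ⟩‖ ^ 2) := by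
  refine ⟨π.q_commutator, π.Q_isCentralApply, π.V_eq,
    fun σ => ⟨π.isSelfAdjoint_cl_A σ, π.isSelfAdjoint_cl_B σ⟩, π.A_comm_B, π.isNormalOp_cl_V,
    π.B_commutator_isCentralApply, π.V_mem_graph_adjoint, fun ψ hV => ?_,
    π.eight_le_sum_norm_cl_B_sq⟩
  choose hB hle using fun σ => π.exists_norm_cl_B_le σ (hV σ)
  exact ⟨hB, Finset.sum_le_sum fun σ _ => pow_le_pow_left₀ (norm_nonneg _) (hle σ) 2⟩
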